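/- **Pinecones.** A *pinecone of width $2k-1$ rooted at* $o=(a,b)\in\mathbb Z^2$ ($a+b$ even) is a subgraph $P$ of the square lattice such that, up to translation by $-o$: for some $i\ge 1$, $j\ge 0$ its horizontal edges form $i+j+1$ segments of odd lengths, starting from $(0,1),(1,2),\dots,(i-1,i)$ and $(0,0),(1,-1),\dots,(j,-j)$, and the length $L_m$ of the segment at ordinate $m$ satisfies $L_{-j}<\dots<L_{-1}<L_0=2k-1=L_1>L_2>\dots>L_i$; its vertices are the endpoints of these horizontal edges; and it contains every vertical lattice edge $\{(x,y),(x,y+1)\}$ with $x+y$ even joining two of its vertices (those with $x+y$ odd may be present or absent). It is *closed* if it has no vertex of degree $1$. The empty graph is also regarded as a closed pinecone (with matching polynomial $1$). Row $r$ is the strip between ordinates $r$ and $r+1$. A *black square* of $P$ in row $r$ is a unit cell with lower-left corner $(x,r)$, $x+r$ even, whose four sides are edges of $P$. A closed pinecone is *interleaved* if between any two black squares in a row $r$ there are a black square in row $r+1$ and one in row $r-1$. **Sub-pinecones.** The *core at* $o'$ of a graph $Q$ is the union of all closed pinecones rooted at $o'$ that are subgraphs of $Q$ (the empty graph if there are none).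 A *diamond graph* of width $2n-1$ consists of rows of $1,3,\dots,2n-3,2n-1,2n-3,\dots,3,1$ unit squares stacked with aligned middle squares (empty if $n\le 0$). For a closed pinecone $P$ of width $2k-1$ rooted at $o$, let $A$ be the smallest diamond graph containing $P$ (it has width $2k-1$ and the same longest row as $P$), and let $G$ be the spanning subgraph of $A$ whose edges are those of $P$, all horizontal edges of $A$, and all vertical edges $\{(x,y),(x,y+1)\}$ of $A$ with $x+y$ even. Let $A_N,A_S,A_W,A_E$ be the diamond graphs of width $2k-3$ whose centres are the centre of $A$ translated by $(0,1),(0,-1),(-1,0),(1,0)$, and $A_C$ the one of width $2k-5$ with the same centre as $A$. Then $P^N,P^S,P^W,P^E,P^C$ are the cores of $G\cap A_N$, $G\cap A_S$, $G\cap A_W$, $G\cap A_E$, $G\cap A_C$ at $o+(1,1)$, $o+(1,-1)$, $o$, $o+(2,0)$, $o+(2,0)$ respectively. **Partial matching polynomial.** Treat edges as commuting indeterminates. The matching polynomial of a finite graph $P$ is $M(P)=\sum_{E'}\prod_{e\in E'}e$, over all perfect matchings $E'$ of $P$. A horizontal edge of $P$ with leftmost vertex $(x,r)$ is *ordinary*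 if, among the black squares of $P$ in rows $r-1$ and $r$ whose lower-left corner has abscissa $\ge x$, there is a closest one to the edge and it lies in row $r-1$ when $x+r$ is even, respectively in row $r$ when $x+r$ is odd. The partial matching polynomial $\tilde M(P)$ is obtained from $M(P)$ by setting all ordinary edges of $P$ to $1$. **Statement.** Let $P$ be a (nonempty) interleaved closed pinecone. Let $a$ and $a'$ be the highest and lowest left edges of $P$ (a left edge being the leftmost edge of one of the horizontal segments), and let $e$ and $w$ be the eastmost and westmost vertical edges of $P$. Then $$\tilde M(P)\,\tilde M(P^C)=a\,a'\,\tilde M(P^W)\,\tilde M(P^E)+e\,w\,\tilde M(P^N)\,\tilde M(P^S).$$ -/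

import Mathlib

open MvPolynomial

/-- The square lattice: vertices `ℤ × ℤ`, two vertices being adjacent when they are at
distance `1`. -/
def squareLattice : SimpleGraph (ℤ × ℤ) where
  Adj u v := (u.2 = v.2 ∧ (v.1 = u.1 + 1 ∨ u.1 = v.1 + 1)) ∨
    (u.1 = v.1 ∧ (v.2 = u.2 + 1 ∨ u.2 = v.2 + 1))
  symm := ⟨by rintro u v h; omega⟩
  loopless := ⟨by rintro u h; omega⟩

/-- Subgraphs of the square lattice: a set of vertices together with a set of lattice edges
between these vertices. -/
abbrev LatticeGraph := squareLattice.Subgraph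

/-- An edge of the square lattice, as an unordered pair of vertices. -/
abbrev LEdge := Sym2 (ℤ × ℤ)

/-- The horizontal edge with leftmost vertex `v`. -/
def hEdge (v : ℤ × ℤ) : LEdge := s(v, (v.1 + 1, v.2))

/-- The vertical edge with lower vertex `v`. -/
def vEdge (v : ℤ × ℤ) : LEdge := s(v, (v.1, v.2 + 1))

namespace LatticeGraph

/-! ### Perfect matchings and matching polynomials -/

/-- `E'` is a perfect matching of `P`: a set of edges of `P` such that every vertex of `P`
belongs to exactly one of them. -/
def IsPM (P : LatticeGraph) (E' : Finset LEdge) : Prop :=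
  (E' : Set LEdge) ⊆ P.edgeSet ∧ ∀ v ∈ P.verts, ∃! e, e ∈ E' ∧ v ∈ e

/-- The matching polynomial `M(P) = ∑_{E'} ∏_{e ∈ E'} e`, the edges being commuting
indeterminates (a genuine finite sum as soon as `P` is finite). -/
noncomputable def matchingPoly (P : LatticeGraph) : MvPolynomial LEdge ℤ :=
  ∑ᶠ E' ∈ {E' : Finset LEdge | IsPM P E'}, ∏ e ∈ E', X e

/-! ### Pinecones -/

/-- Relative abscissa at which the horizontal segment at relative ordinate `m` starts:
the segments start from `(0,1), (1,2), (2,3), …` and `(0,0), (1,-1), (2,-2), …`. -/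
def segStart (m : ℤ) : ℤ := if 1 ≤ m then m - 1 else -m

/-- `P` is a (possibly transplanted) pinecone of width `2k-1` whose leftmost vertices are
`o` and `o + (0,1)`, where the sum of the coordinates of `o` is even. It is a standard
pinecone when `o = (0,0)`. The horizontal segments occupy the relative ordinates
`-j, …, i`, and `L m` is the length of the segment at relative ordinate `m`. -/
def IsPinecone (o : ℤ × ℤ) (k : ℕ) (P : LatticeGraph) : Prop :=
  Even (o.1 + o.2) ∧
  ∃ (i j : ℕ) (L : ℤ → ℕ), 1 ≤ i ∧
    (∀ m : ℤ, -(j : ℤ) ≤ m → m ≤ i → Odd (L m)) ∧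
    (L 0 : ℤ) = 2 * k - 1 ∧ L 1 = L 0 ∧
    (∀ m : ℤ, 1 ≤ m → m < i → L (m + 1) < L m) ∧
    (∀ m : ℤ, -(j : ℤ) ≤ m → m < 0 → L m < L (m + 1)) ∧
    -- the horizontal edges
    (∀ x y : ℤ, P.Adj (x, y) (x + 1, y) ↔
      -(j : ℤ) ≤ y - o.2 ∧ y - o.2 ≤ i ∧
      segStart (y - o.2) ≤ x - o.1 ∧ x - o.1 < segStart (y - o.2) + L (y - o.2)) ∧
    -- the vertices are the endpoints of the horizontal edges
    (∀ x y : ℤ, (x, y) ∈ P.verts ↔ P.Adj (x, y) (x + 1, y) ∨ P.Adj (x - 1, y) (x, y)) ∧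
    -- all even vertical edges are present; odd ones may be present or absent
    (∀ x y : ℤ, Even (x + y) → (x, y) ∈ P.verts → (x, y + 1) ∈ P.verts →
      P.Adj (x, y) (x, y + 1))

/-- A graph is closed if it contains no vertex of degree `1`. -/
def IsClosed (P : LatticeGraph) : Prop :=
  ∀ v ∈ P.verts, (P.neighborSet v).ncard ≠ 1

/-- The cell with lower-left corner `(x, y)` is a black square of `P`: it is a black cell
(the cell with lower-left corner `(0,0)` being black) and its four sides are edges of `P`. -/
def IsBlackSquare (P : LatticeGraph) (x y : ℤ) : Prop :=
  Even (x + y) ∧ P.Adj (x, y) (x + 1, y) ∧ P.Adj (x, y + 1) (x + 1, y + 1) ∧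
    P.Adj (x, y) (x, y + 1) ∧ P.Adj (x + 1, y) (x + 1, y + 1)

/-- Between two black squares in row `r` there is a black square in row `r + 1` and one in
row `r - 1`. -/
def IsInterleaved (P : LatticeGraph) : Prop :=
  ∀ r x x' : ℤ, x < x' → IsBlackSquare P x r → IsBlackSquare P x' r →
    (∃ z, x < z ∧ z < x' ∧ IsBlackSquare P z (r + 1)) ∧
    (∃ z, x < z ∧ z < x' ∧ IsBlackSquare P z (r - 1))

/-- The core at `o`: the largest closed sub-pinecone of `Q` whose leftmost vertices are
`o` and `o + (0,1)`, that is, the union of all closed sub-pinecones of `Q` rooted there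
(the empty graph, which is also a closed pinecone, contributes nothing to the union). -/
def core (o : ℤ × ℤ) (Q : LatticeGraph) : LatticeGraph :=
  sSup {R | R ≤ Q ∧ IsClosed R ∧ ∃ k : ℕ, IsPinecone o k R}

/-! ### Diamond graphs and the five sub-pinecones -/

/-- The square with lower-left corner `c`, as a graph with four vertices and four edges. -/
def square (c : ℤ × ℤ) : LatticeGraph where
  verts := {v | (v.1 = c.1 ∨ v.1 = c.1 + 1) ∧ (v.2 = c.2 ∨ v.2 = c.2 + 1)}
  Adj u v := squareLattice.Adj u v ∧
    ((u.1 = c.1 ∨ u.1 = c.1 + 1) ∧ (u.2 = c.2 ∨ u.2 = c.2 + 1)) ∧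
    ((v.1 = c.1 ∨ v.1 = c.1 + 1) ∧ (v.2 = c.2 ∨ v.2 = c.2 + 1))
  adj_sub h := h.1
  edge_vert h := h.2.1
  symm := ⟨fun _ _ h => ⟨h.1.symm, h.2.2, h.2.1⟩⟩

/-- The diamond graph of width `2n-1` whose central cell has lower-left corner `c`: rows of
`1, 3, …, 2n-3, 2n-1, 2n-3, …, 3, 1` squares stacked with their middle squares aligned.
It is empty if `n ≤ 0`. -/
def diamond (c : ℤ × ℤ) (n : ℤ) : LatticeGraph :=
  ⨆ d ∈ {d : ℤ × ℤ | |d.1| + |d.2| < n}, square (c + d)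

/-- The central cell of a pinecone or diamond graph of width `2k-1` with leftmost vertices
`o` and `o + (0,1)`. -/
def centre (o : ℤ × ℤ) (k : ℕ) : ℤ × ℤ := (o.1 + k - 1, o.2)

/-- The graph `G` obtained by completing a pinecone `P` of width `2k-1` rooted at `o`. Here
`A` is the smallest diamond graph containing `P`, namely the diamond graph with the same
longest row as `P`, and `G` is the spanning subgraph of `A` whose edges are the edges of `P`,
all horizontal edges of `A` and all even vertical edges of `A`. -/
def completion (o : ℤ × ℤ) (k : ℕ) (P : LatticeGraph) : LatticeGraph where
  verts := (diamond (centre o k) k).verts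
  Adj u v := (diamond (centre o k) k).Adj u v ∧
    (P.Adj u v ∨ u.2 = v.2 ∨ (u.1 = v.1 ∧ Even (u.1 + min u.2 v.2)))
  adj_sub h := h.1.adj_sub
  edge_vert h := h.1.fst_mem
  symm := ⟨by
    rintro u v ⟨h, h'⟩
    refine ⟨h.symm, ?_⟩
    rcases h' with h' | h' | ⟨h', h''⟩
    · exact Or.inl h'.symm
    · exact Or.inr (Or.inl h'.symm)
    · exact Or.inr (Or.inr ⟨h'.symm, by rwa [min_comm, ← h']⟩)⟩

/-- `P^N`: the core of `G ∩ A_N`, where `A_N` is the North sub-diamond of `A` (obtained by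
deleting the leftmost and rightmost squares of `A` and the two lowest squares of each of the
remaining columns); its leftmost cell is that of `A` translated by `(1,1)`. -/
def subN (o : ℤ × ℤ) (k : ℕ) (P : LatticeGraph) : LatticeGraph :=
  core (o + (1, 1)) (completion o k P ⊓ diamond (centre o k + (0, 1)) (k - 1))

/-- `P^S`: the core of `G ∩ A_S`, where `A_S` is the South sub-diamond of `A`. -/
def subS (o : ℤ × ℤ) (k : ℕ) (P : LatticeGraph) : LatticeGraph :=
  core (o + (1, -1)) (completion o k P ⊓ diamond (centre o k + (0, -1)) (k - 1))

/-- `P^W`: the core of `G ∩ A_W`, where `A_W` is the West sub-diamond of `A`. -/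
def subW (o : ℤ × ℤ) (k : ℕ) (P : LatticeGraph) : LatticeGraph :=
  core o (completion o k P ⊓ diamond (centre o k + (-1, 0)) (k - 1))

/-- `P^E`: the core of `G ∩ A_E`, where `A_E` is the East sub-diamond of `A`. -/
def subE (o : ℤ × ℤ) (k : ℕ) (P : LatticeGraph) : LatticeGraph :=
  core (o + (2, 0)) (completion o k P ⊓ diamond (centre o k + (1, 0)) (k - 1))

/-- `P^C`: the core of `G ∩ A_C`, where `A_C` is the central sub-diamond of `A`, of width
`2k-5`. -/
def subC (o : ℤ × ℤ) (k : ℕ) (P : LatticeGraph) : LatticeGraph :=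
  core (o + (2, 0)) (completion o k P ⊓ diamond (centre o k) (k - 2))

/-! ### Ordinary edges and the partial matching polynomial -/

/-- The horizontal edge of `P` from `(x, r)` to `(x + 1, r)` is ordinary: if `x + r` is even
(resp. odd), the closest black square found in rows `r - 1` and `r` weakly to the right of
the edge exists and is in row `r - 1` (resp. row `r`). All other horizontal edges are
special. -/
def IsOrdinaryAt (P : LatticeGraph) (x r : ℤ) : Prop :=
  P.Adj (x, r) (x + 1, r) ∧
  ((Even (x + r) ∧ ∃ z, x ≤ z ∧ IsBlackSquare P z (r - 1) ∧
      ∀ z', x ≤ z' → z' ≤ z → ¬ IsBlackSquare P z' r) ∨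
   (Odd (x + r) ∧ ∃ z, x ≤ z ∧ IsBlackSquare P z r ∧
      ∀ z', x ≤ z' → z' ≤ z → ¬ IsBlackSquare P z' (r - 1)))

/-- The edge `e` is an ordinary (horizontal) edge of `P`. -/
def IsOrdinary (P : LatticeGraph) (e : LEdge) : Prop :=
  ∃ x r : ℤ, e = hEdge (x, r) ∧ IsOrdinaryAt P x r

open Classical in
/-- The partial matching polynomial of `P`: the value of `M(P)` when the weights of all
ordinary edges of `P` are set to `1`. -/
noncomputable def partialMatchingPoly (P : LatticeGraph) : MvPolynomial LEdge ℤ :=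
  aeval (fun e => if IsOrdinary P e then (1 : MvPolynomial LEdge ℤ) else X e) (matchingPoly P)

/-! ### Distinguished edges -/

/-- The horizontal edge with leftmost vertex `v` is a left edge of `P`: the leftmost edge of
the horizontal segment of `P` that contains it. -/
def IsLeftEdge (P : LatticeGraph) (v : ℤ × ℤ) : Prop :=
  P.Adj v (v.1 + 1, v.2) ∧ ¬ P.Adj (v.1 - 1, v.2) v

/-- The horizontal edge with leftmost vertex `v` is the highest left edge of `P`. -/
def IsHighestLeftEdge (P : LatticeGraph) (v : ℤ × ℤ) : Prop :=
  IsLeftEdge P v ∧ ∀ u, IsLeftEdge P u → u ≠ v → u.2 < v.2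

/-- The horizontal edge with leftmost vertex `v` is the lowest left edge of `P`. -/
def IsLowestLeftEdge (P : LatticeGraph) (v : ℤ × ℤ) : Prop :=
  IsLeftEdge P v ∧ ∀ u, IsLeftEdge P u → u ≠ v → v.2 < u.2

/-- The vertical edge with lower vertex `v` is the eastmost vertical edge of `P`. -/
def IsEastmostEdge (P : LatticeGraph) (v : ℤ × ℤ) : Prop :=
  P.Adj v (v.1, v.2 + 1) ∧ ∀ u, P.Adj u (u.1, u.2 + 1) → u ≠ v → u.1 < v.1

/-- The vertical edge with lower vertex `v` is the westmost vertical edge of `P`. -/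
def IsWestmostEdge (P : LatticeGraph) (v : ℤ × ℤ) : Prop :=
  P.Adj v (v.1, v.2 + 1) ∧ ∀ u, P.Adj u (u.1, u.2 + 1) → u ≠ v → v.1 < u.1

end LatticeGraph

/-! The identity is the condensation identity of Aztec diamonds, applied to the completion `G` of
`P` with weights that make everything outside the pinecones invisible. Under `specialWeight`,
vertical edges missing from `G` weigh 0, vertical edges of `G` and special horizontal edges of `P`
keep their variables, and all other horizontal edges weigh 1.

Condensation for arbitrary weights (`condensation`) rests on urban renewal. A matching sum is a
squarefree coefficient of a product over edges. Grouping the edges by the cells of corner colour and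
complementing the vertex set covered inside each cell turns a diamond of order `n` into one of order
`n - 1` with renewed weights (`matchSum_diamond_renewal`). All six diamonds of the identity are
renewed at once, their cell factors cancel (`prod_diamondCells_mul`), and induction applies. Renewal
divides by cell factors, so it is carried out over positive reals and then transferred to
polynomials.

Next, the matching sum of a sub-diamond is related to its core. The core is encoded by the right
ends `E y` of its segments, determined greedily by the black squares (`IsEnds`). An odd vertical
edge of nonzero weight is the right side of a black square, so beyond these ends every matching of
nonzero weight consists of forced horizontal edges (`forced_up`, `forced_down`). Each segment of the
core ends at a black square, so the core and `P` agree on which edges are ordinary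
(`isOrdinaryAt_core`). Hence the matching sum is the product of the forced weights times the partial
matching polynomial of the core (`matchSum_eq_prod_mul_core`).

It remains to compare the forced weights. For `A` and `A_E` they are all 1. Interleaving makes the
second-to-last black squares into the ends of the West core (`exists_secondEnds`), and the ends of
the other cores follow. The forced weights of `A_N` and `A_S` together give those of `A_C`; those of
`A_W`, multiplied by the top and bottom edges of `A`, give `a a'` times those of `A_C`. The eastmost
and westmost edges of `A` are `e` and `w`. Cancelling the forced weight of `A_C`, which is nonzero,
leaves the theorem. -/

namespace LatticeGraph

/-! ### Matching sums of induced subgraphs of the lattice -/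

open Classical in
/-- The edges of the square lattice joining two vertices of `U`. -/
noncomputable def latticeEdges (U : Finset (ℤ × ℤ)) : Finset LEdge :=
  U.sym2.filter (· ∈ squareLattice.edgeSet)

lemma mem_latticeEdges {U : Finset (ℤ × ℤ)} {e : LEdge} :
    e ∈ latticeEdges U ↔ (∀ v ∈ e, v ∈ U) ∧ e ∈ squareLattice.edgeSet := by
  classical
  simp [latticeEdges, Finset.mem_sym2_iff]

/-- Every vertex of `U` belongs to exactly one edge of `T`. -/
def Covers (U : Finset (ℤ × ℤ)) (T : Finset LEdge) : Prop :=
  ∀ v ∈ U, ∃! e, e ∈ T ∧ v ∈ e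

open Classical in
/-- The sum over all perfect matchings of the subgraph of the lattice induced by `U` of the
product of the weights of the edges. -/
noncomputable def matchSum {R : Type*} [CommSemiring R] (U : Finset (ℤ × ℤ)) (ω : LEdge → R) : R :=
  ∑ T ∈ (latticeEdges U).powerset with Covers U T, ∏ e ∈ T, ω e

lemma map_matchSum {R S : Type*} [CommSemiring R] [CommSemiring S] (f : R →+* S)
    (U : Finset (ℤ × ℤ)) (ω : LEdge → R) :
    f (matchSum U ω) = matchSum U (fun e => f (ω e)) := by
  simp [matchSum, map_sum, map_prod]

/-- The exponent vector of the two ends of an edge. -/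
noncomputable def ends : LEdge → (ℤ × ℤ →₀ ℕ) :=
  Sym2.lift ⟨fun u v => Finsupp.single u 1 + Finsupp.single v 1, fun _ _ => add_comm _ _⟩

open Classical in
lemma ends_apply {e : LEdge} (he : e ∈ squareLattice.edgeSet) (v : ℤ × ℤ) :
    ends e v = if v ∈ e then 1 else 0 := by
  induction e using Sym2.ind with
  | _ a b =>
    have hab : a ≠ b := (squareLattice.mem_edgeSet.1 he).ne
    simp only [ends, Sym2.lift_mk, Finsupp.add_apply, Finsupp.single_apply, Sym2.mem_iff]
    by_cases h1 : a = v <;> by_cases h2 : b = v <;> simp_all [eq_comm]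

open Classical in
/-- The exponent vector of the squarefree monomial on `U`. -/
noncomputable def indicator (U : Finset (ℤ × ℤ)) : ℤ × ℤ →₀ ℕ :=
  Finsupp.indicator U (fun _ _ => 1)

open Classical in
lemma indicator_apply (U : Finset (ℤ × ℤ)) (v : ℤ × ℤ) :
    indicator U v = if v ∈ U then 1 else 0 := by
  simp [indicator, Finsupp.indicator_apply]

lemma prod_monomial {R ι σ : Type*} [CommSemiring R] (T : Finset ι) (m : ι → σ →₀ ℕ) (w : ι → R) :
    ∏ i ∈ T, monomial (m i) (w i) = monomial (∑ i ∈ T, m i) (∏ i ∈ T, w i) := by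
  classical
  induction T using Finset.induction_on with
  | empty => simp
  | insert a s ha ih => simp [Finset.prod_insert ha, Finset.sum_insert ha, ih, monomial_mul]

/-- The exponent of `v` on the left is the number of edges of `T` through `v`. Demanding 1 on `U`
and 0 elsewhere is exactly demanding a perfect matching of `U`. -/
lemma sum_ends_eq_indicator_iff {U : Finset (ℤ × ℤ)} {T : Finset LEdge}
    (hT : ∀ e ∈ T, e ∈ squareLattice.edgeSet) :
    ∑ e ∈ T, ends e = indicator U ↔ T ⊆ latticeEdges U ∧ Covers U T := by
  classical
  have key : ∀ v, (∑ e ∈ T, ends e) v = (T.filter (v ∈ ·)).card := by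
    intro v
    rw [Finsupp.finsetSum_apply, Finset.card_filter]
    exact Finset.sum_congr rfl fun e he => ends_apply (hT e he) v
  have huniq : ∀ v, (T.filter (v ∈ ·)).card = 1 ↔ ∃! e, e ∈ T ∧ v ∈ e := by
    intro v
    rw [Finset.card_eq_one]
    constructor
    · rintro ⟨e, he⟩
      refine ⟨e, by simpa using (Finset.ext_iff.1 he e), fun y hy => ?_⟩
      simpa using (Finset.ext_iff.1 he y).1 (by simpa using hy)
    · rintro ⟨e, he, h⟩
      refine ⟨e, ?_⟩
      ext y
      simp only [Finset.mem_filter, Finset.mem_singleton]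
      exact ⟨fun hy => h y hy, fun hy => hy ▸ he⟩
  constructor
  · intro h
    have h' : ∀ v, (T.filter (v ∈ ·)).card = if v ∈ U then 1 else 0 := fun v => by
      rw [← key, h, indicator_apply]
    refine ⟨fun e he => mem_latticeEdges.2 ⟨fun v hv => ?_, hT e he⟩, fun v hv => ?_⟩
    · by_contra hvU
      have := h' v
      rw [if_neg hvU, Finset.card_eq_zero] at this
      have h2 : e ∈ T.filter (v ∈ ·) := by simp [he, hv]
      simp [this] at h2
    · rw [← huniq, h', if_pos hv]
  · rintro ⟨h1, h2⟩
    ext v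
    rw [key, indicator_apply]
    split_ifs with hv
    · exact (huniq v).2 (h2 v hv)
    · rw [Finset.card_eq_zero, Finset.filter_eq_empty_iff]
      exact fun e he hve => hv ((mem_latticeEdges.1 (h1 he)).1 v hve)

/-- Expanding the product selects a set of edges whose monomial records vertex degrees, so the
squarefree monomial of `U` picks out the perfect matchings. Surplus edges in `𝓔` are harmless: they
would bring in a variable outside `U`. This freedom permits products over whole cells. -/
lemma coeff_prod_edges {R : Type*} [CommSemiring R] {U : Finset (ℤ × ℤ)} {𝓔 : Finset LEdge}
    (h𝓔 : ∀ e ∈ 𝓔, e ∈ squareLattice.edgeSet) (hU : latticeEdges U ⊆ 𝓔) (ω : LEdge → R) :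
    coeff (indicator U) (∏ e ∈ 𝓔, (1 + monomial (ends e) (ω e))) = matchSum U ω := by
  classical
  rw [Finset.prod_one_add, coeff_sum, matchSum]
  simp only [prod_monomial, coeff_monomial]
  rw [← Finset.sum_filter]
  refine Finset.sum_congr ?_ fun _ _ => rfl
  ext T
  simp only [Finset.mem_filter, Finset.mem_powerset]
  constructor
  · rintro ⟨h1, h2⟩
    exact (sum_ends_eq_indicator_iff fun e he => h𝓔 e (h1 he)).1 h2
  · rintro ⟨h1, h2⟩
    exact ⟨h1.trans hU, (sum_ends_eq_indicator_iff fun e he => h𝓔 e (hU (h1 he))).2 ⟨h1, h2⟩⟩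

/-! ### Squarefree coefficients -/

/-- The ideal generated by the squares of the variables. -/
noncomputable def squareIdeal (R : Type*) [CommRing R] : Ideal (MvPolynomial (ℤ × ℤ) R) :=
  Ideal.span (Set.range fun v => X v ^ 2)

lemma coeff_eq_zero_of_mem_squareIdeal {R : Type*} [CommRing R] {p : MvPolynomial (ℤ × ℤ) R}
    (hp : p ∈ squareIdeal R) : ∀ m : ℤ × ℤ →₀ ℕ, (∀ v, m v ≤ 1) → coeff m p = 0 := by
  classical
  induction hp using Submodule.span_induction with
  | mem x hx =>
    obtain ⟨v, rfl⟩ := hx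
    intro m hm
    simp only
    rw [coeff_X_pow, if_neg]
    rintro rfl
    have := hm v
    simp at this
  | zero => simp
  | add x y _ _ hx hy => intro m hm; simp [hx m hm, hy m hm]
  | smul a x _ hx =>
    intro m hm
    rw [smul_eq_mul, coeff_mul]
    refine Finset.sum_eq_zero fun ij hij => ?_
    rw [Finset.HasAntidiagonal.mem_antidiagonal] at hij
    rw [hx ij.2, mul_zero]
    intro v
    have := hm v
    rw [← hij] at this
    simp at this
    omega

/-- Squarefree coefficients vanish on the ideal of squares, so each factor may be replaced by any
representative modulo that ideal. -/
lemma coeff_prod_congr {R ι : Type*} [CommRing R] (B : Finset ι)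
    (f g : ι → MvPolynomial (ℤ × ℤ) R) (h : ∀ b ∈ B, f b - g b ∈ squareIdeal R)
    {m : ℤ × ℤ →₀ ℕ} (hm : ∀ v, m v ≤ 1) :
    coeff m (∏ b ∈ B, f b) = coeff m (∏ b ∈ B, g b) := by
  rw [← sub_eq_zero, ← coeff_sub]
  refine coeff_eq_zero_of_mem_squareIdeal ?_ m hm
  rw [← Ideal.Quotient.eq, map_prod, map_prod]
  exact Finset.prod_congr rfl fun b hb => Ideal.Quotient.eq.2 (h b hb)

/-! ### Cells -/

/-- The four sides of the cell with lower-left corner `b`. -/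
noncomputable def cellEdges (b : ℤ × ℤ) : Finset LEdge :=
  {hEdge b, hEdge (b.1, b.2 + 1), vEdge b, vEdge (b.1 + 1, b.2)}

lemma hEdge_injective : Function.Injective hEdge := by
  rintro ⟨a, b⟩ ⟨c, d⟩ h
  simp only [hEdge, Sym2.eq_iff, Prod.mk.injEq] at h
  rw [Prod.mk.injEq]; omega

lemma vEdge_injective : Function.Injective vEdge := by
  rintro ⟨a, b⟩ ⟨c, d⟩ h
  simp only [vEdge, Sym2.eq_iff, Prod.mk.injEq] at h
  rw [Prod.mk.injEq]; omega

lemma hEdge_ne_vEdge (u v : ℤ × ℤ) : hEdge u ≠ vEdge v := by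
  rcases u with ⟨a, b⟩; rcases v with ⟨c, d⟩
  intro h
  simp only [hEdge, vEdge, Sym2.eq_iff, Prod.mk.injEq] at h
  omega

lemma hEdge_mem_edgeSet (v : ℤ × ℤ) : hEdge v ∈ squareLattice.edgeSet :=
  squareLattice.mem_edgeSet.2 (Or.inl ⟨rfl, Or.inl rfl⟩)

lemma vEdge_mem_edgeSet (v : ℤ × ℤ) : vEdge v ∈ squareLattice.edgeSet :=
  squareLattice.mem_edgeSet.2 (Or.inr ⟨rfl, Or.inl rfl⟩)

lemma eq_hEdge_or_vEdge {e : LEdge} (he : e ∈ squareLattice.edgeSet) :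
    (∃ v, e = hEdge v) ∨ ∃ v, e = vEdge v := by
  induction e using Sym2.ind with
  | _ a b =>
    obtain ⟨a1, a2⟩ := a
    obtain ⟨b1, b2⟩ := b
    rcases squareLattice.mem_edgeSet.1 he with ⟨h1, h2 | h2⟩ | ⟨h1, h2 | h2⟩ <;>
      simp only at h1 h2 <;> subst h1 <;> subst h2
    · exact Or.inl ⟨_, rfl⟩
    · exact Or.inl ⟨(b1, a2), Sym2.eq_swap⟩
    · exact Or.inr ⟨_, rfl⟩
    · exact Or.inr ⟨(a1, b2), Sym2.eq_swap⟩

lemma cellEdges_subset (b : ℤ × ℤ) : ∀ e ∈ cellEdges b, e ∈ squareLattice.edgeSet := by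
  intro e he
  simp only [cellEdges, Finset.mem_insert, Finset.mem_singleton] at he
  rcases he with rfl | rfl | rfl | rfl <;>
    first | exact hEdge_mem_edgeSet _ | exact vEdge_mem_edgeSet _

lemma hEdge_mem_cellEdges {v b : ℤ × ℤ} :
    hEdge v ∈ cellEdges b ↔ v = b ∨ v = (b.1, b.2 + 1) := by
  simp [cellEdges, hEdge_injective.eq_iff, hEdge_ne_vEdge]

lemma vEdge_mem_cellEdges {v b : ℤ × ℤ} :
    vEdge v ∈ cellEdges b ↔ v = b ∨ v = (b.1 + 1, b.2) := by
  simp [cellEdges, vEdge_injective.eq_iff, (hEdge_ne_vEdge _ _).symm]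

lemma prod_cellEdges {R : Type*} [CommMonoid R] (f : LEdge → R) (b : ℤ × ℤ) :
    ∏ e ∈ cellEdges b, f e =
      f (hEdge b) * (f (hEdge (b.1, b.2 + 1)) * (f (vEdge b) * f (vEdge (b.1 + 1, b.2)))) := by
  have h1 : b ≠ (b.1, b.2 + 1) := fun h => by simpa using congrArg Prod.snd h
  have h2 : b ≠ (b.1 + 1, b.2) := fun h => by simpa using congrArg Prod.fst h
  rw [cellEdges, Finset.prod_insert, Finset.prod_insert, Finset.prod_insert, Finset.prod_singleton]
  · simpa [vEdge_injective.eq_iff] using h2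
  · simp [hEdge_ne_vEdge]
  · simpa [hEdge_ne_vEdge, hEdge_injective.eq_iff] using h1

/-- The matching polynomial of a single cell. -/
def cellFactor {R : Type*} [CommSemiring R] (ω : LEdge → R) (b : ℤ × ℤ) : R :=
  ω (hEdge b) * ω (hEdge (b.1, b.2 + 1)) + ω (vEdge b) * ω (vEdge (b.1 + 1, b.2))

/-- The exponents of the six sets of vertices of a cell that can be covered by edges of that
cell. -/
noncomputable def cellExponent (b : ℤ × ℤ) : Fin 6 → (ℤ × ℤ →₀ ℕ) :=
  ![0, ends (hEdge b), ends (hEdge (b.1, b.2 + 1)), ends (vEdge b), ends (vEdge (b.1 + 1, b.2)),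
    ends (hEdge b) + ends (hEdge (b.1, b.2 + 1))]

/-- The weights of the six sets of vertices of a cell. -/
def cellWeight {R : Type*} [CommSemiring R] (ω : LEdge → R) (b : ℤ × ℤ) : Fin 6 → R :=
  ![1, ω (hEdge b), ω (hEdge (b.1, b.2 + 1)), ω (vEdge b), ω (vEdge (b.1 + 1, b.2)),
    cellFactor ω b]

/-- Complementation of the six sets of vertices of a cell. -/
def cellCompl : Equiv.Perm (Fin 6) where
  toFun := ![5, 2, 1, 4, 3, 0]
  invFun := ![5, 2, 1, 4, 3, 0]
  left_inv := by decide
  right_inv := by decide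

lemma ends_hEdge (b : ℤ × ℤ) :
    ends (hEdge b) = Finsupp.single b 1 + Finsupp.single (b.1 + 1, b.2) 1 := rfl

lemma ends_vEdge (b : ℤ × ℤ) :
    ends (vEdge b) = Finsupp.single b 1 + Finsupp.single (b.1, b.2 + 1) 1 := rfl

lemma cellExponent_add_compl (b : ℤ × ℤ) (j : Fin 6) :
    cellExponent b j + cellExponent b (cellCompl j) =
      ends (hEdge b) + ends (hEdge (b.1, b.2 + 1)) := by
  fin_cases j <;> simp [cellExponent, cellCompl, ends_hEdge, ends_vEdge] <;> abel

lemma monomial_single_add_single {R : Type*} [CommSemiring R] (u v : ℤ × ℤ) (r : R) :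
    monomial (Finsupp.single u 1 + Finsupp.single v 1) r = C r * (X u * X v) := by
  rw [X, X, monomial_mul, C_mul_monomial, mul_one, mul_one]

/-- Of the 16 terms of the expanded product, 7 have no repeated vertex: the empty set, the four
sides and the two pairs of opposite sides. The two pairs share a monomial and merge into the cell
factor. -/
lemma prod_cellEdges_sub_mem {R : Type*} [CommRing R] (ω : LEdge → R) (b : ℤ × ℤ) :
    ∏ e ∈ cellEdges b, (1 + monomial (ends e) (ω e)) -
      ∑ j, monomial (cellExponent b j) (cellWeight ω b j) ∈ squareIdeal R := by
  rw [prod_cellEdges, Fin.sum_univ_six]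
  simp only [cellExponent, cellWeight, Matrix.cons_val]
  have hq : monomial (ends (hEdge b) + ends (hEdge (b.1, b.2 + 1))) (cellFactor ω b) =
      C (cellFactor ω b) * (X b * X (b.1 + 1, b.2) *
        (X (b.1, b.2 + 1) * X (b.1 + 1, b.2 + 1))) := by
    rw [← one_mul (cellFactor ω b), ← mul_one (1 * cellFactor ω b), ← monomial_mul, ends_hEdge,
      ends_hEdge, monomial_single_add_single, monomial_single_add_single]
    simp only [map_one, one_mul, mul_one]
    ring
  rw [hq]
  simp only [ends_hEdge, ends_vEdge, monomial_single_add_single, monomial_zero', cellFactor,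
    map_add, map_mul, map_one]
  generalize hp : (X b : MvPolynomial (ℤ × ℤ) R) = p
  generalize hq : (X (b.1 + 1, b.2) : MvPolynomial (ℤ × ℤ) R) = q
  generalize hr : (X (b.1, b.2 + 1) : MvPolynomial (ℤ × ℤ) R) = r
  generalize hs : (X (b.1 + 1, b.2 + 1) : MvPolynomial (ℤ × ℤ) R) = s
  generalize C (ω (hEdge b)) = β
  generalize C (ω (hEdge (b.1, b.2 + 1))) = τ
  generalize C (ω (vEdge b)) = l
  generalize C (ω (vEdge (b.1 + 1, b.2))) = ρ
  have hmem : ∀ v : ℤ × ℤ, (X v ^ 2 : MvPolynomial (ℤ × ℤ) R) ∈ squareIdeal R :=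
    fun v => Ideal.subset_span ⟨v, rfl⟩
  have h1 := hmem b
  have h2 := hmem (b.1 + 1, b.2)
  have h3 := hmem (b.1, b.2 + 1)
  have h4 := hmem (b.1 + 1, b.2 + 1)
  rw [hp] at h1; rw [hq] at h2; rw [hr] at h3; rw [hs] at h4
  -- The nine discarded terms, each assigned to one variable whose square divides it.
  have := add_mem (add_mem
    ((squareIdeal R).mul_mem_left (β * l * q * r + β * τ * l * q * r ^ 2 * s +
      β * l * ρ * q ^ 2 * r * s + β * τ * l * ρ * q ^ 2 * r ^ 2 * s ^ 2) h1)
    ((squareIdeal R).mul_mem_left (β * ρ * p * s + β * τ * ρ * p * r * s ^ 2) h2))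
    (add_mem ((squareIdeal R).mul_mem_left (τ * l * p * s + τ * l * ρ * p * q * s ^ 2) h3)
    ((squareIdeal R).mul_mem_left (τ * ρ * q * r) h4))
  convert this using 1
  ring

/-- Urban renewal, for a family of cells: complementing the set of vertices covered by each cell. -/
lemma coeff_prod_cells_compl {R : Type*} [CommRing R] (B : Finset (ℤ × ℤ)) (ω ω' : LEdge → R)
    (hω : ∀ b ∈ B, ∀ j, cellWeight ω b j = cellFactor ω b * cellWeight ω' b (cellCompl j))
    {m m' : ℤ × ℤ →₀ ℕ}
    (hm : m + m' = ∑ b ∈ B, (ends (hEdge b) + ends (hEdge (b.1, b.2 + 1)))) :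
    coeff m (∏ b ∈ B, ∑ j, monomial (cellExponent b j) (cellWeight ω b j)) =
      (∏ b ∈ B, cellFactor ω b) *
        coeff m' (∏ b ∈ B, ∑ j, monomial (cellExponent b j) (cellWeight ω' b j)) := by
  classical
  rw [← Finset.prod_coe_sort B (fun b => ∑ j, monomial (cellExponent b j) (cellWeight ω b j)),
    ← Finset.prod_coe_sort B (fun b => ∑ j, monomial (cellExponent b j) (cellWeight ω' b j)),
    ← Finset.prod_coe_sort B (cellFactor ω), Finset.prod_univ_sum, Finset.prod_univ_sum]
  simp only [Fintype.piFinset_univ, prod_monomial, coeff_sum, coeff_monomial, Finset.mul_sum]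
  -- Choose the complementary vertex set in every cell simultaneously. The exponents of a choice and
  -- of its complement add up to `m + m'`, so one hits `m` exactly when the other hits `m'`.
  refine Fintype.sum_equiv (Equiv.piCongrRight fun _ => cellCompl) _ _ fun f => ?_
  rw [mul_ite, mul_zero]
  have hsum : ∑ i : B, cellExponent i (f i) + ∑ i : B, cellExponent i (cellCompl (f i)) =
      m + m' := by
    rw [← Finset.sum_add_distrib, hm,
      ← Finset.sum_coe_sort B (fun b => ends (hEdge b) + ends (hEdge (b.1, b.2 + 1)))]
    exact Finset.sum_congr rfl fun i _ => cellExponent_add_compl _ _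
  have hiff : (∑ i : B, cellExponent i (f i) = m) ↔
      (∑ i : B, cellExponent i (cellCompl (f i)) = m') := by
    constructor
    · intro h; rw [h] at hsum; exact add_left_cancel hsum
    · intro h; rw [h] at hsum; exact add_right_cancel hsum
  simp only [Equiv.piCongrRight_apply, Pi.map_apply]
  refine if_congr hiff ?_ rfl
  rw [← Finset.prod_mul_distrib]
  exact Finset.prod_congr rfl fun i _ => hω i i.2 _

/-! ### Condensation for Aztec diamonds -/

/-- The vertices of the diamond graph of width `2n-1` with central cell `c`. -/
noncomputable def diamondVerts (c : ℤ × ℤ) (n : ℤ) : Finset (ℤ × ℤ) :=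
  (Finset.Icc (c.1 - n) (c.1 + n + 1) ×ˢ Finset.Icc (c.2 - n) (c.2 + n + 1)).filter fun v =>
    -n ≤ v.1 + v.2 - c.1 - c.2 - 1 ∧ v.1 + v.2 - c.1 - c.2 - 1 ≤ n ∧
      -n ≤ v.1 - v.2 - c.1 + c.2 ∧ v.1 - v.2 - c.1 + c.2 ≤ n

lemma mem_diamondVerts {c : ℤ × ℤ} {n : ℤ} {v : ℤ × ℤ} :
    v ∈ diamondVerts c n ↔ -n ≤ v.1 + v.2 - c.1 - c.2 - 1 ∧ v.1 + v.2 - c.1 - c.2 - 1 ≤ n ∧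
      -n ≤ v.1 - v.2 - c.1 + c.2 ∧ v.1 - v.2 - c.1 + c.2 ≤ n := by
  simp only [diamondVerts, Finset.mem_filter, Finset.mem_product, Finset.mem_Icc]
  omega

/-- The cells of the diamond graph of width `2n-1` with central cell `c` that have the same
colour as its corner cells. -/
noncomputable def diamondCells (c : ℤ × ℤ) (n : ℤ) : Finset (ℤ × ℤ) :=
  (Finset.Icc (c.1 - n) (c.1 + n) ×ˢ Finset.Icc (c.2 - n) (c.2 + n)).filter fun v =>
    -n < v.1 + v.2 - c.1 - c.2 ∧ v.1 + v.2 - c.1 - c.2 < n ∧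
      -n < v.1 - v.2 - c.1 + c.2 ∧ v.1 - v.2 - c.1 + c.2 < n ∧
      (v.1 + v.2 - c.1 - c.2 - n) % 2 = 1

lemma mem_diamondCells {c : ℤ × ℤ} {n : ℤ} {v : ℤ × ℤ} :
    v ∈ diamondCells c n ↔ -n < v.1 + v.2 - c.1 - c.2 ∧ v.1 + v.2 - c.1 - c.2 < n ∧
      -n < v.1 - v.2 - c.1 + c.2 ∧ v.1 - v.2 - c.1 + c.2 < n ∧
      (v.1 + v.2 - c.1 - c.2 - n) % 2 = 1 := by
  simp only [diamondCells, Finset.mem_filter, Finset.mem_product, Finset.mem_Icc]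
  omega

lemma matchSum_diamondVerts_of_nonpos {R : Type*} [CommSemiring R] (c : ℤ × ℤ) {n : ℤ}
    (hn : n ≤ 0) (ω : LEdge → R) : matchSum (diamondVerts c n) ω = 1 := by
  classical
  have h : diamondVerts c n = ∅ := by
    ext v
    simp only [mem_diamondVerts, Finset.notMem_empty, iff_false]
    omega
  have h2 : latticeEdges ∅ = ∅ := by
    ext e
    induction e using Sym2.ind with
    | _ a b =>
      simp only [mem_latticeEdges, Finset.notMem_empty, iff_false]
      exact fun h => h.1 a (Sym2.mem_mk_left a b)
  rw [h, matchSum, h2, Finset.powerset_empty, Finset.filter_true_of_mem]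
  · simp
  · intro T _ v hv
    simp at hv

open Classical in
/-- The edge weights given by the weights of the horizontal edges and of the vertical ones. -/
noncomputable def edgeWeight {R : Type*} [One R] (H V : ℤ × ℤ → R) (e : LEdge) : R :=
  if h : ∃ v, e = hEdge v then H h.choose else if h : ∃ v, e = vEdge v then V h.choose else 1

lemma edgeWeight_hEdge {R : Type*} [One R] (H V : ℤ × ℤ → R) (v : ℤ × ℤ) :
    edgeWeight H V (hEdge v) = H v := by
  have h : ∃ u, hEdge v = hEdge u := ⟨v, rfl⟩
  rw [edgeWeight, dif_pos h, ← hEdge_injective h.choose_spec]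

lemma edgeWeight_vEdge {R : Type*} [One R] (H V : ℤ × ℤ → R) (v : ℤ × ℤ) :
    edgeWeight H V (vEdge v) = V v := by
  have h : ∃ u, vEdge v = vEdge u := ⟨v, rfl⟩
  rw [edgeWeight, dif_neg, dif_pos h, ← vEdge_injective h.choose_spec]
  rintro ⟨u, hu⟩
  exact hEdge_ne_vEdge _ _ hu.symm

/-- The edge weights after urban renewal of all the cells `b` for which `b.1 + b.2 - ε` is
even. -/
noncomputable def renewedWeight (ε : ℤ) (ω : LEdge → ℝ) : LEdge → ℝ :=
  edgeWeight
    (fun v => if (v.1 + v.2 - ε) % 2 = 0 then ω (hEdge (v.1, v.2 + 1)) / cellFactor ω v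
      else ω (hEdge (v.1, v.2 - 1)) / cellFactor ω (v.1, v.2 - 1))
    (fun v => if (v.1 + v.2 - ε) % 2 = 0 then ω (vEdge (v.1 + 1, v.2)) / cellFactor ω v
      else ω (vEdge (v.1 - 1, v.2)) / cellFactor ω (v.1 - 1, v.2))

lemma cellFactor_pos {ω : LEdge → ℝ} (hω : ∀ e, 0 < ω e) (b : ℤ × ℤ) : 0 < cellFactor ω b :=
  add_pos (mul_pos (hω _) (hω _)) (mul_pos (hω _) (hω _))

lemma renewedWeight_pos (ε : ℤ) {ω : LEdge → ℝ} (hω : ∀ e, 0 < ω e) (e : LEdge) :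
    0 < renewedWeight ε ω e := by
  have := cellFactor_pos hω
  unfold renewedWeight edgeWeight
  split_ifs
  · simp only; split_ifs <;> exact div_pos (hω _) (this _)
  · simp only; split_ifs <;> exact div_pos (hω _) (this _)
  · exact one_pos

/-- Renewal exchanges opposite sides and divides by the cell factor, so the renewed cell factor is
the reciprocal of the old one. All six weights then match those of the complementary sets up to one
common factor. -/
lemma cellWeight_renewed {ε : ℤ} {ω : LEdge → ℝ} (hω : ∀ e, 0 < ω e) {b : ℤ × ℤ}
    (hb : (b.1 + b.2 - ε) % 2 = 0) (j : Fin 6) :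
    cellWeight ω b j = cellFactor ω b * cellWeight (renewedWeight ε ω) b (cellCompl j) := by
  have h0 : cellFactor ω b ≠ 0 := (cellFactor_pos hω b).ne'
  have h1 : ¬ (b.1 + (b.2 + 1) - ε) % 2 = 0 := by omega
  have h2 : ¬ (b.1 + 1 + b.2 - ε) % 2 = 0 := by omega
  have e1 : renewedWeight ε ω (hEdge b) = ω (hEdge (b.1, b.2 + 1)) / cellFactor ω b := by
    rw [renewedWeight, edgeWeight_hEdge, if_pos hb]
  have e2 : renewedWeight ε ω (hEdge (b.1, b.2 + 1)) = ω (hEdge b) / cellFactor ω b := by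
    rw [renewedWeight, edgeWeight_hEdge, if_neg h1]; simp
  have e3 : renewedWeight ε ω (vEdge b) = ω (vEdge (b.1 + 1, b.2)) / cellFactor ω b := by
    rw [renewedWeight, edgeWeight_vEdge, if_pos hb]
  have e4 : renewedWeight ε ω (vEdge (b.1 + 1, b.2)) = ω (vEdge b) / cellFactor ω b := by
    rw [renewedWeight, edgeWeight_vEdge, if_neg h2]; simp
  have e5 : cellFactor (renewedWeight ε ω) b = 1 / cellFactor ω b := by
    rw [cellFactor, e1, e2, e3, e4]
    field_simp
    rw [cellFactor]; ring
  fin_cases j <;>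
    simp [cellWeight, cellCompl, e1, e2, e3, e4, e5, h0, mul_div_cancel₀]

lemma ends_cell_apply (b v : ℤ × ℤ) :
    (ends (hEdge b) + ends (hEdge (b.1, b.2 + 1))) v =
      (if b = v then 1 else 0) + (if b = (v.1 - 1, v.2) then 1 else 0) +
      ((if b = (v.1, v.2 - 1) then 1 else 0) + (if b = (v.1 - 1, v.2 - 1) then 1 else 0)) := by
  have h1 : ((b.1 + 1, b.2) = v) = (b = (v.1 - 1, v.2)) := by
    simp only [Prod.ext_iff, eq_iff_iff]; omega
  have h2 : ((b.1, b.2 + 1) = v) = (b = (v.1, v.2 - 1)) := by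
    simp only [Prod.ext_iff, eq_iff_iff]; omega
  have h3 : ((b.1 + 1, b.2 + 1) = v) = (b = (v.1 - 1, v.2 - 1)) := by
    simp only [Prod.ext_iff, eq_iff_iff]; omega
  simp only [ends_hEdge, Finsupp.add_apply, Finsupp.single_apply, h1, h2, h3]

/-- A vertex of the smaller diamond is a corner of two cells of corner colour, while a vertex of the
outer layer is a corner of just one. -/
lemma sum_ends_diamondCells (c : ℤ × ℤ) (n : ℤ) :
    indicator (diamondVerts c n) + indicator (diamondVerts c (n - 1)) =
      ∑ b ∈ diamondCells c n, (ends (hEdge b) + ends (hEdge (b.1, b.2 + 1))) := by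
  classical
  ext v
  rw [Finsupp.finsetSum_apply, Finset.sum_congr rfl fun b _ => ends_cell_apply b v]
  simp only [Finset.sum_add_distrib, Finset.sum_ite_eq', Finsupp.add_apply, indicator_apply,
    mem_diamondVerts, mem_diamondCells]
  obtain ⟨x, y⟩ := v
  obtain ⟨p, q⟩ := c
  simp only
  obtain ⟨s, hs⟩ : ∃ s, s = x + y - p - q := ⟨_, rfl⟩
  obtain ⟨d, hd⟩ : ∃ d, d = x - y - p + q := ⟨_, rfl⟩
  have h2 : x - 1 + y - p - q = s - 1 := by omega
  have h3 : x + (y - 1) - p - q = s - 1 := by omega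
  have h4 : x - 1 + (y - 1) - p - q = s - 2 := by omega
  have h5 : x - 1 - y - p + q = d - 1 := by omega
  have h6 : x - (y - 1) - p + q = d + 1 := by omega
  have h7 : x - 1 - (y - 1) - p + q = d := by omega
  have hp : s % 2 = d % 2 := by omega
  rw [h2, h3, h4, h5, h6, h7, ← hs, ← hd]
  clear h2 h3 h4 h5 h6 h7 hs hd
  -- Of the four cells around a vertex, only one diagonally opposite pair has the right colour; the
  -- parity of `s - n` tells which.
  rcases Int.emod_two_eq_zero_or_one (s - n) with h | h
  · rw [if_neg (c := _ ∧ _ ∧ _ ∧ _ ∧ (s - n) % 2 = 1) (by omega),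
      if_neg (c := _ ∧ _ ∧ _ ∧ _ ∧ (s - 2 - n) % 2 = 1) (by omega)]
    split_ifs <;> omega
  · rw [if_neg (c := _ ∧ _ ∧ _ ∧ _ ∧ (s - 1 - n) % 2 = 1) (by omega),
      if_neg (c := _ ∧ _ ∧ _ ∧ _ ∧ (s - 1 - n) % 2 = 1) (by omega)]
    split_ifs <;> omega

lemma latticeEdges_diamondVerts_subset (c : ℤ × ℤ) (n : ℤ) :
    latticeEdges (diamondVerts c n) ⊆ (diamondCells c n).biUnion cellEdges := by
  intro e he
  rw [mem_latticeEdges] at he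
  obtain ⟨he1, he2⟩ := he
  simp only [Finset.mem_biUnion]
  rcases eq_hEdge_or_vEdge he2 with ⟨⟨x, y⟩, rfl⟩ | ⟨⟨x, y⟩, rfl⟩
  · have h1 := mem_diamondVerts.1 (he1 (x, y) (by simp [hEdge]))
    have h2 := mem_diamondVerts.1 (he1 (x + 1, y) (by simp [hEdge]))
    simp only at h1 h2
    simp only [hEdge_mem_cellEdges]
    rcases Int.emod_two_eq_zero_or_one (x + y - c.1 - c.2 - n) with h | h
    · exact ⟨(x, y - 1), mem_diamondCells.2 (by simp only; omega), Or.inr (by simp)⟩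
    · exact ⟨(x, y), mem_diamondCells.2 (by simp only; omega), Or.inl rfl⟩
  · have h1 := mem_diamondVerts.1 (he1 (x, y) (by simp [vEdge]))
    have h2 := mem_diamondVerts.1 (he1 (x, y + 1) (by simp [vEdge]))
    simp only at h1 h2
    simp only [vEdge_mem_cellEdges]
    rcases Int.emod_two_eq_zero_or_one (x + y - c.1 - c.2 - n) with h | h
    · exact ⟨(x - 1, y), mem_diamondCells.2 (by simp only; omega), Or.inr (by simp)⟩
    · exact ⟨(x, y), mem_diamondCells.2 (by simp only; omega), Or.inl rfl⟩

/-- The two cells on either side of an edge have opposite colours. With the preceding covering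
statement, the cells of corner colour partition the edges under consideration. -/
lemma pairwiseDisjoint_cellEdges (c : ℤ × ℤ) (n : ℤ) :
    (diamondCells c n : Set (ℤ × ℤ)).PairwiseDisjoint cellEdges := by
  intro b hb b' hb' hne
  have h1 := (mem_diamondCells.1 hb).2.2.2.2
  have h2 := (mem_diamondCells.1 hb').2.2.2.2
  refine Finset.disjoint_left.2 fun e he he' => hne ?_
  rcases eq_hEdge_or_vEdge (cellEdges_subset b e he) with ⟨v, rfl⟩ | ⟨v, rfl⟩
  · rw [hEdge_mem_cellEdges, Prod.ext_iff, Prod.ext_iff] at he he'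
    rw [Prod.ext_iff]
    simp only at he he'
    omega
  · rw [vEdge_mem_cellEdges, Prod.ext_iff, Prod.ext_iff] at he he'
    rw [Prod.ext_iff]
    simp only at he he'
    omega

lemma matchSum_eq_coeff_cells {R : Type*} [CommRing R] (c : ℤ × ℤ) (n : ℤ) {U : Finset (ℤ × ℤ)}
    (hU : U ⊆ diamondVerts c n) (ω : LEdge → R) :
    matchSum U ω = coeff (indicator U)
      (∏ b ∈ diamondCells c n, ∑ j, monomial (cellExponent b j) (cellWeight ω b j)) := by
  classical
  rw [← coeff_prod_edges (𝓔 := (diamondCells c n).biUnion cellEdges) _ _ ω,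
    Finset.prod_biUnion (pairwiseDisjoint_cellEdges c n)]
  · refine coeff_prod_congr _ _ _ (fun b _ => prod_cellEdges_sub_mem ω b) fun v => ?_
    rw [indicator_apply]; split_ifs <;> simp
  · intro e he
    obtain ⟨b, _, hb⟩ := Finset.mem_biUnion.1 he
    exact cellEdges_subset b e hb
  · refine subset_trans (fun e he => ?_) (latticeEdges_diamondVerts_subset c n)
    rw [mem_latticeEdges] at he ⊢
    exact ⟨fun v hv => hU (he.1 v hv), he.2⟩

/-- Urban renewal for diamond graphs. -/
lemma matchSum_diamond_renewal {ω : LEdge → ℝ} (hω : ∀ e, 0 < ω e) (c : ℤ × ℤ) (n ε : ℤ)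
    (hε : (c.1 + c.2 + n - 1 - ε) % 2 = 0) :
    matchSum (diamondVerts c n) ω = (∏ b ∈ diamondCells c n, cellFactor ω b) *
      matchSum (diamondVerts c (n - 1)) (renewedWeight ε ω) := by
  rw [matchSum_eq_coeff_cells c n subset_rfl, matchSum_eq_coeff_cells c n]
  · refine coeff_prod_cells_compl _ _ _ (fun b hb => cellWeight_renewed hω ?_)
      (sum_ends_diamondCells c n)
    have := mem_diamondCells.1 hb
    omega
  · intro v hv
    rw [mem_diamondVerts] at hv ⊢
    omega

/-- Inclusion–exclusion: the cells of two opposite sub-diamonds meet in those of the central one,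
and their union misses only the two corner cells in the perpendicular direction. -/
lemma prod_diamondCells_mul {M : Type*} [CommMonoid M] (f : ℤ × ℤ → M) (c d : ℤ × ℤ) {n : ℤ}
    (hn : 2 ≤ n) (hd : d = (1, 0) ∨ d = (0, 1)) :
    (∏ b ∈ diamondCells c n, f b) * ∏ b ∈ diamondCells c (n - 2), f b =
      f (c.1 + (n - 1) * d.2, c.2 + (n - 1) * d.1) *
      f (c.1 - (n - 1) * d.2, c.2 - (n - 1) * d.1) *
      ((∏ b ∈ diamondCells (c + d) (n - 1), f b) * ∏ b ∈ diamondCells (c - d) (n - 1), f b) := by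
  classical
  have hinter : diamondCells (c + d) (n - 1) ∩ diamondCells (c - d) (n - 1) =
      diamondCells c (n - 2) := by
    ext b
    rw [Finset.mem_inter, mem_diamondCells, mem_diamondCells, mem_diamondCells]
    rcases hd with rfl | rfl <;>
      simp only [Prod.fst_add, Prod.snd_add, Prod.fst_sub, Prod.snd_sub] <;> omega
  have hunion : diamondCells c n = insert (c.1 + (n - 1) * d.2, c.2 + (n - 1) * d.1)
      (insert (c.1 - (n - 1) * d.2, c.2 - (n - 1) * d.1)
        (diamondCells (c + d) (n - 1) ∪ diamondCells (c - d) (n - 1))) := by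
    ext b
    rw [Finset.mem_insert, Finset.mem_insert, Finset.mem_union, mem_diamondCells,
      mem_diamondCells, mem_diamondCells]
    rcases hd with rfl | rfl <;>
      simp only [Prod.fst_add, Prod.snd_add, Prod.fst_sub, Prod.snd_sub, Prod.ext_iff] <;> omega
  rw [← Finset.prod_union_inter (s₁ := diamondCells (c + d) (n - 1)), hinter, hunion,
    Finset.prod_insert, Finset.prod_insert]
  · simp only [mul_assoc]
  · rw [Finset.mem_union, mem_diamondCells, mem_diamondCells]
    rcases hd with rfl | rfl <;>
      simp only [Prod.fst_add, Prod.snd_add, Prod.fst_sub, Prod.snd_sub] <;> omega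
  · rw [Finset.mem_insert, Finset.mem_union, mem_diamondCells, mem_diamondCells]
    rcases hd with rfl | rfl <;>
      simp only [Prod.fst_add, Prod.snd_add, Prod.fst_sub, Prod.snd_sub, Prod.ext_iff] <;> omega

/-- The condensation identity for the diamond graph of width `2n-1` with central cell `c`. -/
def Condensation {R : Type*} [CommSemiring R] (ω : LEdge → R) (c : ℤ × ℤ) (n : ℤ) : Prop :=
  matchSum (diamondVerts c n) ω * matchSum (diamondVerts c (n - 2)) ω =
    ω (hEdge (c.1, c.2 + n)) * ω (hEdge (c.1, c.2 - n + 1)) *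
      (matchSum (diamondVerts (c + (1, 0)) (n - 1)) ω *
        matchSum (diamondVerts (c - (1, 0)) (n - 1)) ω) +
    ω (vEdge (c.1 + n, c.2)) * ω (vEdge (c.1 - n + 1, c.2)) *
      (matchSum (diamondVerts (c + (0, 1)) (n - 1)) ω *
        matchSum (diamondVerts (c - (0, 1)) (n - 1)) ω)

/-- The base case is the matching polynomial of one cell. For the step, urban renewal reduces every
diamond to the next smaller order, giving the identity for the renewed weights; positivity keeps the
cell factors invertible. -/
lemma condensation_of_pos {ω : LEdge → ℝ} (hω : ∀ e, 0 < ω e) (c : ℤ × ℤ) (n : ℕ) :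
    Condensation ω c (n + 1) := by
  induction n generalizing ω with
  | zero =>
    have h0 := matchSum_diamond_renewal hω c 1 (c.1 + c.2) (by omega)
    have h1 : diamondCells c 1 = {c} := by
      ext b
      rw [mem_diamondCells, Finset.mem_singleton, Prod.ext_iff]
      omega
    rw [h1, Finset.prod_singleton, matchSum_diamondVerts_of_nonpos c (n := 1 - 1) (by norm_num),
      mul_one] at h0
    simp only [Condensation, Nat.cast_zero, zero_add, h0, cellFactor]
    rw [matchSum_diamondVerts_of_nonpos _ (n := 1 - 2) (by norm_num)]
    simp only [matchSum_diamondVerts_of_nonpos _ (n := 1 - 1) (by norm_num)]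
    rw [show c.1 - 1 + 1 = c.1 by ring, show c.2 - 1 + 1 = c.2 by ring]
    simp only [mul_one, Prod.mk.eta]
    ring
  | succ n ih =>
    -- The colour of the corner cells. It is common to all six diamonds, so a single renewed weight
    -- serves them all.
    set ε := c.1 + c.2 + n + 1 with hε
    have ih' := ih (renewedWeight_pos ε hω)
    simp only [Condensation, Nat.cast_succ] at ih' ⊢
    have rA := matchSum_diamond_renewal hω c (n + 1 + 1) ε (by omega)
    have rC : matchSum (diamondVerts c (n + 1 + 1 - 2)) ω =
        (∏ b ∈ diamondCells c (n + 1 + 1 - 2), cellFactor ω b) *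
          matchSum (diamondVerts c (n + 1 + 1 - 2 - 1)) (renewedWeight ε ω) :=
      matchSum_diamond_renewal hω c _ ε (by omega)
    have rE := matchSum_diamond_renewal hω (c + (1, 0)) (n + 1 + 1 - 1) ε
      (by simp only [Prod.fst_add, Prod.snd_add]; omega)
    have rW := matchSum_diamond_renewal hω (c - (1, 0)) (n + 1 + 1 - 1) ε
      (by simp only [Prod.fst_sub, Prod.snd_sub]; omega)
    have rN := matchSum_diamond_renewal hω (c + (0, 1)) (n + 1 + 1 - 1) ε
      (by simp only [Prod.fst_add, Prod.snd_add]; omega)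
    have rS := matchSum_diamond_renewal hω (c - (0, 1)) (n + 1 + 1 - 1) ε
      (by simp only [Prod.fst_sub, Prod.snd_sub]; omega)
    have p1 := prod_diamondCells_mul (cellFactor ω) c (1, 0) (n := n + 1 + 1) (by omega)
      (Or.inl rfl)
    have p2 := prod_diamondCells_mul (cellFactor ω) c (0, 1) (n := n + 1 + 1) (by omega)
      (Or.inr rfl)
    simp only [mul_zero, mul_one, add_zero, sub_zero] at p1 p2
    -- Renewal of a corner cell moves the extreme edge to the opposite side of that cell, where it
    -- is the extreme edge of the smaller diamond. The division supplies the corner cell factor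
    -- needed by `prod_diamondCells_mul`.
    have w1 : ω (hEdge (c.1, c.2 + (n + 1 + 1))) =
        cellFactor ω (c.1, c.2 + (n + 1 + 1 - 1)) *
          renewedWeight ε ω (hEdge (c.1, c.2 + (n + 1))) := by
      rw [renewedWeight, edgeWeight_hEdge, if_pos (by simp only; omega)]
      have := (cellFactor_pos hω (c.1, c.2 + (n + 1 : ℤ))).ne'
      simp only [add_sub_cancel_right]
      rw [mul_div_cancel₀ _ this, add_assoc c.2]
    have w2 : ω (hEdge (c.1, c.2 - (n + 1 + 1) + 1)) =
        cellFactor ω (c.1, c.2 - (n + 1 + 1 - 1)) *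
          renewedWeight ε ω (hEdge (c.1, c.2 - (n + 1) + 1)) := by
      rw [renewedWeight, edgeWeight_hEdge, if_neg (by simp only; omega)]
      have := (cellFactor_pos hω (c.1, c.2 - (n + 1 : ℤ))).ne'
      simp only [add_sub_cancel_right]
      rw [mul_div_cancel₀ _ this]
      ring_nf
    have w3 : ω (vEdge (c.1 + (n + 1 + 1), c.2)) =
        cellFactor ω (c.1 + (n + 1 + 1 - 1), c.2) *
          renewedWeight ε ω (vEdge (c.1 + (n + 1), c.2)) := by
      rw [renewedWeight, edgeWeight_vEdge, if_pos (by simp only; omega)]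
      have := (cellFactor_pos hω (c.1 + (n + 1 : ℤ), c.2)).ne'
      simp only [add_sub_cancel_right]
      rw [mul_div_cancel₀ _ this, add_assoc c.1]
    have w4 : ω (vEdge (c.1 - (n + 1 + 1) + 1, c.2)) =
        cellFactor ω (c.1 - (n + 1 + 1 - 1), c.2) *
          renewedWeight ε ω (vEdge (c.1 - (n + 1) + 1, c.2)) := by
      rw [renewedWeight, edgeWeight_vEdge, if_neg (by simp only; omega)]
      have := (cellFactor_pos hω (c.1 - (n + 1 : ℤ), c.2)).ne'
      simp only [add_sub_cancel_right]
      rw [mul_div_cancel₀ _ this]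
      ring_nf
    rw [rA, rC, rE, rW, rN, rS, w1, w2, w3, w4]
    have s1 : (n : ℤ) + 1 + 1 - 2 - 1 = n + 1 - 2 := by ring
    have s2 : (n : ℤ) + 1 + 1 - 1 = n + 1 := by ring
    rw [s1]
    simp only [s2] at p1 p2 ih' ⊢
    generalize matchSum (diamondVerts c (↑n + 1)) (renewedWeight ε ω) = zA at *
    generalize matchSum (diamondVerts c (↑n + 1 - 2)) (renewedWeight ε ω) = zC at *
    generalize matchSum (diamondVerts (c + (1, 0)) (↑n + 1 - 1)) (renewedWeight ε ω) = zE at *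
    generalize matchSum (diamondVerts (c - (1, 0)) (↑n + 1 - 1)) (renewedWeight ε ω) = zW at *
    generalize matchSum (diamondVerts (c + (0, 1)) (↑n + 1 - 1)) (renewedWeight ε ω) = zN at *
    generalize matchSum (diamondVerts (c - (0, 1)) (↑n + 1 - 1)) (renewedWeight ε ω) = zS at *
    rw [mul_mul_mul_comm, ih', mul_add]
    -- The same product of cell factors is split horizontally in the East–West term and vertically
    -- in the North–South term.
    nth_rewrite 1 [p1]
    rw [p2]
    ring

/-- The condensation identity for arbitrary edge weights. -/
theorem condensation {R : Type*} [CommRing R] (ω : LEdge → R) (c : ℤ × ℤ) {n : ℤ} (hn : 1 ≤ n) :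
    Condensation ω c n := by
  obtain ⟨m, rfl⟩ : ∃ m : ℕ, n = m + 1 := ⟨(n - 1).toNat, by omega⟩
  have key : Condensation (fun e => (X e : MvPolynomial LEdge ℤ)) c (m + 1) := by
    -- For indeterminate weights both sides are integer polynomials. They agree at all positive real
    -- points, a product of infinite sets, hence coincide.
    refine map_injective (Int.castRingHom ℝ) Int.cast_injective ?_
    refine funext_set (fun _ => Set.Ioi (0 : ℝ)) (fun _ => Set.Ioi_infinite 0) fun x hx => ?_
    have hx' : ∀ e, 0 < x e := fun e => hx e (Set.mem_univ e)
    have := condensation_of_pos hx' c m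
    simpa only [Condensation, map_mul, map_add, map_matchSum, map_X, eval_X] using this
  -- Specialise the generic identity.
  have := congrArg (eval₂Hom (Int.castRingHom R) ω) key
  simpa only [Condensation, map_mul, map_add, map_matchSum, eval₂Hom_X'] using this

/-! ### Forced edges -/

/-- Matchings that do not contain `F` have weight 0. As `F` covers exactly the vertices outside `K`,
removing it is a bijection from the remaining matchings to the matchings of `K`. -/
lemma matchSum_forced {R : Type*} [CommSemiring R] {U K : Finset (ℤ × ℤ)} {F : Finset LEdge}
    {ω : LEdge → R} (hK : K ⊆ U) (hF : F ⊆ latticeEdges U) (hcov : Covers (U \ K) F)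
    (hFK : ∀ e ∈ F, ∀ v ∈ e, v ∉ K)
    (hforced : ∀ T, T ⊆ latticeEdges U → Covers U T → (∀ e ∈ T, ω e ≠ 0) → F ⊆ T) :
    matchSum U ω = (∏ e ∈ F, ω e) * matchSum K ω := by
  classical
  have hKF : ∀ T, T ⊆ latticeEdges K → Disjoint F T := by
    intro T hT
    refine Finset.disjoint_left.2 fun e he heT => ?_
    induction e using Sym2.ind with
    | _ a b =>
      exact hFK _ he a (Sym2.mem_mk_left a b)
        ((mem_latticeEdges.1 (hT heT)).1 a (Sym2.mem_mk_left a b))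
  have h1 : matchSum U ω =
      ∑ T ∈ (latticeEdges U).powerset with Covers U T ∧ F ⊆ T, ∏ e ∈ T, ω e := by
    rw [matchSum, ← Finset.filter_filter, eq_comm]
    refine Finset.sum_filter_of_ne fun T hT hne => ?_
    rw [Finset.mem_filter, Finset.mem_powerset] at hT
    exact hforced T hT.1 hT.2 fun e he h0 => hne (Finset.prod_eq_zero he h0)
  rw [h1, matchSum, Finset.mul_sum]
  refine Finset.sum_bij' (fun T _ => T \ F) (fun T _ => F ∪ T) ?_ ?_ ?_ ?_ ?_
  · intro T hT
    simp only [Finset.mem_filter, Finset.mem_powerset] at hT ⊢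
    obtain ⟨hT1, hT2, hT3⟩ := hT
    constructor
    · intro e he
      rw [Finset.mem_sdiff] at he
      have := mem_latticeEdges.1 (hT1 he.1)
      refine mem_latticeEdges.2 ⟨fun v hv => ?_, this.2⟩
      by_contra hvK
      obtain ⟨f, hf, -⟩ := hcov v (Finset.mem_sdiff.2 ⟨this.1 v hv, hvK⟩)
      have := (hT2 v (this.1 v hv)).unique ⟨he.1, hv⟩ ⟨hT3 hf.1, hf.2⟩
      exact he.2 (this ▸ hf.1)
    · intro v hv
      obtain ⟨e, he, huniq⟩ := hT2 v (hK hv)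
      exact ⟨e, ⟨Finset.mem_sdiff.2 ⟨he.1, fun h => hFK e h v he.2 hv⟩, he.2⟩,
        fun f hf => huniq f ⟨(Finset.mem_sdiff.1 hf.1).1, hf.2⟩⟩
  · intro T hT
    simp only [Finset.mem_filter, Finset.mem_powerset] at hT ⊢
    obtain ⟨hT1, hT2⟩ := hT
    refine ⟨Finset.union_subset hF fun e he => ?_, fun v hv => ?_, Finset.subset_union_left⟩
    · have := mem_latticeEdges.1 (hT1 he)
      exact mem_latticeEdges.2 ⟨fun v hv => hK (this.1 v hv), this.2⟩
    · by_cases hvK : v ∈ K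
      · obtain ⟨e, he, huniq⟩ := hT2 v hvK
        refine ⟨e, ⟨Finset.mem_union_right _ he.1, he.2⟩, fun f hf => ?_⟩
        rcases Finset.mem_union.1 hf.1 with h | h
        · exact absurd hvK (hFK f h v hf.2)
        · exact huniq f ⟨h, hf.2⟩
      · obtain ⟨e, he, huniq⟩ := hcov v (Finset.mem_sdiff.2 ⟨hv, hvK⟩)
        refine ⟨e, ⟨Finset.mem_union_left _ he.1, he.2⟩, fun f hf => ?_⟩
        rcases Finset.mem_union.1 hf.1 with h | h
        · exact huniq f ⟨h, hf.2⟩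
        · exact absurd ((mem_latticeEdges.1 (hT1 h)).1 v hf.2) hvK
  · intro T hT
    simp only [Finset.mem_filter, Finset.mem_powerset] at hT
    exact Finset.union_sdiff_of_subset hT.2.2
  · intro T hT
    simp only [Finset.mem_filter, Finset.mem_powerset] at hT
    rw [Finset.union_sdiff_left]
    exact Finset.sdiff_eq_self_of_disjoint (hKF T hT.1).symm
  · intro T hT
    simp only [Finset.mem_filter, Finset.mem_powerset] at hT
    rw [mul_comm]
    exact (Finset.prod_sdiff hT.2.2).symm

/-! ### Right ends of the segments of the core -/

/-- The vertices of the diamond graph of width `2n-1` whose leftmost vertices are `o` and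
`o + (0,1)`. -/
noncomputable def rootedDiamond (o : ℤ × ℤ) (n : ℤ) : Finset (ℤ × ℤ) :=
  diamondVerts (o.1 + n - 1, o.2) n

lemma mem_rootedDiamond {o : ℤ × ℤ} {n x y : ℤ} :
    (x, y) ∈ rootedDiamond o n ↔ 0 ≤ x + y - o.1 - o.2 ∧ x + y - o.1 - o.2 ≤ 2 * n ∧
      -1 ≤ x - y - o.1 + o.2 ∧ x - y - o.1 + o.2 ≤ 2 * n - 1 := by
  rw [rootedDiamond, mem_diamondVerts]
  simp only
  omega

/-- `E y` is the abscissa of the right end of the segment at ordinate `y` of the largest closed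
pinecone contained in the rooted diamond graph, when `B` describes the black squares; empty
segments end just before the left boundary of the diamond. -/
structure IsEnds (B : ℤ → ℤ → Prop) (o : ℤ × ℤ) (n : ℤ) (E : ℤ → ℤ) : Prop where
  mid : E (o.2 + 1) = E o.2
  last : E o.2 = o.1 - 1 ∨ (o.1 < E o.2 ∧ E o.2 ≤ o.1 + 2 * n - 1 ∧ B (E o.2 - 1) o.2)
  last_max : ∀ x, B x o.2 → o.1 ≤ x → x + 1 ≤ o.1 + 2 * n - 1 → x + 1 ≤ E o.2
  up : ∀ y, o.2 < y → E (y + 1) = o.1 + (y - o.2) - 1 ∨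
    (o.1 + (y - o.2) < E (y + 1) ∧ E (y + 1) < E y ∧ B (E (y + 1) - 1) y)
  up_max : ∀ y, o.2 < y → ∀ x, B x y → o.1 + (y - o.2) ≤ x → x + 1 < E y → x + 1 ≤ E (y + 1)
  down : ∀ y, y ≤ o.2 → E (y - 1) = o.1 + (o.2 - y) ∨
    (o.1 + (o.2 - y) + 1 < E (y - 1) ∧ E (y - 1) < E y ∧ B (E (y - 1) - 1) (y - 1))
  down_max : ∀ y, y ≤ o.2 → ∀ x, B x (y - 1) → o.1 + (o.2 - y) + 1 ≤ x → x + 1 < E y →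
    x + 1 ≤ E (y - 1)

namespace IsEnds

variable {B : ℤ → ℤ → Prop} {o : ℤ × ℤ} {n : ℤ} {E : ℤ → ℤ}

/-- The value given to an empty segment has the same parity as a genuine right end, so parity holds
in every row; genuine ends also inherit the diamond's bounds and a black square in the row below. -/
lemma up_cases (h : IsEnds B o n E) (hB : ∀ x y, B x y → (x + y) % 2 = 0)
    (ho : (o.1 + o.2) % 2 = 0) : ∀ y, o.2 < y → (E y + y) % 2 = 0 ∧
      (E y = o.1 + (y - o.2) - 2 ∨ (o.1 + (y - o.2) - 1 < E y ∧
        E y ≤ o.1 + o.2 + 2 * n - y ∧ E y ≤ E (y - 1) ∧ B (E y - 1) (y - 1))) := by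
  intro y hy
  induction y, (show o.2 + 1 ≤ y from hy) using Int.leInduction with
  | base =>
    rw [add_sub_cancel_right, h.mid]
    rcases h.last with h1 | ⟨h1, h2, h3⟩
    · omega
    · have := hB _ _ h3
      exact ⟨by omega, Or.inr ⟨by omega, by omega, le_rfl, h3⟩⟩
  | succ y hy' ih =>
    obtain ⟨ih1, ih2⟩ := ih (by omega)
    rw [add_sub_cancel_right]
    rcases h.up y (by omega) with h1 | ⟨h1, h2, h3⟩
    · omega
    · have := hB _ _ h3
      refine ⟨by omega, Or.inr ⟨by omega, ?_, by omega, h3⟩⟩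
      rcases ih2 with h4 | ⟨h4, h5, -⟩ <;> omega

lemma down_cases (h : IsEnds B o n E) (hB : ∀ x y, B x y → (x + y) % 2 = 0)
    (ho : (o.1 + o.2) % 2 = 0) : ∀ y, y ≤ o.2 → (E y + y) % 2 = 1 ∧
      (E y = o.1 + (o.2 - y) - 1 ∨ (o.1 + (o.2 - y) < E y ∧
        E y ≤ o.1 - o.2 + 2 * n - 1 + y ∧ E y ≤ E (y + 1) ∧ B (E y - 1) y)) := by
  intro y hy
  induction y, hy using Int.leInductionDown with
  | base =>
    rw [h.mid]
    rcases h.last with h1 | ⟨h1, h2, h3⟩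
    · omega
    · have := hB _ _ h3
      exact ⟨by omega, Or.inr ⟨by omega, by omega, le_rfl, h3⟩⟩
  | pred y hy' ih =>
    obtain ⟨ih1, ih2⟩ := ih
    rw [sub_add_cancel]
    rcases h.down y (by omega) with h1 | ⟨h1, h2, h3⟩
    · omega
    · have := hB _ _ h3
      refine ⟨by omega, Or.inr ⟨by omega, ?_, by omega, h3⟩⟩
      rcases ih2 with h4 | ⟨h4, h5, -⟩ <;> omega

end IsEnds

/-! ### Forced horizontal edges beyond the ends of the segments. -/

lemma exists_mem_of_covers {U : Finset (ℤ × ℤ)} {T : Finset LEdge} (hT : T ⊆ latticeEdges U)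
    (hcov : Covers U T) {x y : ℤ} (hv : (x, y) ∈ U) :
    (hEdge (x, y) ∈ T ∧ (x + 1, y) ∈ U) ∨ hEdge (x - 1, y) ∈ T ∨
      (vEdge (x, y) ∈ T ∧ (x, y + 1) ∈ U) ∨ (vEdge (x, y - 1) ∈ T ∧ (x, y - 1) ∈ U) := by
  obtain ⟨e, ⟨he, hve⟩, -⟩ := hcov _ hv
  have hmem := mem_latticeEdges.1 (hT he)
  rcases eq_hEdge_or_vEdge hmem.2 with ⟨⟨a, b⟩, rfl⟩ | ⟨⟨a, b⟩, rfl⟩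
  · simp only [hEdge, Sym2.mem_iff, Prod.mk.injEq] at hve
    rcases hve with ⟨rfl, rfl⟩ | ⟨rfl, rfl⟩
    · exact Or.inl ⟨he, hmem.1 _ (Sym2.mem_mk_right _ _)⟩
    · exact Or.inr (Or.inl (by simpa using he))
  · simp only [vEdge, Sym2.mem_iff, Prod.mk.injEq] at hve
    rcases hve with ⟨rfl, rfl⟩ | ⟨rfl, rfl⟩
    · exact Or.inr (Or.inr (Or.inl ⟨he, hmem.1 _ (Sym2.mem_mk_right _ _)⟩))
    · exact Or.inr (Or.inr (Or.inr (by simpa using ⟨he, hmem.1 _ (Sym2.mem_mk_left _ _)⟩)))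

lemma left_mem_hEdge (x y : ℤ) : (x, y) ∈ hEdge (x, y) := Sym2.mem_mk_left _ _
lemma right_mem_hEdge (x y : ℤ) : (x + 1, y) ∈ hEdge (x, y) := Sym2.mem_mk_right _ _
lemma right_mem_hEdge' (x y : ℤ) : (x, y) ∈ hEdge (x - 1, y) := by
  simp [hEdge]
lemma bot_mem_vEdge (x y : ℤ) : (x, y) ∈ vEdge (x, y) := Sym2.mem_mk_left _ _
lemma top_mem_vEdge (x y : ℤ) : (x, y + 1) ∈ vEdge (x, y) := Sym2.mem_mk_right _ _

/-- In the upper half of the diamond, beyond the ends of the segments, vertices of even parity are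
matched to their left neighbours. -/
lemma forced_up {B : ℤ → ℤ → Prop} {o : ℤ × ℤ} {n : ℤ} {E : ℤ → ℤ} (h : IsEnds B o n E)
    (hB : ∀ x y, B x y → (x + y) % 2 = 0) (ho : (o.1 + o.2) % 2 = 0) {T : Finset LEdge}
    (hT : T ⊆ latticeEdges (rootedDiamond o n)) (hcov : Covers (rootedDiamond o n) T)
    (hodd : ∀ x y, (x + y) % 2 = 1 → vEdge (x, y) ∈ T → B (x - 1) y) (N : ℕ) :
    ∀ x y, o.1 + 2 * n - x ≤ N → (x, y) ∈ rootedDiamond o n → o.2 < y → (x + y) % 2 = 0 →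
      E y < x → hEdge (x - 1, y) ∈ T := by
  induction N using Nat.strong_induction_on with
  | _ N ih =>
  intro x y hN hv hy hxy hE
  have hv' := mem_rootedDiamond.1 hv
  have hN0 : 0 < N := by omega
  -- Induction from right to left: even vertices further right, beyond the ends, are already matched
  -- to their left. This excludes the right and upper neighbours as partners, since each is already
  -- taken.
  have ih' := fun x' y' (hx : x < x') => ih (N - 1) (by omega) x' y' (by omega)
  rcases exists_mem_of_covers hT hcov hv with ⟨he, hu⟩ | he | ⟨he, hu⟩ | ⟨he, hu⟩
  · have hu' := mem_rootedDiamond.1 hu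
    have h2 := ih' (x + 2) y (by omega) (mem_rootedDiamond.2 (by omega)) hy (by omega) (by omega)
    rw [show x + 2 - 1 = x + 1 by ring] at h2
    have := hEdge_injective ((hcov _ hu).unique ⟨he, right_mem_hEdge _ _⟩ ⟨h2, left_mem_hEdge _ _⟩)
    simp at this
  · exact he
  · have hu' := mem_rootedDiamond.1 hu
    have hEy : E (y + 1) < x + 1 := by
      rcases h.up y hy with h1 | ⟨h1, h2, -⟩ <;> omega
    have h2 := ih' (x + 1) (y + 1) (by omega) (mem_rootedDiamond.2 (by omega)) (by omega)
      (by omega) hEy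
    rw [add_sub_cancel_right] at h2
    have := (hcov _ hu).unique ⟨he, top_mem_vEdge _ _⟩ ⟨h2, left_mem_hEdge _ _⟩
    exact absurd this.symm (hEdge_ne_vEdge _ _)
  · have hu' := mem_rootedDiamond.1 hu
    -- A downward edge would be the right side of a black square. If it lies left of `E (y - 1)`,
    -- maximality forces `E y` to be at least `x`; otherwise its lower vertex is already matched to
    -- the right.
    have hb := hodd _ _ (by omega) he
    exfalso
    by_cases hy1 : y - 1 = o.2
    · rw [hy1] at hb
      have h1 := h.last_max _ hb (by omega) (by omega)
      have h2 := h.mid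
      rw [show o.2 + 1 = y by omega] at h2
      omega
    · have hpar := (h.up_cases hB ho (y - 1) (by omega)).1
      rcases lt_or_ge x (E (y - 1)) with hlt | hge
      · have h1 := h.up_max (y - 1) (by omega) _ hb (by omega) (by omega)
        rw [sub_add_cancel, sub_add_cancel] at h1
        omega
      · have h2 := ih' (x + 1) (y - 1) (by omega) (mem_rootedDiamond.2 (by omega)) (by omega)
          (by omega) (by omega)
        rw [add_sub_cancel_right] at h2
        have := (hcov _ hu).unique ⟨he, bot_mem_vEdge _ _⟩ ⟨h2, left_mem_hEdge _ _⟩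
        exact absurd this.symm (hEdge_ne_vEdge _ _)

/-- In the lower half of the diamond, beyond the ends of the segments, vertices of odd parity are
matched to their left neighbours. -/
lemma forced_down {B : ℤ → ℤ → Prop} {o : ℤ × ℤ} {n : ℤ} {E : ℤ → ℤ} (h : IsEnds B o n E)
    (hB : ∀ x y, B x y → (x + y) % 2 = 0) (ho : (o.1 + o.2) % 2 = 0) {T : Finset LEdge}
    (hT : T ⊆ latticeEdges (rootedDiamond o n)) (hcov : Covers (rootedDiamond o n) T)
    (hodd : ∀ x y, (x + y) % 2 = 1 → vEdge (x, y) ∈ T → B (x - 1) y) (N : ℕ) :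
    ∀ x y, o.1 + 2 * n - x ≤ N → (x, y) ∈ rootedDiamond o n → y ≤ o.2 → (x + y) % 2 = 1 →
      E y < x → hEdge (x - 1, y) ∈ T := by
  induction N using Nat.strong_induction_on with
  | _ N ih =>
  intro x y hN hv hy hxy hE
  have hv' := mem_rootedDiamond.1 hv
  have hN0 : 0 < N := by omega
  have ih' := fun x' y' (hx : x < x') => ih (N - 1) (by omega) x' y' (by omega)
  rcases exists_mem_of_covers hT hcov hv with ⟨he, hu⟩ | he | ⟨he, hu⟩ | ⟨he, hu⟩
  · have hu' := mem_rootedDiamond.1 hu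
    have h2 := ih' (x + 2) y (by omega) (mem_rootedDiamond.2 (by omega)) hy (by omega) (by omega)
    rw [show x + 2 - 1 = x + 1 by ring] at h2
    have := hEdge_injective ((hcov _ hu).unique ⟨he, right_mem_hEdge _ _⟩ ⟨h2, left_mem_hEdge _ _⟩)
    simp at this
  · exact he
  · have hu' := mem_rootedDiamond.1 hu
    have hb := hodd _ _ (by omega) he
    exfalso
    by_cases hy1 : y = o.2
    · subst hy1
      have h1 := h.last_max _ hb (by omega) (by omega)
      omega
    · have hpar := (h.down_cases hB ho (y + 1) (by omega)).1
      rcases lt_or_ge x (E (y + 1)) with hlt | hge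
      · have h1 := h.down_max (y + 1) (by omega) (x - 1) (by simpa using hb) (by omega) (by omega)
        rw [add_sub_cancel_right] at h1
        omega
      · have h2 := ih' (x + 1) (y + 1) (by omega) (mem_rootedDiamond.2 (by omega)) (by omega)
          (by omega) (by omega)
        rw [add_sub_cancel_right] at h2
        have := (hcov _ hu).unique ⟨he, top_mem_vEdge _ _⟩ ⟨h2, left_mem_hEdge _ _⟩
        exact absurd this.symm (hEdge_ne_vEdge _ _)
  · have hu' := mem_rootedDiamond.1 hu
    have hEy : E (y - 1) < x + 1 := by
      rcases h.down y hy with h1 | ⟨h1, h2, -⟩ <;> omega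
    have h2 := ih' (x + 1) (y - 1) (by omega) (mem_rootedDiamond.2 (by omega)) (by omega)
      (by omega) hEy
    rw [add_sub_cancel_right] at h2
    have := (hcov _ hu).unique ⟨he, bot_mem_vEdge _ _⟩ ⟨h2, left_mem_hEdge _ _⟩
    exact absurd this.symm (hEdge_ne_vEdge _ _)

/-- The left vertices of the forced horizontal edges. -/
noncomputable def forcedVerts (o : ℤ × ℤ) (n : ℤ) (E : ℤ → ℤ) : Finset (ℤ × ℤ) :=
  (rootedDiamond o n).filter fun v => (v.1 + 1, v.2) ∈ rootedDiamond o n ∧ E v.2 < v.1 ∧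
    ((o.2 < v.2 ∧ (v.1 + v.2) % 2 = 1) ∨ (v.2 ≤ o.2 ∧ (v.1 + v.2) % 2 = 0))

lemma mem_forcedVerts {o : ℤ × ℤ} {n : ℤ} {E : ℤ → ℤ} {x y : ℤ} :
    (x, y) ∈ forcedVerts o n E ↔ (x, y) ∈ rootedDiamond o n ∧ (x + 1, y) ∈ rootedDiamond o n ∧
      E y < x ∧ ((o.2 < y ∧ (x + y) % 2 = 1) ∨ (y ≤ o.2 ∧ (x + y) % 2 = 0)) := by
  simp [forcedVerts]

/-- The vertices of the diamond graph that are not beyond the ends of the segments. -/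
noncomputable def coreVerts (o : ℤ × ℤ) (n : ℤ) (E : ℤ → ℤ) : Finset (ℤ × ℤ) :=
  (rootedDiamond o n).filter fun v => v.1 ≤ E v.2

lemma mem_coreVerts {o : ℤ × ℤ} {n : ℤ} {E : ℤ → ℤ} {x y : ℤ} :
    (x, y) ∈ coreVerts o n E ↔ (x, y) ∈ rootedDiamond o n ∧ x ≤ E y := by
  simp [coreVerts]

/-- In each row, the parities of `E y` and of the right boundary make the vertices beyond the end
pair off exactly. The hypothesis on `ω` confines odd vertical edges of nonzero weight to right sides
of black squares, which makes these pairs forced. -/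
lemma matchSum_rootedDiamond {R : Type*} [CommSemiring R] {B : ℤ → ℤ → Prop} {o : ℤ × ℤ} {n : ℤ}
    {E : ℤ → ℤ} (h : IsEnds B o n E) (hB : ∀ x y, B x y → (x + y) % 2 = 0)
    (ho : (o.1 + o.2) % 2 = 0) {ω : LEdge → R}
    (hω : ∀ x y, (x + y) % 2 = 1 → ω (vEdge (x, y)) ≠ 0 → B (x - 1) y) :
    matchSum (rootedDiamond o n) ω =
      (∏ v ∈ forcedVerts o n E, ω (hEdge v)) * matchSum (coreVerts o n E) ω := by
  classical
  rw [← Finset.prod_image (g := hEdge) (f := ω) (fun _ _ _ _ h => hEdge_injective h)]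
  refine matchSum_forced (Finset.filter_subset _ _) ?_ ?_ ?_ ?_
  · intro e he
    obtain ⟨⟨x, y⟩, hv, rfl⟩ := Finset.mem_image.1 he
    rw [mem_forcedVerts] at hv
    refine mem_latticeEdges.2 ⟨fun v hv' => ?_, hEdge_mem_edgeSet _⟩
    rcases Sym2.mem_iff.1 hv' with rfl | rfl
    exacts [hv.1, hv.2.1]
  · rintro ⟨x, y⟩ hv
    rw [Finset.mem_sdiff, mem_coreVerts] at hv
    obtain ⟨hv1, hv2⟩ := hv
    have hE : E y < x := by
      by_contra hcon
      exact hv2 ⟨hv1, by omega⟩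
    have hv' := mem_rootedDiamond.1 hv1
    have hpar : (o.2 < y → (E y + y) % 2 = 0 ∧ o.1 + (y - o.2) - 2 ≤ E y) ∧
        (y ≤ o.2 → (E y + y) % 2 = 1 ∧ o.1 + (o.2 - y) - 1 ≤ E y) := by
      constructor
      · intro hy
        obtain ⟨h1, h2⟩ := h.up_cases hB ho y hy
        exact ⟨h1, by rcases h2 with h2 | h2 <;> omega⟩
      · intro hy
        obtain ⟨h1, h2⟩ := h.down_cases hB ho y hy
        exact ⟨h1, by rcases h2 with h2 | h2 <;> omega⟩
    by_cases hp : (o.2 < y ∧ (x + y) % 2 = 1) ∨ (y ≤ o.2 ∧ (x + y) % 2 = 0)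
    · refine ⟨hEdge (x, y), ⟨Finset.mem_image_of_mem _ (mem_forcedVerts.2
        ⟨hv1, mem_rootedDiamond.2 (by omega), hE, hp⟩), left_mem_hEdge _ _⟩, ?_⟩
      rintro f ⟨hf, hvf⟩
      obtain ⟨⟨a, b⟩, hab, rfl⟩ := Finset.mem_image.1 hf
      have := mem_forcedVerts.1 hab
      simp only [hEdge, Sym2.mem_iff, Prod.mk.injEq] at hvf
      rcases hvf with ⟨rfl, rfl⟩ | ⟨h1, h2⟩
      · rfl
      · omega
    · refine ⟨hEdge (x - 1, y), ⟨Finset.mem_image_of_mem _ (mem_forcedVerts.2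
        ⟨mem_rootedDiamond.2 (by omega), mem_rootedDiamond.2 (by omega), by omega, by omega⟩),
        right_mem_hEdge' _ _⟩, ?_⟩
      rintro f ⟨hf, hvf⟩
      obtain ⟨⟨a, b⟩, hab, rfl⟩ := Finset.mem_image.1 hf
      have := mem_forcedVerts.1 hab
      simp only [hEdge, Sym2.mem_iff, Prod.mk.injEq] at hvf
      rcases hvf with ⟨rfl, rfl⟩ | ⟨rfl, rfl⟩
      · omega
      · simp
  · intro e he v hv
    obtain ⟨⟨x, y⟩, hv', rfl⟩ := Finset.mem_image.1 he
    have := mem_forcedVerts.1 hv'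
    rcases Sym2.mem_iff.1 hv with rfl | rfl <;> simp only [mem_coreVerts] <;> omega
  · intro T hT hcov hne e he
    obtain ⟨⟨x, y⟩, hv, rfl⟩ := Finset.mem_image.1 he
    obtain ⟨-, h1, h2, h3⟩ := mem_forcedVerts.1 hv
    have hodd : ∀ x y, (x + y) % 2 = 1 → vEdge (x, y) ∈ T → B (x - 1) y :=
      fun x y hxy hmem => hω x y hxy (hne _ hmem)
    rcases h3 with ⟨hy, hp⟩ | ⟨hy, hp⟩
    · have := forced_up h hB ho hT hcov hodd _ _ _ (Int.self_le_toNat _) h1 hy (by omega)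
        (by omega)
      simpa using this
    · have := forced_down h hB ho hT hcov hodd _ _ _ (Int.self_le_toNat _) h1 hy (by omega)
        (by omega)
      simpa using this

/-! ### Induced subgraphs of the completion -/

/-- The graph on the vertex set `K` whose edges are the edges of `P`, the horizontal edges and the
even vertical edges joining vertices of `K`. -/
def completedOn (P : LatticeGraph) (K : Finset (ℤ × ℤ)) : LatticeGraph where
  verts := K
  Adj u v := (squareLattice.Adj u v ∧ u ∈ K ∧ v ∈ K) ∧
    (P.Adj u v ∨ u.2 = v.2 ∨ (u.1 = v.1 ∧ Even (u.1 + min u.2 v.2)))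
  adj_sub h := h.1.1
  edge_vert h := h.1.2.1
  symm := ⟨by
    rintro u v ⟨⟨h, hu, hv⟩, h'⟩
    refine ⟨⟨h.symm, hv, hu⟩, ?_⟩
    rcases h' with h' | h' | ⟨h', h''⟩
    · exact Or.inl h'.symm
    · exact Or.inr (Or.inl h'.symm)
    · exact Or.inr (Or.inr ⟨h'.symm, by rwa [min_comm, ← h']⟩)⟩

lemma squareLattice_adj_right (x y : ℤ) : squareLattice.Adj (x, y) (x + 1, y) :=
  Or.inl ⟨rfl, Or.inl rfl⟩

lemma squareLattice_adj_up (x y : ℤ) : squareLattice.Adj (x, y) (x, y + 1) :=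
  Or.inr ⟨rfl, Or.inl rfl⟩

lemma completedOn_adj_right {P : LatticeGraph} {K : Finset (ℤ × ℤ)} {x y : ℤ} :
    (completedOn P K).Adj (x, y) (x + 1, y) ↔ (x, y) ∈ K ∧ (x + 1, y) ∈ K :=
  ⟨fun h => h.1.2, fun h => ⟨⟨squareLattice_adj_right x y, h⟩, Or.inr (Or.inl rfl)⟩⟩

lemma completedOn_adj_up {P : LatticeGraph} {K : Finset (ℤ × ℤ)} {x y : ℤ} :
    (completedOn P K).Adj (x, y) (x, y + 1) ↔
      ((x, y) ∈ K ∧ (x, y + 1) ∈ K) ∧ (P.Adj (x, y) (x, y + 1) ∨ (x + y) % 2 = 0) := by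
  constructor
  · rintro ⟨⟨-, h⟩, h1 | h1 | ⟨-, h1⟩⟩
    · exact ⟨h, Or.inl h1⟩
    · simp at h1
    · refine ⟨h, Or.inr ?_⟩
      simp only [le_add_iff_nonneg_right, zero_le_one, min_eq_left] at h1
      exact Int.even_iff.1 h1
  · rintro ⟨h, h1 | h1⟩
    · exact ⟨⟨squareLattice_adj_up x y, h⟩, Or.inl h1⟩
    · refine ⟨⟨squareLattice_adj_up x y, h⟩, Or.inr (Or.inr ⟨rfl, ?_⟩)⟩
      simp only [le_add_iff_nonneg_right, zero_le_one, min_eq_left]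
      exact Int.even_iff.2 h1

/-- Completion creates no black square: the right side of a black cell is an odd vertical edge, so
it comes from `P`, where it already bounds a black square. -/
lemma isBlackSquare_completedOn {P : LatticeGraph} {K : Finset (ℤ × ℤ)}
    (hodd : ∀ x y, (x + y) % 2 = 1 → P.Adj (x, y) (x, y + 1) → IsBlackSquare P (x - 1) y)
    {x y : ℤ} :
    IsBlackSquare (completedOn P K) x y ↔ IsBlackSquare P x y ∧ (x, y) ∈ K ∧ (x + 1, y) ∈ K ∧
      (x, y + 1) ∈ K ∧ (x + 1, y + 1) ∈ K := by
  simp only [IsBlackSquare, completedOn_adj_right, completedOn_adj_up]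
  constructor
  · rintro ⟨h0, ⟨h1, h2⟩, ⟨h3, h4⟩, -, -, h5 | h5⟩
    · have hb := hodd (x + 1) y (by have := Int.even_iff.1 h0; omega) h5
      rw [add_sub_cancel_right] at hb
      exact ⟨hb, h1, h2, h3, h4⟩
    · have := Int.even_iff.1 h0
      omega
  · rintro ⟨⟨h0, h1, h2, h3, h4⟩, h5, h6, h7, h8⟩
    exact ⟨h0, ⟨h5, h6⟩, ⟨h7, h8⟩, ⟨⟨h5, h7⟩, Or.inl h3⟩, ⟨h6, h8⟩, Or.inl h4⟩

lemma IsBlackSquare.emod_two {P : LatticeGraph} (x y : ℤ) (h : IsBlackSquare P x y) :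
    (x + y) % 2 = 0 := Int.even_iff.1 h.1

/-! ### Black squares and ordinary edges of a core. -/

section

variable {P : LatticeGraph} {o : ℤ × ℤ} {n : ℤ} {E : ℤ → ℤ}

/-- Data on black squares above and below an edge of the core, seen in the upper half. -/
lemma isBlackSquare_core_up (h : IsEnds (IsBlackSquare P) o n E) (ho : (o.1 + o.2) % 2 = 0)
    (hodd : ∀ x y, (x + y) % 2 = 1 → P.Adj (x, y) (x, y + 1) → IsBlackSquare P (x - 1) y)
    {x y : ℤ} (hy : o.2 < y) (hx : (x, y) ∈ coreVerts o n E) {z : ℤ} (hz : x ≤ z) :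
    (IsBlackSquare (completedOn P (coreVerts o n E)) z (y - 1) ↔
      IsBlackSquare P z (y - 1) ∧ z + 1 ≤ E y) ∧
    (IsBlackSquare (completedOn P (coreVerts o n E)) z y ↔
      IsBlackSquare P z y ∧ z + 1 < E y) := by
  have hB := IsBlackSquare.emod_two (P := P)
  rw [isBlackSquare_completedOn hodd, isBlackSquare_completedOn hodd, sub_add_cancel]
  simp only [mem_coreVerts, mem_rootedDiamond] at hx ⊢
  obtain ⟨hp, hc⟩ := h.up_cases hB ho y hy
  constructor
  · constructor
    · rintro ⟨h1, h2⟩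
      exact ⟨h1, by omega⟩
    · rintro ⟨h1, h2⟩
      have := hB _ _ h1
      refine ⟨h1, ?_⟩
      rcases hc with hc | ⟨hc1, hc2, hc3, -⟩ <;> omega
  · constructor
    · rintro ⟨h1, h2⟩
      refine ⟨h1, ?_⟩
      rcases h.up y hy with h3 | ⟨h3, h4, -⟩ <;> omega
    · rintro ⟨h1, h2⟩
      have := hB _ _ h1
      -- By maximality of the next end, a black square of row `y` to the left of `E y` also fits
      -- under the segment above.
      have h3 := h.up_max y hy z h1 (by omega) h2
      refine ⟨h1, ?_⟩
      rcases hc with hc | ⟨hc1, hc2, hc3, -⟩ <;>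
        rcases h.up y hy with h4 | ⟨h4, h5, -⟩ <;> omega

/-- Data on black squares above and below an edge of the core, seen in the lower half. -/
lemma isBlackSquare_core_down (h : IsEnds (IsBlackSquare P) o n E) (ho : (o.1 + o.2) % 2 = 0)
    (hodd : ∀ x y, (x + y) % 2 = 1 → P.Adj (x, y) (x, y + 1) → IsBlackSquare P (x - 1) y)
    {x y : ℤ} (hy : y ≤ o.2) (hx : (x, y) ∈ coreVerts o n E) {z : ℤ} (hz : x ≤ z) :
    (IsBlackSquare (completedOn P (coreVerts o n E)) z y ↔
      IsBlackSquare P z y ∧ z + 1 ≤ E y) ∧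
    (IsBlackSquare (completedOn P (coreVerts o n E)) z (y - 1) ↔
      IsBlackSquare P z (y - 1) ∧ z + 1 < E y) := by
  have hB := IsBlackSquare.emod_two (P := P)
  rw [isBlackSquare_completedOn hodd, isBlackSquare_completedOn hodd, sub_add_cancel]
  simp only [mem_coreVerts, mem_rootedDiamond] at hx ⊢
  obtain ⟨hp, hc⟩ := h.down_cases hB ho y hy
  constructor
  · constructor
    · rintro ⟨h1, h2⟩
      exact ⟨h1, by omega⟩
    · rintro ⟨h1, h2⟩
      have := hB _ _ h1
      refine ⟨h1, ?_⟩
      rcases hc with hc | ⟨hc1, hc2, hc3, -⟩ <;> omega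
  · constructor
    · rintro ⟨h1, h2⟩
      refine ⟨h1, ?_⟩
      rcases h.down y hy with h3 | ⟨h3, h4, -⟩ <;> omega
    · rintro ⟨h1, h2⟩
      have := hB _ _ h1
      have h3 := h.down_max y hy z h1 (by omega) h2
      refine ⟨h1, ?_⟩
      rcases hc with hc | ⟨hc1, hc2, hc3, -⟩ <;>
        rcases h.down y hy with h4 | ⟨h4, h5, -⟩ <;> omega

/-- The segment ends at a black square of `P`, which also belongs to the core, so the closest black
square to any edge of the segment occurs no later than that one. Up to there the core and `P` have
the same black squares in both adjacent rows. -/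
lemma isOrdinaryAt_core (h : IsEnds (IsBlackSquare P) o n E) (ho : (o.1 + o.2) % 2 = 0)
    (hodd : ∀ x y, (x + y) % 2 = 1 → P.Adj (x, y) (x, y + 1) → IsBlackSquare P (x - 1) y)
    {x y : ℤ} (hx : (x, y) ∈ coreVerts o n E) (hx' : (x + 1, y) ∈ coreVerts o n E)
    (hadj : P.Adj (x, y) (x + 1, y)) :
    IsOrdinaryAt (completedOn P (coreVerts o n E)) x y ↔ IsOrdinaryAt P x y := by
  have hB := IsBlackSquare.emod_two (P := P)
  have hE := (mem_coreVerts.1 hx').2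
  have hD := mem_rootedDiamond.1 (mem_coreVerts.1 hx).1
  -- Here `r₁` is the row containing the black square at the end of the segment: the row below it in
  -- the upper half, above it in the lower half. The other row is `r₂`; opposite parities rule out
  -- ties.
  have key : ∀ r₁ r₂ : ℤ, (r₁ + r₂) % 2 = 1 →
      (∀ z, x ≤ z → ((IsBlackSquare (completedOn P (coreVerts o n E)) z r₁ ↔
          IsBlackSquare P z r₁ ∧ z + 1 ≤ E y) ∧
        (IsBlackSquare (completedOn P (coreVerts o n E)) z r₂ ↔
          IsBlackSquare P z r₂ ∧ z + 1 < E y))) → IsBlackSquare P (E y - 1) r₁ →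
      ((∃ z, x ≤ z ∧ IsBlackSquare (completedOn P (coreVerts o n E)) z r₁ ∧
          ∀ z', x ≤ z' → z' ≤ z → ¬ IsBlackSquare (completedOn P (coreVerts o n E)) z' r₂) ↔
        ∃ z, x ≤ z ∧ IsBlackSquare P z r₁ ∧ ∀ z', x ≤ z' → z' ≤ z → ¬ IsBlackSquare P z' r₂) ∧
      ((∃ z, x ≤ z ∧ IsBlackSquare (completedOn P (coreVerts o n E)) z r₂ ∧
          ∀ z', x ≤ z' → z' ≤ z → ¬ IsBlackSquare (completedOn P (coreVerts o n E)) z' r₁) ↔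
        ∃ z, x ≤ z ∧ IsBlackSquare P z r₂ ∧ ∀ z', x ≤ z' → z' ≤ z → ¬ IsBlackSquare P z' r₁) := by
    intro r₁ r₂ hr hcore hlast
    refine ⟨⟨?_, ?_⟩, ⟨?_, ?_⟩⟩
    · rintro ⟨z, hxz, hz, hno⟩
      rw [(hcore z hxz).1] at hz
      refine ⟨z, hxz, hz.1, fun z' h1 h2 hz' => hno z' h1 h2 ((hcore z' h1).2.2 ⟨hz', ?_⟩)⟩
      have := hB _ _ hz'
      have := hB _ _ hz.1
      omega
    · rintro ⟨z, hxz, hz, hno⟩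
      rcases le_or_gt (z + 1) (E y) with hle | hgt
      · exact ⟨z, hxz, (hcore z hxz).1.2 ⟨hz, hle⟩,
          fun z' h1 h2 hz' => hno z' h1 h2 ((hcore z' h1).2.1 hz').1⟩
      · exact ⟨E y - 1, by omega, (hcore _ (by omega)).1.2 ⟨hlast, by omega⟩,
          fun z' h1 h2 hz' => hno z' h1 (by omega) ((hcore z' h1).2.1 hz').1⟩
    · rintro ⟨z, hxz, hz, hno⟩
      rw [(hcore z hxz).2] at hz
      exact ⟨z, hxz, hz.1,
        fun z' h1 h2 hz' => hno z' h1 h2 ((hcore z' h1).1.2 ⟨hz', by omega⟩)⟩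
    · rintro ⟨z, hxz, hz, hno⟩
      have hlt : z < E y - 1 := by
        by_contra hcon
        exact hno _ (by omega) (by omega) hlast
      exact ⟨z, hxz, (hcore z hxz).2.2 ⟨hz, by omega⟩,
        fun z' h1 h2 hz' => hno z' h1 h2 ((hcore z' h1).1.1 hz').1⟩
  simp only [IsOrdinaryAt, completedOn_adj_right, hx, hx', hadj, true_and]
  rcases lt_or_ge o.2 y with hy | hy
  · have hlast : IsBlackSquare P (E y - 1) (y - 1) := by
      rcases (h.up_cases hB ho y hy).2 with h1 | h1
      · omega
      · exact h1.2.2.2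
    obtain ⟨k1, k2⟩ := key (y - 1) y (by omega)
      (fun z hz => isBlackSquare_core_up h ho hodd hy hx hz) hlast
    rw [k1, k2]
  · have hlast : IsBlackSquare P (E y - 1) y := by
      rcases (h.down_cases hB ho y hy).2 with h1 | h1
      · omega
      · exact h1.2.2.2
    obtain ⟨k1, k2⟩ := key y (y - 1) (by omega)
      (fun z hz => isBlackSquare_core_down h ho hodd hy hx hz) hlast
    rw [k1, k2]

end

/-! ### Partial matching polynomials as matching sums -/

/-- Giving weight 0 to lattice edges missing from `Q` lets its matchings be summed over the induced
lattice graph. -/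
lemma aeval_matchingPoly (Q : LatticeGraph) (K : Finset (ℤ × ℤ))
    (hK : Q.verts = K) (f ω : LEdge → MvPolynomial LEdge ℤ)
    (h0 : ∀ e ∈ latticeEdges K, e ∉ Q.edgeSet → ω e = 0)
    (h1 : ∀ e ∈ Q.edgeSet, ω e = f e) : aeval f (matchingPoly Q) = matchSum K ω := by
  classical
  have hsub : ∀ e ∈ Q.edgeSet, e ∈ latticeEdges K := by
    intro e he
    refine mem_latticeEdges.2 ⟨fun v hv => ?_, Q.edgeSet_subset he⟩
    have := Q.mem_verts_of_mem_edge he hv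
    rwa [hK] at this
  have hset : {E' : Finset LEdge | IsPM Q E'} =
      (((latticeEdges K).powerset.filter fun T => Covers K T).filter
        fun T => (T : Set LEdge) ⊆ Q.edgeSet : Finset (Finset LEdge)) := by
    ext T
    rw [Finset.mem_coe, Finset.mem_filter, Finset.mem_filter, Finset.mem_powerset,
      Set.mem_ofPred_eq, IsPM, hK]
    constructor
    · rintro ⟨h2, h3⟩
      exact ⟨⟨fun e he => hsub e (h2 he), h3⟩, h2⟩
    · rintro ⟨⟨_, h3⟩, h2⟩
      exact ⟨h2, h3⟩
  rw [matchingPoly, hset, finsum_mem_coe_finset, map_sum, matchSum, Finset.sum_filter, eq_comm]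
  refine Finset.sum_congr rfl fun T hT => ?_
  rw [Finset.mem_filter, Finset.mem_powerset] at hT
  split_ifs with hTQ
  · rw [map_prod]
    exact Finset.prod_congr rfl fun e he => by rw [aeval_X, h1 e (hTQ he)]
  · obtain ⟨e, he, heQ⟩ := Set.not_subset.1 hTQ
    exact Finset.prod_eq_zero he (h0 e (hT.1 he) heQ)

/-- The horizontal edge of `P` with left vertex `v` is special, that is, not ordinary. -/
def IsSpecialAt (P : LatticeGraph) (v : ℤ × ℤ) : Prop :=
  P.Adj v (v.1 + 1, v.2) ∧ ¬ IsOrdinaryAt P v.1 v.2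

open Classical in
/-- The edge weights of the completion of `P` in which all the horizontal edges that are not
special edges of `P` are set to `1`. -/
noncomputable def specialWeight (P : LatticeGraph) : LEdge → MvPolynomial LEdge ℤ :=
  edgeWeight (fun v => if IsSpecialAt P v then X (hEdge v) else 1)
    (fun v => if P.Adj v (v.1, v.2 + 1) ∨ (v.1 + v.2) % 2 = 0 then X (vEdge v) else 0)

open Classical in
lemma specialWeight_hEdge (P : LatticeGraph) (v : ℤ × ℤ) :
    specialWeight P (hEdge v) = if IsSpecialAt P v then X (hEdge v) else 1 := by
  rw [specialWeight, edgeWeight_hEdge]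

open Classical in
lemma specialWeight_vEdge (P : LatticeGraph) (v : ℤ × ℤ) :
    specialWeight P (vEdge v) =
      if P.Adj v (v.1, v.2 + 1) ∨ (v.1 + v.2) % 2 = 0 then X (vEdge v) else 0 := by
  rw [specialWeight, edgeWeight_vEdge]

lemma isOrdinary_hEdge {P : LatticeGraph} {v : ℤ × ℤ} :
    IsOrdinary P (hEdge v) ↔ IsOrdinaryAt P v.1 v.2 := by
  constructor
  · rintro ⟨x, r, h, h'⟩
    rwa [hEdge_injective h]
  · exact fun h => ⟨v.1, v.2, rfl, h⟩

lemma not_isOrdinary_vEdge {P : LatticeGraph} {v : ℤ × ℤ} : ¬ IsOrdinary P (vEdge v) := by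
  rintro ⟨x, r, h, -⟩
  exact hEdge_ne_vEdge _ _ h.symm

/-- Inside the core the weights are precisely those of its partial matching polynomial, because
ordinariness agrees with `P`; missing odd vertical edges weigh 0, which makes the rest forced. -/
theorem matchSum_specialWeight {P : LatticeGraph} {o : ℤ × ℤ} {n : ℤ} {E : ℤ → ℤ}
    (h : IsEnds (IsBlackSquare P) o n E) (ho : (o.1 + o.2) % 2 = 0)
    (hodd : ∀ x y, (x + y) % 2 = 1 → P.Adj (x, y) (x, y + 1) → IsBlackSquare P (x - 1) y)
    (hrow : ∀ x y, (x, y) ∈ coreVerts o n E → (x + 1, y) ∈ coreVerts o n E →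
      P.Adj (x, y) (x + 1, y)) :
    matchSum (rootedDiamond o n) (specialWeight P) =
      (∏ v ∈ forcedVerts o n E, specialWeight P (hEdge v)) *
        partialMatchingPoly (completedOn P (coreVerts o n E)) := by
  classical
  rw [matchSum_rootedDiamond h IsBlackSquare.emod_two ho]
  · rw [partialMatchingPoly, aeval_matchingPoly _ (coreVerts o n E) rfl _ (specialWeight P)]
    · intro e he hne
      rw [mem_latticeEdges] at he
      rcases eq_hEdge_or_vEdge he.2 with ⟨⟨x, y⟩, rfl⟩ | ⟨⟨x, y⟩, rfl⟩
      · exact absurd (completedOn_adj_right.2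
          ⟨he.1 _ (left_mem_hEdge _ _), he.1 _ (right_mem_hEdge _ _)⟩) hne
      · rw [specialWeight_vEdge, if_neg]
        exact fun hcon => hne (completedOn_adj_up.2
          ⟨⟨he.1 _ (bot_mem_vEdge _ _), he.1 _ (top_mem_vEdge _ _)⟩, hcon⟩)
    · intro e he
      rcases eq_hEdge_or_vEdge (SimpleGraph.Subgraph.edgeSet_subset _ he) with
        ⟨⟨x, y⟩, rfl⟩ | ⟨⟨x, y⟩, rfl⟩
      · obtain ⟨h1, h2⟩ := completedOn_adj_right.1 he
        rw [specialWeight_hEdge, isOrdinary_hEdge, isOrdinaryAt_core h ho hodd h1 h2 (hrow x y h1 h2),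
          IsSpecialAt]
        simp only [hrow x y h1 h2, true_and, ite_not]
      · rw [specialWeight_vEdge, if_neg not_isOrdinary_vEdge, if_pos]
        exact (completedOn_adj_up.1 he).2
  · intro x y hxy hne
    refine hodd x y hxy ?_
    rw [specialWeight_vEdge] at hne
    by_contra hcon
    refine hne (if_neg ?_)
    simp only [not_or]
    exact ⟨hcon, by omega⟩

/-! ### Diamond graphs as induced subgraphs -/

lemma abs_add_abs_lt_iff {a b n : ℤ} :
    |a| + |b| < n ↔ -n < a + b ∧ a + b < n ∧ -n < a - b ∧ a - b < n := by
  rcases abs_cases a with ⟨h1, h2⟩ | ⟨h1, h2⟩ <;> rcases abs_cases b with ⟨h3, h4⟩ | ⟨h3, h4⟩ <;>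
    rw [h1, h3] <;> omega

lemma mem_verts_diamond {c v : ℤ × ℤ} {n : ℤ} :
    v ∈ (diamond c n).verts ↔ v ∈ diamondVerts c n := by
  simp only [diamond, SimpleGraph.Subgraph.verts_iSup, Set.mem_iUnion, square, Set.mem_ofPred_eq,
    mem_diamondVerts, Prod.fst_add, Prod.snd_add, abs_add_abs_lt_iff, exists_prop, Prod.exists]
  constructor
  · rintro ⟨a, b, h⟩
    omega
  · intro h
    rcases le_or_gt v.1 c.1 with h1 | h1 <;> rcases le_or_gt v.2 c.2 with h2 | h2
    · exact ⟨v.1 - c.1, v.2 - c.2, by omega⟩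
    · exact ⟨v.1 - c.1, v.2 - c.2 - 1, by omega⟩
    · exact ⟨v.1 - c.1 - 1, v.2 - c.2, by omega⟩
    · exact ⟨v.1 - c.1 - 1, v.2 - c.2 - 1, by omega⟩

/-- Diamonds are induced subgraphs of the lattice: of the two cells bordering an edge, one on the
side of the centre belongs to the diamond. -/
lemma diamond_adj {c u v : ℤ × ℤ} {n : ℤ} :
    (diamond c n).Adj u v ↔
      squareLattice.Adj u v ∧ u ∈ diamondVerts c n ∧ v ∈ diamondVerts c n := by
  constructor
  · intro h
    exact ⟨h.adj_sub, mem_verts_diamond.1 h.fst_mem, mem_verts_diamond.1 h.snd_mem⟩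
  · rintro ⟨h, hu, hv⟩
    have key : ∃ a b : ℤ, (-n < a + b ∧ a + b < n ∧ -n < a - b ∧ a - b < n) ∧
        ((u.1 = c.1 + a ∨ u.1 = c.1 + a + 1) ∧ (u.2 = c.2 + b ∨ u.2 = c.2 + b + 1)) ∧
        ((v.1 = c.1 + a ∨ v.1 = c.1 + a + 1) ∧ (v.2 = c.2 + b ∨ v.2 = c.2 + b + 1)) := by
      rw [mem_diamondVerts] at hu hv
      rcases h with ⟨h1, h2 | h2⟩ | ⟨h1, h2 | h2⟩
      · rcases le_or_gt u.2 c.2 with h3 | h3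
        · exact ⟨u.1 - c.1, u.2 - c.2, by omega⟩
        · exact ⟨u.1 - c.1, u.2 - c.2 - 1, by omega⟩
      · rcases le_or_gt u.2 c.2 with h3 | h3
        · exact ⟨v.1 - c.1, u.2 - c.2, by omega⟩
        · exact ⟨v.1 - c.1, u.2 - c.2 - 1, by omega⟩
      · rcases le_or_gt u.1 c.1 with h3 | h3
        · exact ⟨u.1 - c.1, u.2 - c.2, by omega⟩
        · exact ⟨u.1 - c.1 - 1, u.2 - c.2, by omega⟩
      · rcases le_or_gt u.1 c.1 with h3 | h3
        · exact ⟨u.1 - c.1, v.2 - c.2, by omega⟩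
        · exact ⟨u.1 - c.1 - 1, v.2 - c.2, by omega⟩
    obtain ⟨a, b, hab, h1, h2⟩ := key
    simp only [diamond, SimpleGraph.Subgraph.iSup_adj]
    exact ⟨(a, b), abs_add_abs_lt_iff.2 hab, h, h1, h2⟩

lemma completion_inf_diamond (o c : ℤ × ℤ) (k : ℕ) (n : ℤ) (P : LatticeGraph)
    (hsub : diamondVerts c n ⊆ diamondVerts (centre o k) k) :
    completion o k P ⊓ diamond c n = completedOn P (diamondVerts c n) := by
  ext u v
  · simp only [SimpleGraph.Subgraph.verts_inf, completion, completedOn, Set.mem_inter_iff,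
      mem_verts_diamond, Finset.mem_coe]
    exact ⟨fun h => h.2, fun h => ⟨hsub h, h⟩⟩
  · simp only [SimpleGraph.Subgraph.inf_adj, completion, completedOn, diamond_adj]
    constructor
    · rintro ⟨⟨-, h1⟩, h2⟩
      exact ⟨h2, h1⟩
    · rintro ⟨h2, h1⟩
      exact ⟨⟨⟨h2.1, hsub h2.2.1, hsub h2.2.2⟩, h1⟩, h2⟩

lemma IsEnds.mem_coreVerts_iff {B : ℤ → ℤ → Prop} {o : ℤ × ℤ} {n : ℤ} {E : ℤ → ℤ}
    (h : IsEnds B o n E) (hB : ∀ x y, B x y → (x + y) % 2 = 0) (ho : (o.1 + o.2) % 2 = 0)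
    {x y : ℤ} : (x, y) ∈ coreVerts o n E ↔
      -1 ≤ x - y - o.1 + o.2 ∧ 0 ≤ x + y - o.1 - o.2 ∧ x ≤ E y := by
  rw [mem_coreVerts, mem_rootedDiamond]
  constructor
  · omega
  · rintro ⟨h1, h2, h3⟩
    rcases lt_or_ge o.2 y with hy | hy
    · rcases (h.up_cases hB ho y hy).2 with h4 | h4 <;> omega
    · rcases (h.down_cases hB ho y hy).2 with h4 | h4 <;> omega

/-! ### Pinecones described by the right ends of their segments -/

/-- `E y` is the abscissa of the right end of the segment at ordinate `y` of the pinecone `R`; empty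
segments end just before the left boundary. -/
structure PineconeEnds (o : ℤ × ℤ) (k : ℕ) (R : LatticeGraph) (E : ℤ → ℤ) : Prop where
  pos : 1 ≤ k
  verts : ∀ x y, (x, y) ∈ R.verts ↔
    -1 ≤ x - y - o.1 + o.2 ∧ 0 ≤ x + y - o.1 - o.2 ∧ x ≤ E y
  adj : ∀ x y, R.Adj (x, y) (x + 1, y) ↔
    -1 ≤ x - y - o.1 + o.2 ∧ 0 ≤ x + y - o.1 - o.2 ∧ x + 1 ≤ E y
  even : ∀ x y, (x + y) % 2 = 0 → (x, y) ∈ R.verts → (x, y + 1) ∈ R.verts →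
    R.Adj (x, y) (x, y + 1)
  mid : E o.2 = o.1 + 2 * k - 1
  mid' : E (o.2 + 1) = o.1 + 2 * k - 1
  up : ∀ y, o.2 < y → E (y + 1) = o.1 + (y - o.2) - 1 ∨
    (o.1 + (y - o.2) < E (y + 1) ∧ E (y + 1) < E y)
  down : ∀ y, y ≤ o.2 → E (y - 1) = o.1 + (o.2 - y) ∨
    (o.1 + (o.2 - y) + 1 < E (y - 1) ∧ E (y - 1) < E y)
  up_parity : ∀ y, o.2 < y → (E y + y) % 2 = 0
  down_parity : ∀ y, y ≤ o.2 → (E y + y) % 2 = 1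

/-- Right ends, unlike lengths, can be compared between pinecones with different roots. The numbers
`i` and `j` survive only to say which ends are genuine. -/
lemma IsPinecone.exists_ends {o : ℤ × ℤ} {k : ℕ} {R : LatticeGraph} (h : IsPinecone o k R) :
    (o.1 + o.2) % 2 = 0 ∧ ∃ (i j : ℕ) (E : ℤ → ℤ), PineconeEnds o k R E ∧ 1 ≤ i ∧
      (∀ y, o.2 < y → (o.1 + (y - o.2) - 1 < E y ↔ y ≤ o.2 + i)) ∧
      (∀ y, y ≤ o.2 → (o.1 + (o.2 - y) < E y ↔ o.2 - j ≤ y)) := by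
  obtain ⟨ho, i, j, L, hi, hodd, hL0, hL1, hup, hdown, hadj, hverts, heven⟩ := h
  rw [Int.even_iff] at ho
  have hodd' : ∀ m : ℤ, -(j : ℤ) ≤ m → m ≤ i → (L m : ℤ) % 2 = 1 := by
    intro m h1 h2
    have := Nat.odd_iff.1 (hodd m h1 h2)
    omega
  have hup' : ∀ m : ℤ, 1 ≤ m → m < i → (L (m + 1) : ℤ) < L m :=
    fun m h1 h2 => by exact_mod_cast hup m h1 h2
  have hdown' : ∀ m : ℤ, -(j : ℤ) ≤ m → m < 0 → (L m : ℤ) < L (m + 1) :=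
    fun m h1 h2 => by exact_mod_cast hdown m h1 h2
  have hL1' : (L 1 : ℤ) = L 0 := by exact_mod_cast hL1
  -- An absent segment is given length `-1`: it ends one unit before its start and keeps odd parity.
  refine ⟨ho, i, j, fun y => o.1 + segStart (y - o.2) +
    if -(j : ℤ) ≤ y - o.2 ∧ y - o.2 ≤ i then (L (y - o.2) : ℤ) else -1, ?_, hi, ?_, ?_⟩
  · have hadj' : ∀ x y, R.Adj (x, y) (x + 1, y) ↔
        -1 ≤ x - y - o.1 + o.2 ∧ 0 ≤ x + y - o.1 - o.2 ∧ x + 1 ≤ o.1 + segStart (y - o.2) +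
          if -(j : ℤ) ≤ y - o.2 ∧ y - o.2 ≤ i then (L (y - o.2) : ℤ) else -1 := by
      intro x y
      rw [hadj]
      unfold segStart
      split_ifs <;> omega
    refine ⟨?_, ?_, hadj', ?_, ?_, ?_, ?_, ?_, ?_, ?_⟩
    · have := hodd' 0 (by omega) (by omega)
      omega
    · intro x y
      rw [hverts, hadj']
      have h2 := hadj' (x - 1) y
      rw [sub_add_cancel] at h2
      rw [h2]
      split_ifs with hc
      · have := hodd' (y - o.2) hc.1 hc.2
        unfold segStart
        split_ifs <;> omega
      · unfold segStart
        split_ifs <;> omega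
    · intro x y hxy
      exact heven x y (Int.even_iff.2 hxy)
    · simp only [sub_self]
      rw [if_pos (by omega), hL0]
      simp [segStart]
      ring
    · simp only [add_sub_cancel_left]
      rw [if_pos (by omega), hL1', hL0]
      simp [segStart]
      ring
    · intro y hy
      have e : y + 1 - o.2 = y - o.2 + 1 := by ring
      rw [e]
      by_cases hc : y - o.2 < i
      · have h1 := hup' (y - o.2) (by omega) hc
        have h2 := hodd' (y - o.2) (by omega) (by omega)
        have h3 := hodd' (y - o.2 + 1) (by omega) (by omega)
        simp only [segStart]
        rw [if_pos (by omega), if_pos (by omega), if_pos (by omega), if_pos (by omega)]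
        omega
      · simp only [segStart]
        rw [if_pos (by omega), if_neg (by omega)]
        omega
    · intro y hy
      have e : y - 1 - o.2 = y - o.2 - 1 := by ring
      rw [e]
      by_cases hc : -(j : ℤ) ≤ y - o.2 - 1
      · have h1 := hdown' (y - o.2 - 1) (by omega) (by omega)
        rw [sub_add_cancel] at h1
        have h2 := hodd' (y - o.2 - 1) (by omega) (by omega)
        have h3 := hodd' (y - o.2) (by omega) (by omega)
        simp only [segStart]
        rw [if_neg (by omega), if_pos (by omega), if_neg (by omega), if_pos (by omega)]
        omega
      · simp only [segStart]
        rw [if_neg (by omega), if_neg (by omega)]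
        omega
    · intro y hy
      simp only [segStart]
      split_ifs with h1 h2
      · have := hodd' _ h2.1 h2.2
        omega
      all_goals omega
    · intro y hy
      simp only [segStart]
      split_ifs with h1 h2 h2
      · omega
      · omega
      · have := hodd' _ h2.1 h2.2
        omega
      · omega
  · intro y hy
    simp only [segStart]
    split_ifs with h1 h2
    · have := hodd' _ h2.1 h2.2
      omega
    all_goals omega
  · intro y hy
    simp only [segStart]
    split_ifs with h1 h2 h2
    · omega
    · omega
    · have := hodd' _ h2.1 h2.2
      omega
    · omega

namespace PineconeEnds

variable {o : ℤ × ℤ} {k : ℕ} {R : LatticeGraph} {E : ℤ → ℤ}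

lemma isPinecone (h : PineconeEnds o k R E) (ho : (o.1 + o.2) % 2 = 0) {i j : ℕ} (hi : 1 ≤ i)
    (hup : ∀ y, o.2 < y → (o.1 + (y - o.2) - 1 < E y ↔ y ≤ o.2 + i))
    (hdown : ∀ y, y ≤ o.2 → (o.1 + (o.2 - y) < E y ↔ o.2 - j ≤ y)) : IsPinecone o k R := by
  have hs : ∀ m, o.2 + m - o.2 = m := fun m => by ring
  have hL : ∀ m : ℤ, -(j : ℤ) ≤ m → m ≤ i →
      (((E (o.2 + m) - (o.1 + segStart m)).toNat : ℕ) : ℤ) = E (o.2 + m) - (o.1 + segStart m) ∧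
        (E (o.2 + m) - (o.1 + segStart m)) % 2 = 1 := by
    intro m h1 h2
    rcases lt_or_ge 0 m with hm | hm
    · have := (hup (o.2 + m) (by omega)).2 (by omega)
      have := h.up_parity (o.2 + m) (by omega)
      rw [segStart, if_pos (by omega), Int.toNat_of_nonneg (by omega)]
      omega
    · have := (hdown (o.2 + m) (by omega)).2 (by omega)
      have := h.down_parity (o.2 + m) (by omega)
      rw [segStart, if_neg (by omega), Int.toNat_of_nonneg (by omega)]
      omega
  refine ⟨Int.even_iff.2 ho, i, j, fun m => (E (o.2 + m) - (o.1 + segStart m)).toNat, hi,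
    ?_, ?_, ?_, ?_, ?_, ?_, ?_, ?_⟩
  · intro m h1 h2
    have := hL m h1 h2
    simp only [Nat.odd_iff]
    omega
  · rw [(hL 0 (by omega) (by omega)).1, add_zero, h.mid]
    simp [segStart]
    ring
  · simp only [add_zero, h.mid, h.mid']
    simp [segStart]
  · intro m h1 h2
    have h3 := (hL m (by omega) (by omega)).1
    have h4 := (hL (m + 1) (by omega) (by omega)).1
    have h5 := (hup (o.2 + (m + 1)) (by omega)).2 (by omega)
    have h6 := h.up (o.2 + m) (by omega)
    rw [add_assoc] at h6
    simp only [segStart] at h3 h4 ⊢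
    rw [if_pos (by omega)] at h3 h4 ⊢
    rw [if_pos (by omega)]
    omega
  · intro m h1 h2
    have h3 := (hL m (by omega) (by omega)).1
    have h4 := (hL (m + 1) (by omega) (by omega)).1
    have h5 := (hdown (o.2 + m) (by omega)).2 (by omega)
    have h6 := h.down (o.2 + (m + 1)) (by omega)
    rw [show o.2 + (m + 1) - 1 = o.2 + m by ring] at h6
    simp only [segStart] at h3 h4 ⊢
    rw [if_neg (by omega)] at h3 h4 ⊢
    rw [if_neg (by omega)]
    omega
  · intro x y
    rw [h.adj]
    have e : o.2 + (y - o.2) = y := by ring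
    simp only [e]
    by_cases hc : -(j : ℤ) ≤ y - o.2 ∧ y - o.2 ≤ i
    · have h3 := (hL (y - o.2) hc.1 hc.2).1
      rw [e] at h3
      rw [h3]
      unfold segStart
      split_ifs <;> omega
    · rcases lt_or_ge o.2 y with hy | hy
      · have := hup y hy
        omega
      · have := hdown y hy
        omega
  · intro x y
    have h2 := h.adj (x - 1) y
    rw [sub_add_cancel] at h2
    rw [h.verts, h.adj, h2]
    rcases lt_or_ge o.2 y with hy | hy
    · have := h.up_parity y hy
      have := hup y hy
      rcases lt_or_ge (o.1 + (y - o.2) - 1) (E y) with h5 | h5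
      · omega
      · have hy1 : y ≠ o.2 + 1 := by rintro rfl; omega
        have h6 := h.up (y - 1) (by omega)
        rw [sub_add_cancel] at h6
        omega
    · have := h.down_parity y hy
      have := hdown y hy
      rcases lt_or_ge (o.1 + (o.2 - y)) (E y) with h5 | h5
      · omega
      · have hy1 : y ≠ o.2 := by rintro rfl; omega
        have h6 := h.down (y + 1) (by omega)
        rw [add_sub_cancel_right] at h6
        omega
  · intro x y hxy
    exact h.even x y (Int.even_iff.1 hxy)

lemma neighbor_subset (v : ℤ × ℤ) (u : ℤ × ℤ) (hu : R.Adj v u) :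
    u = (v.1 + 1, v.2) ∨ u = (v.1 - 1, v.2) ∨ u = (v.1, v.2 + 1) ∨ u = (v.1, v.2 - 1) := by
  simp only [Prod.ext_iff]
  rcases hu.adj_sub with h | h <;> omega

/-- The right ends of the segments of a closed pinecone are joined to the longest row. -/
lemma adj_right_end_up (h : PineconeEnds o k R E) (hR : IsClosed R) {y : ℤ} (hy : o.2 < y)
    (hE : o.1 + (y - o.2) - 1 < E y) : R.Adj (E y, y - 1) (E y, y) := by
  have hv : (E y, y) ∈ R.verts := (h.verts _ _).2 (by omega)
  have hleft : R.Adj (E y, y) (E y - 1, y) := by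
    have := (h.adj (E y - 1) y).2 (by have := h.up_parity y hy; omega)
    rw [sub_add_cancel] at this
    exact this.symm
  by_contra hcon
  refine hR _ hv (Set.ncard_eq_one.2 ⟨(E y - 1, y), ?_⟩)
  ext u
  simp only [SimpleGraph.Subgraph.mem_neighborSet, Set.mem_singleton_iff]
  constructor
  · intro hu
    have hu2 := hu.snd_mem
    rcases neighbor_subset _ _ hu with rfl | rfl | rfl | rfl
    · have := ((h.verts _ _).1 hu2).2.2
      simp only at this
      omega
    · rfl
    · have h1 := (h.verts _ _).1 hu2
      have h2 := h.up y hy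
      simp only at h1
      omega
    · exact absurd hu.symm hcon
  · rintro rfl
    exact hleft

lemma adj_right_end_down (h : PineconeEnds o k R E) (hR : IsClosed R) {y : ℤ} (hy : y ≤ o.2)
    (hE : o.1 + (o.2 - y) < E y) : R.Adj (E y, y) (E y, y + 1) := by
  have hv : (E y, y) ∈ R.verts := (h.verts _ _).2 (by omega)
  have hleft : R.Adj (E y, y) (E y - 1, y) := by
    have := (h.adj (E y - 1) y).2 (by have := h.down_parity y hy; omega)
    rw [sub_add_cancel] at this
    exact this.symm
  by_contra hcon
  refine hR _ hv (Set.ncard_eq_one.2 ⟨(E y - 1, y), ?_⟩)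
  ext u
  simp only [SimpleGraph.Subgraph.mem_neighborSet, Set.mem_singleton_iff]
  constructor
  · intro hu
    have hu2 := hu.snd_mem
    rcases neighbor_subset _ _ hu with rfl | rfl | rfl | rfl
    · have := ((h.verts _ _).1 hu2).2.2
      simp only at this
      omega
    · rfl
    · exact absurd hu hcon
    · have h1 := (h.verts _ _).1 hu2
      have h2 := h.down y hy
      simp only at h1
      omega
  · rintro rfl
    exact hleft

/-- Odd vertical edges are right sides of black squares. -/
lemma isBlackSquare_of_odd (h : PineconeEnds o k R E) (ho : (o.1 + o.2) % 2 = 0) (x y : ℤ)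
    (hxy : (x + y) % 2 = 1) (hadj : R.Adj (x, y) (x, y + 1)) : IsBlackSquare R (x - 1) y := by
  have h1 := (h.verts _ _).1 hadj.fst_mem
  have h2 := (h.verts _ _).1 hadj.snd_mem
  refine ⟨Int.even_iff.2 (by omega), (h.adj _ _).2 (by omega), (h.adj _ _).2 (by omega),
    h.even _ _ (by omega) ((h.verts _ _).2 (by omega)) ((h.verts _ _).2 (by omega)), ?_⟩
  rwa [sub_add_cancel]

lemma bounds_of_isBlackSquare (h : PineconeEnds o k R E) {x y : ℤ} (hb : IsBlackSquare R x y) :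
    0 ≤ x - y - o.1 + o.2 ∧ 0 ≤ x + y - o.1 - o.2 ∧ x + 1 ≤ E y ∧ x + 1 ≤ E (y + 1) := by
  have h1 := (h.adj _ _).1 hb.2.1
  have h2 := (h.adj _ _).1 hb.2.2.1
  omega

/-- Closedness gives the end of a segment a second edge, necessarily the odd vertical edge towards
the longest row, hence the right side of a black square. Maximality is immediate, since black
squares of the pinecone lie within its segments. -/
lemma isEnds (h : PineconeEnds o k R E) (hR : IsClosed R) (ho : (o.1 + o.2) % 2 = 0) :
    IsEnds (IsBlackSquare R) o k E := by
  have hpos := h.pos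
  have hmid := h.mid
  have hmid' := h.mid'
  refine ⟨by omega, Or.inr ⟨by omega, by omega, ?_⟩, ?_, ?_, ?_, ?_, ?_⟩
  · exact h.isBlackSquare_of_odd ho _ _ (h.down_parity _ le_rfl)
      (h.adj_right_end_down hR le_rfl (by omega))
  · intro x hx _ _
    exact (h.bounds_of_isBlackSquare hx).2.2.1
  · intro y hy
    refine (h.up y hy).imp_right fun h1 => ⟨h1.1, h1.2, ?_⟩
    have h2 := h.adj_right_end_up hR (y := y + 1) (by omega) (by omega)
    rw [add_sub_cancel_right] at h2
    exact h.isBlackSquare_of_odd ho _ _ (by have := h.up_parity (y + 1) (by omega); omega) h2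
  · intro y _ x hx _ _
    exact (h.bounds_of_isBlackSquare hx).2.2.2
  · intro y hy
    refine (h.down y hy).imp_right fun h1 => ⟨h1.1, h1.2, ?_⟩
    exact h.isBlackSquare_of_odd ho _ _ (h.down_parity (y - 1) (by omega))
      (h.adj_right_end_down hR (by omega) (by omega))
  · intro y _ x hx _ _
    exact (h.bounds_of_isBlackSquare hx).2.2.1

/-- A closed pinecone is determined by its vertices and its black squares. -/
lemma eq_completedOn (h : PineconeEnds o k R E) (hR : IsClosed R) (ho : (o.1 + o.2) % 2 = 0) :
    R = completedOn R (coreVerts o k E) := by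
  have hmem : ∀ x y, (x, y) ∈ R.verts ↔ (x, y) ∈ coreVerts o k E := by
    intro x y
    rw [h.verts, (h.isEnds hR ho).mem_coreVerts_iff IsBlackSquare.emod_two ho]
  have hrow : ∀ x y, (x, y) ∈ R.verts → (x + 1, y) ∈ R.verts → R.Adj (x, y) (x + 1, y) := by
    intro x y h1 h2
    rw [h.verts] at h1 h2
    exact (h.adj _ _).2 (by omega)
  ext u v
  · exact hmem u.1 u.2
  · constructor
    · intro huv
      exact ⟨⟨huv.adj_sub, (hmem _ _).1 huv.fst_mem, (hmem _ _).1 huv.snd_mem⟩, Or.inl huv⟩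
    · obtain ⟨a, b⟩ := u
      obtain ⟨c, d⟩ := v
      rintro ⟨⟨h1, hu, hv⟩, h2⟩
      rw [← hmem] at hu hv
      rcases h1 with ⟨h3, h4 | h4⟩ | ⟨h3, h4 | h4⟩ <;> simp only at h3 h4 <;> subst h3 <;> subst h4
      · exact hrow _ _ hu hv
      · exact (hrow _ _ hv hu).symm
      · rcases h2 with h2 | h2 | ⟨-, h2⟩
        · exact h2
        · simp at h2
        · refine h.even _ _ (Int.even_iff.1 ?_) hu hv
          simpa using h2
      · rcases h2 with h2 | h2 | ⟨-, h2⟩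
        · exact h2
        · simp at h2
        · refine (h.even _ _ (Int.even_iff.1 ?_) hv hu).symm
          simpa using h2

end PineconeEnds

/-! ### Cores -/

lemma exists_last (r : ℕ → Prop) (h1 : r 1) (hmono : ∀ m, 1 ≤ m → r (m + 1) → r m)
    (hb : ∃ N, ∀ m, N ≤ m → ¬ r m) : ∃ i, 1 ≤ i ∧ ∀ m, 1 ≤ m → (r m ↔ m ≤ i) := by
  classical
  have hex : ∃ m, ¬ r (m + 1) := by
    obtain ⟨N, hN⟩ := hb
    exact ⟨N, hN _ (by omega)⟩
  have hspec := Nat.find_spec hex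
  have hmin := fun m => Nat.find_min hex (m := m)
  set i := Nat.find hex
  have hi : 1 ≤ i := by
    by_contra hcon
    rw [show i = 0 by omega] at hspec
    exact hspec h1
  refine ⟨i, hi, fun m hm => ⟨fun hr => ?_, fun hmi => ?_⟩⟩
  · by_contra hcon
    have key : ∀ d, r (i + 1 + d) → False := by
      intro d
      induction d with
      | zero => exact hspec
      | succ d ih => exact fun h => ih (hmono _ (by omega) h)
    refine key (m - (i + 1)) ?_
    rwa [show i + 1 + (m - (i + 1)) = m by omega]
  · have := hmin (m - 1) (by omega)
    rw [not_not, Nat.sub_add_cancel hm] at this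
    exact this

lemma ncard_ne_one {s : Set (ℤ × ℤ)} {a b : ℤ × ℤ} (ha : a ∈ s) (hb : b ∈ s) (hab : a ≠ b) :
    s.ncard ≠ 1 := by
  intro h
  obtain ⟨c, rfl⟩ := Set.ncard_eq_one.1 h
  exact hab (ha.trans hb.symm)

lemma completedOn_mono {P : LatticeGraph} {K K' : Finset (ℤ × ℤ)} (hK : K ⊆ K') :
    completedOn P K ≤ completedOn P K' :=
  ⟨fun _ hv => hK hv, fun _ _ h => ⟨⟨h.1.1, hK h.1.2.1, hK h.1.2.2⟩, h.2⟩⟩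

section

variable {P : LatticeGraph} {o : ℤ × ℤ} {n : ℤ} {E : ℤ → ℤ}

/-- Moving away from the longest row, each genuine end of `R` is the right side of a black square of
`P`. Maximality of `E` then bounds the ends of `R` row by row. -/
lemma le_completedOn_coreVerts (h : IsEnds (IsBlackSquare P) o n E) (ho : (o.1 + o.2) % 2 = 0)
    (hodd : ∀ x y, (x + y) % 2 = 1 → P.Adj (x, y) (x, y + 1) → IsBlackSquare P (x - 1) y)
    {R : LatticeGraph} (hR : R ≤ completedOn P (rootedDiamond o n)) (hclosed : IsClosed R) {k : ℕ}
    (hp : IsPinecone o k R) : R ≤ completedOn P (coreVerts o n E) := by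
  obtain ⟨-, -, -, F, hF, -, -, -⟩ := hp.exists_ends
  have hblack : ∀ x y, (x + y) % 2 = 1 → R.Adj (x, y) (x, y + 1) →
      IsBlackSquare P (x - 1) y ∧ (x, y) ∈ rootedDiamond o n := by
    intro x y hxy hadj
    obtain ⟨h1, h2⟩ := completedOn_adj_up.1 (hR.2 hadj)
    rcases h2 with h2 | h2
    · exact ⟨hodd x y hxy h2, h1.1⟩
    · omega
  have hmid : F o.2 ≤ E o.2 := by
    have hpos := hF.pos
    have h1 := hF.mid
    obtain ⟨h2, h3⟩ := hblack _ _ (hF.down_parity _ le_rfl)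
      (hF.adj_right_end_down hclosed le_rfl (by omega))
    rw [mem_rootedDiamond] at h3
    have := h.last_max _ h2 (by omega) (by omega)
    omega
  have hup : ∀ y, o.2 < y → o.1 + (y - o.2) - 1 < F y → F y ≤ E y := by
    intro y hy
    induction y, (show o.2 + 1 ≤ y from hy) using Int.leInduction with
    | base =>
      intro _
      rw [h.mid, hF.mid', ← hF.mid]
      exact hmid
    | succ y hy' ih =>
      intro hreal
      have h1 := hF.up y (by omega)
      have h2 := ih (by omega) (by omega)
      have h3 := hF.adj_right_end_up hclosed (y := y + 1) (by omega) hreal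
      rw [add_sub_cancel_right] at h3
      obtain ⟨h4, -⟩ := hblack _ _ (by have := hF.up_parity (y + 1) (by omega); omega) h3
      have := h.up_max y (by omega) _ h4 (by omega) (by omega)
      omega
  have hdown : ∀ y, y ≤ o.2 → o.1 + (o.2 - y) < F y → F y ≤ E y := by
    intro y hy
    induction y, hy using Int.leInductionDown with
    | base => exact fun _ => hmid
    | pred y hy' ih =>
      intro hreal
      have h1 := hF.down y (by omega)
      have h2 := ih (by omega)
      have h3 := hF.adj_right_end_down hclosed (y := y - 1) (by omega) (by omega)
      obtain ⟨h4, -⟩ := hblack _ _ (hF.down_parity (y - 1) (by omega)) h3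
      have := h.down_max y (by omega) _ h4 (by omega) (by omega)
      omega
  have hmem : ∀ v ∈ R.verts, v ∈ coreVerts o n E := by
    rintro ⟨x, y⟩ hv
    have h1 : (x, y) ∈ rootedDiamond o n := hR.1 hv
    rw [hF.verts] at hv
    rw [mem_coreVerts]
    refine ⟨h1, ?_⟩
    rcases lt_or_ge o.2 y with hy | hy
    · have := hF.up_parity y hy
      rcases lt_or_ge (o.1 + (y - o.2) - 1) (F y) with h5 | h5
      · have := hup y hy h5
        omega
      · have hpos := hF.pos
        have h7 := hF.mid'
        have hy1 : y ≠ o.2 + 1 := by rintro rfl; omega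
        have h6 := hF.up (y - 1) (by omega)
        rw [sub_add_cancel] at h6
        omega
    · have := hF.down_parity y hy
      rcases lt_or_ge (o.1 + (o.2 - y)) (F y) with h5 | h5
      · have := hdown y hy h5
        omega
      · have hpos := hF.pos
        have h7 := hF.mid
        have hy1 : y ≠ o.2 := by rintro rfl; omega
        have h6 := hF.down (y + 1) (by omega)
        rw [add_sub_cancel_right] at h6
        omega
  exact ⟨hmem, fun u v huv => ⟨⟨huv.adj_sub, hmem _ huv.fst_mem, hmem _ huv.snd_mem⟩,
    (hR.2 huv).2⟩⟩

/-- An inner vertex of a segment has two horizontal neighbours; a left end has its right neighbour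
and an even vertical edge; a right end has its left neighbour and the right side of the black square
ending the segment. -/
lemma isClosed_completedOn_coreVerts (h : IsEnds (IsBlackSquare P) o n E)
    (ho : (o.1 + o.2) % 2 = 0) : IsClosed (completedOn P (coreVerts o n E)) := by
  have hB := IsBlackSquare.emod_two (P := P)
  have hmem := @IsEnds.mem_coreVerts_iff _ _ _ _ h hB ho
  rintro ⟨x, y⟩ hv
  replace hv : (x, y) ∈ coreVerts o n E := hv
  have hv' := hmem.1 hv
  rcases lt_or_ge o.2 y with hy | hy
  · obtain ⟨hp, hc⟩ := h.up_cases hB ho y hy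
    have hc' : o.1 + (y - o.2) - 1 < E y ∧ E y ≤ E (y - 1) ∧ IsBlackSquare P (E y - 1) (y - 1) := by
      rcases hc with hc | hc
      · omega
      · exact ⟨hc.1, hc.2.2⟩
    obtain ⟨h1, h2, h3⟩ := hc'
    have hdownAdj : ∀ (hP : P.Adj (x, y - 1) (x, y) ∨ (x + (y - 1)) % 2 = 0),
        (completedOn P (coreVerts o n E)).Adj (x, y) (x, y - 1) := by
      intro hP
      have := (completedOn_adj_up (P := P) (K := coreVerts o n E) (x := x) (y := y - 1)).2
      rw [sub_add_cancel] at this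
      exact (this ⟨⟨hmem.2 (by omega), hv⟩, hP⟩).symm
    have hright : x < E y → (completedOn P (coreVerts o n E)).Adj (x, y) (x + 1, y) :=
      fun hx => completedOn_adj_right.2 ⟨hv, hmem.2 (by omega)⟩
    have hleft : -1 ≤ x - 1 - y - o.1 + o.2 →
        (completedOn P (coreVerts o n E)).Adj (x, y) (x - 1, y) := by
      intro hx
      have := (completedOn_adj_right (P := P) (K := coreVerts o n E) (x := x - 1) (y := y)).2
      rw [sub_add_cancel] at this
      exact (this ⟨hmem.2 (by omega), hv⟩).symm
    by_cases hx1 : x < E y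
    · by_cases hx2 : -1 ≤ x - 1 - y - o.1 + o.2
      · exact ncard_ne_one (hright hx1) (hleft hx2) (by rw [Ne, Prod.mk.injEq]; omega)
      · exact ncard_ne_one (hright hx1) (hdownAdj (Or.inr (by omega)))
          (by rw [Ne, Prod.mk.injEq]; omega)
    · obtain rfl : x = E y := by omega
      refine ncard_ne_one (hleft (by omega)) (hdownAdj (Or.inl ?_))
        (by rw [Ne, Prod.mk.injEq]; omega)
      have := h3.2.2.2.2
      rwa [sub_add_cancel, sub_add_cancel] at this
  · obtain ⟨hp, hc⟩ := h.down_cases hB ho y hy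
    have hc' : o.1 + (o.2 - y) < E y ∧ E y ≤ E (y + 1) ∧ IsBlackSquare P (E y - 1) y := by
      rcases hc with hc | hc
      · omega
      · exact ⟨hc.1, hc.2.2⟩
    obtain ⟨h1, h2, h3⟩ := hc'
    have hupAdj : ∀ (hP : P.Adj (x, y) (x, y + 1) ∨ (x + y) % 2 = 0),
        (completedOn P (coreVerts o n E)).Adj (x, y) (x, y + 1) :=
      fun hP => completedOn_adj_up.2 ⟨⟨hv, hmem.2 (by omega)⟩, hP⟩
    have hright : x < E y → (completedOn P (coreVerts o n E)).Adj (x, y) (x + 1, y) :=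
      fun hx => completedOn_adj_right.2 ⟨hv, hmem.2 (by omega)⟩
    have hleft : 0 ≤ x - 1 + y - o.1 - o.2 →
        (completedOn P (coreVerts o n E)).Adj (x, y) (x - 1, y) := by
      intro hx
      have := (completedOn_adj_right (P := P) (K := coreVerts o n E) (x := x - 1) (y := y)).2
      rw [sub_add_cancel] at this
      exact (this ⟨hmem.2 (by omega), hv⟩).symm
    by_cases hx1 : x < E y
    · by_cases hx2 : 0 ≤ x - 1 + y - o.1 - o.2
      · exact ncard_ne_one (hright hx1) (hleft hx2) (by rw [Ne, Prod.mk.injEq]; omega)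
      · exact ncard_ne_one (hright hx1) (hupAdj (Or.inr (by omega)))
          (by rw [Ne, Prod.mk.injEq]; omega)
    · obtain rfl : x = E y := by omega
      refine ncard_ne_one (hleft (by omega)) (hupAdj (Or.inl ?_))
        (by rw [Ne, Prod.mk.injEq]; omega)
      have := h3.2.2.2.2
      rwa [sub_add_cancel] at this

lemma exists_isPinecone_completedOn_coreVerts (h : IsEnds (IsBlackSquare P) o n E)
    (ho : (o.1 + o.2) % 2 = 0) (hne : o.1 < E o.2) :
    ∃ k, IsPinecone o k (completedOn P (coreVerts o n E)) := by
  have hB := IsBlackSquare.emod_two (P := P)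
  have hmem := @IsEnds.mem_coreVerts_iff _ _ _ _ h hB ho
  have hp0 := (h.down_cases hB ho o.2 le_rfl).1
  obtain ⟨k, hk⟩ : ∃ k : ℕ, E o.2 = o.1 + 2 * k - 1 :=
    ⟨((E o.2 - o.1 + 1) / 2).toNat, by omega⟩
  have hends : PineconeEnds o k (completedOn P (coreVerts o n E)) E := by
    refine ⟨by omega, fun x y => hmem, ?_, ?_, hk, h.mid ▸ hk, ?_, ?_, ?_, ?_⟩
    · intro x y
      rw [completedOn_adj_right, hmem, hmem]
      omega
    · exact fun x y hxy h1 h2 => completedOn_adj_up.2 ⟨⟨h1, h2⟩, Or.inr hxy⟩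
    · exact fun y hy => (h.up y hy).imp_right fun h1 => ⟨h1.1, h1.2.1⟩
    · exact fun y hy => (h.down y hy).imp_right fun h1 => ⟨h1.1, h1.2.1⟩
    · exact fun y hy => (h.up_cases hB ho y hy).1
    · exact fun y hy => (h.down_cases hB ho y hy).1
  obtain ⟨i, hi, hup⟩ := exists_last (fun m => o.1 + ((o.2 + m) - o.2) - 1 < E (o.2 + m))
    (by have := h.mid; push_cast; omega)
    (by
      intro m hm hr
      have := h.up (o.2 + m) (by omega)
      push_cast at hr
      rw [← add_assoc] at hr
      omega)
    ⟨(n + 1).toNat, by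
      intro m hm hr
      have := h.up_cases hB ho (o.2 + m) (by have := h.last; omega)
      omega⟩
  obtain ⟨j, hj, hdown⟩ := exists_last
    (fun m => o.1 + (o.2 - (o.2 - (m - 1))) < E (o.2 - (m - 1)))
    (by push_cast; simpa using hne)
    (by
      intro m hm hr
      have := h.down (o.2 - (m - 1)) (by omega)
      push_cast at hr
      rw [show o.2 - (m - 1 : ℤ) - 1 = o.2 - (m + 1 - 1) by ring] at this
      omega)
    ⟨(n + 1).toNat + 1, by
      intro m hm hr
      have := h.down_cases hB ho (o.2 - (m - 1)) (by omega)
      omega⟩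
  refine ⟨k, hends.isPinecone ho (i := i) (j := j - 1) hi ?_ ?_⟩
  · intro y hy
    have := hup (y - o.2).toNat (by omega)
    rw [Int.toNat_of_nonneg (by omega), show o.2 + (y - o.2) = y by ring] at this
    rw [this]
    omega
  · intro y hy
    have := hdown (o.2 - y + 1).toNat (by omega)
    rw [Int.toNat_of_nonneg (by omega), show o.2 - (o.2 - y + 1 - 1) = y by ring] at this
    rw [this]
    omega

/-- The greedy graph contains every competing closed pinecone and, unless empty, is itself one of
them, so the union defining the core is attained. -/
theorem core_completedOn (h : IsEnds (IsBlackSquare P) o n E) (ho : (o.1 + o.2) % 2 = 0)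
    (hodd : ∀ x y, (x + y) % 2 = 1 → P.Adj (x, y) (x, y + 1) → IsBlackSquare P (x - 1) y) :
    core o (completedOn P (rootedDiamond o n)) = completedOn P (coreVerts o n E) := by
  have hB := IsBlackSquare.emod_two (P := P)
  refine le_antisymm (sSup_le ?_) ?_
  · rintro R ⟨h1, h2, k, h3⟩
    exact le_completedOn_coreVerts h ho hodd h1 h2 h3
  · rcases h.last with h1 | ⟨h1, -⟩
    · have hempty : ∀ v : ℤ × ℤ, v ∉ coreVerts o n E := by
        rintro ⟨x, y⟩ hv
        rw [h.mem_coreVerts_iff hB ho] at hv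
        have hup : ∀ y, o.2 < y → E y = o.1 + (y - o.2) - 2 := by
          intro y hy
          induction y, (show o.2 + 1 ≤ y from hy) using Int.leInduction with
          | base => rw [h.mid]; omega
          | succ y hy' ih =>
            have := h.up y (by omega)
            have := ih (by omega)
            omega
        have hdown : ∀ y, y ≤ o.2 → E y = o.1 + (o.2 - y) - 1 := by
          intro y hy
          induction y, hy using Int.leInductionDown with
          | base => omega
          | pred y hy' ih =>
            have := h.down y (by omega)
            omega
        rcases lt_or_ge o.2 y with hy | hy
        · have := hup y hy
          omega
        · have := hdown y hy
          omega
      exact ⟨fun v hv => absurd hv (hempty v), fun u v huv => absurd huv.1.2.1 (hempty u)⟩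
    · exact le_sSup ⟨completedOn_mono (Finset.filter_subset _ _),
        isClosed_completedOn_coreVerts h ho, exists_isPinecone_completedOn_coreVerts h ho h1⟩

end

/-! ### Interleaved pinecones -/

/-- `W y` is the right end of the second black square from the right among those that carry the
right end of the segment at ordinate `y`. -/
structure SecondEnds (B : ℤ → ℤ → Prop) (o : ℤ × ℤ) (E W : ℤ → ℤ) : Prop where
  mid : W (o.2 + 1) = W o.2
  up : ∀ y, o.2 < y → W y = o.1 + (y - o.2) - 2 ∨
    (o.1 + (y - o.2) - 1 < W y ∧ W y < E y ∧ B (W y - 1) (y - 1))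
  up_max : ∀ y, o.2 < y → ∀ x, B x (y - 1) → W y < x + 1 → E y ≤ x + 1
  up_lt : ∀ y, o.2 < y → W y < E (y + 1)
  up_step : ∀ y, o.2 < y → W (y + 1) = o.1 + (y - o.2) - 1 ∨ W (y + 1) < W y
  down : ∀ y, y ≤ o.2 → W y = o.1 + (o.2 - y) - 1 ∨
    (o.1 + (o.2 - y) < W y ∧ W y < E y ∧ B (W y - 1) y)
  down_max : ∀ y, y ≤ o.2 → ∀ x, B x y → W y < x + 1 → E y ≤ x + 1
  down_lt : ∀ y, y ≤ o.2 → W y < E (y - 1)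
  down_step : ∀ y, y ≤ o.2 → W (y - 1) = o.1 + (o.2 - y) ∨ W (y - 1) < W y

lemma exists_second_last (p : ℤ → Prop) (e : ℤ) :
    (∀ x, p x → e ≤ x + 1) ∨ ∃ w, p (w - 1) ∧ w < e ∧ ∀ x, p x → w < x + 1 → e ≤ x + 1 := by
  by_cases h : ∃ x, p x ∧ x + 1 < e
  · obtain ⟨x, hx⟩ := h
    obtain ⟨m, hm, hmax⟩ := Int.exists_greatest_of_bdd (P := fun z => p z ∧ z + 1 < e)
      ⟨e, fun z hz => by omega⟩ ⟨x, hx⟩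
    refine Or.inr ⟨m + 1, by simpa using hm.1, hm.2, fun z hz hlt => ?_⟩
    by_contra hcon
    have := hmax z ⟨hz, by omega⟩
    omega
  · push Not at h
    exact Or.inl h

namespace PineconeEnds

variable {o : ℤ × ℤ} {k : ℕ} {P : LatticeGraph} {E : ℤ → ℤ}

/-- Interleaving enters here: between the last two black squares that carry ends in one row, there
is a black square in each neighbouring row. This compares second ends with the adjacent ends and
with each other. -/
lemma exists_secondEnds (h : PineconeEnds o k P E) (hclosed : IsClosed P)
    (ho : (o.1 + o.2) % 2 = 0) (hinter : IsInterleaved P) :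
    ∃ W, SecondEnds (IsBlackSquare P) o E W := by
  have hE := h.isEnds hclosed ho
  have hB := IsBlackSquare.emod_two (P := P)
  have hex : ∀ y, ∃ w, (o.2 < y → (w = o.1 + (y - o.2) - 2 ∨
        (o.1 + (y - o.2) - 1 < w ∧ w < E y ∧ IsBlackSquare P (w - 1) (y - 1))) ∧
        ∀ x, IsBlackSquare P x (y - 1) → w < x + 1 → E y ≤ x + 1) ∧
      (y ≤ o.2 → (w = o.1 + (o.2 - y) - 1 ∨
        (o.1 + (o.2 - y) < w ∧ w < E y ∧ IsBlackSquare P (w - 1) y)) ∧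
        ∀ x, IsBlackSquare P x y → w < x + 1 → E y ≤ x + 1) := by
    intro y
    rcases lt_or_ge o.2 y with hy | hy
    · rcases exists_second_last (fun x => IsBlackSquare P x (y - 1)) (E y) with h1 | ⟨w, h1, h2, h3⟩
      · exact ⟨_, fun _ => ⟨Or.inl rfl, fun x hx _ => h1 x hx⟩, fun h => absurd h (by omega)⟩
      · refine ⟨w, fun _ => ⟨Or.inr ⟨?_, h2, h1⟩, h3⟩, fun h => absurd h (by omega)⟩
        have := h.bounds_of_isBlackSquare h1
        omega
    · rcases exists_second_last (fun x => IsBlackSquare P x y) (E y) with h1 | ⟨w, h1, h2, h3⟩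
      · exact ⟨_, fun h => absurd h (by omega), fun _ => ⟨Or.inl rfl, fun x hx _ => h1 x hx⟩⟩
      · refine ⟨w, fun h => absurd h (by omega), fun _ => ⟨Or.inr ⟨?_, h2, h1⟩, h3⟩⟩
        have := h.bounds_of_isBlackSquare h1
        omega
  choose W hW using hex
  refine ⟨W, ?_, fun y hy => ((hW y).1 hy).1, fun y hy => ((hW y).1 hy).2, ?_, ?_,
    fun y hy => ((hW y).2 hy).1, fun y hy => ((hW y).2 hy).2, ?_, ?_⟩
  · obtain ⟨h1, h2⟩ := (hW (o.2 + 1)).1 (by omega)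
    obtain ⟨h3, h4⟩ := (hW o.2).2 le_rfl
    rw [add_sub_cancel_right] at h1 h2
    have h5 := h.mid
    have h6 := h.mid'
    rcases h1 with h1 | ⟨h1, h1', h1''⟩ <;> rcases h3 with h3 | ⟨h3, h3', h3''⟩
    · omega
    · have := h2 _ h3'' (by omega)
      omega
    · have := h4 _ h1'' (by omega)
      omega
    · have h7 := h2 _ h3''
      have h8 := h4 _ h1''
      omega
  · intro y hy
    rcases ((hW y).1 hy).1 with h1 | ⟨h1, h2, h3⟩
    · have := h.up y hy
      omega
    · have h4 : IsBlackSquare P (E y - 1) (y - 1) := by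
        rcases (hE.up_cases hB ho y hy).2 with h5 | h5
        · omega
        · exact h5.2.2.2
      -- The intermediate black square in row `y` lies under the segment at `y + 1`, whose end
      -- therefore exceeds `W y`.
      obtain ⟨⟨z, hz1, hz2, hz3⟩, -⟩ := hinter (y - 1) _ _ (by omega) h3 h4
      rw [sub_add_cancel] at hz3
      have := h.bounds_of_isBlackSquare hz3
      omega
  · intro y hy
    rcases ((hW (y + 1)).1 (by omega)).1 with h1 | ⟨h1, h2, h3⟩
    · exact Or.inl (by omega)
    · right
      rw [add_sub_cancel_right] at h3
      have h4 := hE.up y hy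
      have h5 : E (y + 1) < E y ∧ IsBlackSquare P (E (y + 1) - 1) y := by
        rcases h4 with h4 | h4
        · omega
        · exact h4.2
      -- The intermediate black square in row `y - 1` is not the last there, so it ends at or before
      -- `W y`; hence the second ends decrease.
      obtain ⟨-, z, hz1, hz2, hz3⟩ := hinter y _ _ (by omega) h3 h5.2
      have := ((hW y).1 hy).2 z hz3
      omega
  · intro y hy
    rcases ((hW y).2 hy).1 with h1 | ⟨h1, h2, h3⟩
    · have := h.down y hy
      omega
    · have h4 : IsBlackSquare P (E y - 1) y := by
        rcases (hE.down_cases hB ho y hy).2 with h5 | h5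
        · omega
        · exact h5.2.2.2
      obtain ⟨-, z, hz1, hz2, hz3⟩ := hinter y _ _ (by omega) h3 h4
      have := h.bounds_of_isBlackSquare hz3
      rw [sub_add_cancel] at this
      omega
  · intro y hy
    rcases ((hW (y - 1)).2 (by omega)).1 with h1 | ⟨h1, h2, h3⟩
    · exact Or.inl (by omega)
    · right
      have h4 := hE.down y hy
      have h5 : E (y - 1) < E y ∧ IsBlackSquare P (E (y - 1) - 1) (y - 1) := by
        rcases h4 with h4 | h4
        · omega
        · exact h4.2
      obtain ⟨⟨z, hz1, hz2, hz3⟩, -⟩ := hinter (y - 1) _ _ (by omega) h3 h5.2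
      rw [sub_add_cancel] at hz3
      have := ((hW y).2 hy).2 z hz3
      omega

end PineconeEnds

/-! ### Right ends of the cores of the sub-diamonds. -/

/-- The right ends of the segments after deletion of the two leftmost vertices of each row of the
diamond. -/
def trimmedEnds (o : ℤ × ℤ) (F : ℤ → ℤ) (y : ℤ) : ℤ :=
  if o.2 < y then max (F y) (o.1 + (y - o.2)) else max (F y) (o.1 + (o.2 - y) + 1)

lemma trimmedEnds_up {o : ℤ × ℤ} {F : ℤ → ℤ} {y : ℤ} (hy : o.2 < y) :
    trimmedEnds o F y = max (F y) (o.1 + (y - o.2)) := if_pos hy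

lemma trimmedEnds_down {o : ℤ × ℤ} {F : ℤ → ℤ} {y : ℤ} (hy : y ≤ o.2) :
    trimmedEnds o F y = max (F y) (o.1 + (o.2 - y) + 1) := if_neg (by omega)

/-- Moving the root two units right while lowering the order by one keeps the right boundary. Ends
are unchanged unless they fall before the new left boundary, where the maximum supplies the value
for an empty segment. This passes from `A` to `A_E` and from `A_W` to `A_C`. -/
lemma IsEnds.trim {B : ℤ → ℤ → Prop} {o : ℤ × ℤ} {n : ℤ} {F : ℤ → ℤ} (h : IsEnds B o n F)
    (hB : ∀ x y, B x y → (x + y) % 2 = 0) (ho : (o.1 + o.2) % 2 = 0) :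
    IsEnds B (o.1 + 2, o.2) (n - 1) (trimmedEnds o F) := by
  have hmid := h.mid
  have hd := (h.down_cases hB ho o.2 le_rfl).1
  constructor
  · simp only
    rw [trimmedEnds_up (by omega), trimmedEnds_down le_rfl]
    omega
  · simp only
    rw [trimmedEnds_down le_rfl]
    rcases h.last with h1 | ⟨h1, h2, h3⟩
    · omega
    · rcases le_or_gt (F o.2) (o.1 + 1) with h4 | h4
      · omega
      · rw [max_eq_left (by omega)]
        exact Or.inr ⟨by omega, by omega, h3⟩
  · intro x hx h1 h2
    simp only at hx h1 h2 ⊢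
    rw [trimmedEnds_down le_rfl]
    have := h.last_max x hx (by omega) (by omega)
    omega
  · intro y hy
    simp only at hy ⊢
    rw [trimmedEnds_up (by omega), trimmedEnds_up (by omega)]
    have hp := (h.up_cases hB ho (y + 1) (by omega)).1
    rcases h.up y hy with h1 | ⟨h1, h2, h3⟩
    · omega
    · rcases le_or_gt (F (y + 1)) (o.1 + (y + 1 - o.2)) with h4 | h4
      · omega
      · rw [max_eq_left (by omega)]
        exact Or.inr ⟨by omega, by omega, h3⟩
  · intro y hy x hx h1 h2
    simp only at hy hx h1 h2 ⊢
    rw [trimmedEnds_up (by omega)] at h2 ⊢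
    have := h.up_max y hy x hx (by omega) (by omega)
    omega
  · intro y hy
    simp only at hy ⊢
    rw [trimmedEnds_down (by omega), trimmedEnds_down (by omega)]
    have hp := (h.down_cases hB ho (y - 1) (by omega)).1
    rcases h.down y hy with h1 | ⟨h1, h2, h3⟩
    · omega
    · rcases le_or_gt (F (y - 1)) (o.1 + (o.2 - (y - 1)) + 1) with h4 | h4
      · omega
      · rw [max_eq_left (by omega)]
        exact Or.inr ⟨by omega, by omega, h3⟩
  · intro y hy x hx h1 h2
    simp only at hy hx h1 h2 ⊢
    rw [trimmedEnds_down (by omega)] at h2 ⊢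
    have := h.down_max y hy x hx (by omega) (by omega)
    omega

/-- The West diamond cuts off the last black square of the longest row. Its core must then stop at
the second-to-last black square there, and by interleaving in all other rows too. -/
lemma SecondEnds.isEnds {B : ℤ → ℤ → Prop} {o : ℤ × ℤ} {k : ℤ} {E W : ℤ → ℤ}
    (h : SecondEnds B o E W) (hB : ∀ x y, B x y → (x + y) % 2 = 0)
    (ho : (o.1 + o.2) % 2 = 0) (hE : E o.2 = o.1 + 2 * k - 1) : IsEnds B o (k - 1) W := by
  constructor
  · exact h.mid
  · rcases h.down o.2 le_rfl with h1 | ⟨h1, h2, h3⟩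
    · omega
    · have := hB _ _ h3
      exact Or.inr ⟨by omega, by omega, h3⟩
  · intro x hx h1 h2
    have := h.down_max o.2 le_rfl x hx
    omega
  · intro y hy
    have h0 := h.up_step y hy
    rcases h.up (y + 1) (by omega) with h1 | ⟨h1, h2, h3⟩
    · omega
    · rw [add_sub_cancel_right] at h3
      rcases h0 with h0 | h0
      · omega
      · exact Or.inr ⟨by omega, h0, h3⟩
  · intro y hy x hx h1 h2
    have h3 := h.up_max (y + 1) (by omega) x (by rwa [add_sub_cancel_right])
    have h4 := h.up_lt y hy
    omega
  · intro y hy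
    have h0 := h.down_step y hy
    rcases h.down (y - 1) (by omega) with h1 | ⟨h1, h2, h3⟩
    · omega
    · rcases h0 with h0 | h0
      · omega
      · exact Or.inr ⟨by omega, h0, h3⟩
  · intro y hy x hx h1 h2
    have h3 := h.down_max (y - 1) (by omega) x hx
    have h4 := h.down_lt y hy
    omega

/-- The right ends of the segments of the North core. -/
def northEnds (o : ℤ × ℤ) (E W : ℤ → ℤ) (y : ℤ) : ℤ :=
  if o.2 + 1 < y then E y else if y = o.2 + 1 then E (o.2 + 2) else trimmedEnds o W y

/-- The right ends of the segments of the South core. -/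
def southEnds (o : ℤ × ℤ) (E W : ℤ → ℤ) (y : ℤ) : ℤ :=
  if y < o.2 then E y else if y = o.2 then E (o.2 - 1) else trimmedEnds o W y

section

variable {o : ℤ × ℤ} {E W : ℤ → ℤ} {y : ℤ}

lemma northEnds_up (hy : o.2 + 1 < y) : northEnds o E W y = E y := if_pos hy

lemma northEnds_mid : northEnds o E W (o.2 + 1) = E (o.2 + 2) := by simp [northEnds]

lemma northEnds_down (hy : y ≤ o.2) : northEnds o E W y = trimmedEnds o W y := by
  rw [northEnds, if_neg (by omega), if_neg (by omega)]

lemma southEnds_down (hy : y < o.2) : southEnds o E W y = E y := if_pos hy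

lemma southEnds_mid : southEnds o E W o.2 = E (o.2 - 1) := by simp [southEnds]

lemma southEnds_up (hy : o.2 < y) : southEnds o E W y = trimmedEnds o W y := by
  rw [southEnds, if_neg (by omega), if_neg (by omega)]

end

namespace PineconeEnds

variable {o : ℤ × ℤ} {k : ℕ} {P : LatticeGraph} {E W : ℤ → ℤ}

/-- The North core's longest row is row `o.2 + 1`, so its two middle segments both end at `E (o.2 +
2)`. Higher segments end as in `P`; lower ones end as in the central core, whose left boundary they
share. -/
lemma isEnds_north (h : PineconeEnds o k P E) (hclosed : IsClosed P)
    (ho : (o.1 + o.2) % 2 = 0) (hW : SecondEnds (IsBlackSquare P) o E W) :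
    IsEnds (IsBlackSquare P) (o.1 + 1, o.2 + 1) (k - 1) (northEnds o E W) := by
  have hB := IsBlackSquare.emod_two (P := P)
  have hE := h.isEnds hclosed ho
  have hC := (hW.isEnds hB ho h.mid).trim hB ho
  have hm1 := h.mid
  have hm2 := h.mid'
  have hu := hE.up (o.2 + 1) (by omega)
  rw [add_assoc, one_add_one_eq_two] at hu
  constructor
  · simp only
    rw [northEnds_up (by omega), northEnds_mid, add_assoc, one_add_one_eq_two]
  · simp only
    rw [northEnds_mid]
    rcases hu with h1 | ⟨h1, h2, h3⟩
    · omega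
    · exact Or.inr ⟨by omega, by omega, h3⟩
  · intro x hx h1 h2
    simp only at hx h1 h2 ⊢
    have := h.bounds_of_isBlackSquare hx
    rw [add_assoc, one_add_one_eq_two] at this
    rw [northEnds_mid]
    omega
  · intro y hy
    simp only at hy ⊢
    rw [northEnds_up (by omega), northEnds_up (by omega)]
    refine (hE.up y (by omega)).imp (by omega) fun h1 => ⟨by omega, h1.2⟩
  · intro y hy x hx h1 h2
    simp only at hy hx h1 h2 ⊢
    rw [northEnds_up (by omega)] at h2 ⊢
    exact hE.up_max y (by omega) x hx (by omega) h2
  · intro y hy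
    simp only at hy ⊢
    rw [northEnds_down (by omega)]
    rcases hy.lt_or_eq with hy | rfl
    · rw [northEnds_down (by omega)]
      refine (hC.down y (by simp only; omega)).imp ?_ fun h1 => ⟨?_, h1.2⟩
      · simp only; omega
      · have := h1.1
        simp only at this
        omega
    · rw [northEnds_mid, add_sub_cancel_right]
      -- Interleaving places the second end of row `o.2` strictly before the new middle end, while
      -- the last one lies beyond it.
      have h4 := hW.up_lt (o.2 + 1) (by omega)
      rw [hW.mid, add_assoc, one_add_one_eq_two] at h4
      rcases hC.last with h1 | ⟨h1, h2, h3⟩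
      · simp only at h1
        omega
      · simp only at h1 h2 h3
        refine Or.inr ⟨by omega, ?_, h3⟩
        rw [trimmedEnds_down le_rfl] at h1 ⊢
        omega
  · intro y hy x hx h1 h2
    simp only at hy hx h1 h2 ⊢
    rw [northEnds_down (by omega)]
    rcases hy.lt_or_eq with hy | rfl
    · rw [northEnds_down (by omega)] at h2
      exact hC.down_max y (by simp only; omega) x hx (by simp only; omega) h2
    · rw [northEnds_mid] at h2
      rw [add_sub_cancel_right] at hx ⊢
      have h4 := hW.down_max o.2 le_rfl x hx
      rw [trimmedEnds_down le_rfl]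
      omega

lemma isEnds_south (h : PineconeEnds o k P E) (hclosed : IsClosed P)
    (ho : (o.1 + o.2) % 2 = 0) (hW : SecondEnds (IsBlackSquare P) o E W) :
    IsEnds (IsBlackSquare P) (o.1 + 1, o.2 - 1) (k - 1) (southEnds o E W) := by
  have hB := IsBlackSquare.emod_two (P := P)
  have hE := h.isEnds hclosed ho
  have hC := (hW.isEnds hB ho h.mid).trim hB ho
  have hm1 := h.mid
  have hm2 := h.mid'
  have hu := hE.down o.2 le_rfl
  constructor
  · simp only
    rw [sub_add_cancel, southEnds_mid, southEnds_down (by omega)]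
  · simp only
    rw [southEnds_down (by omega)]
    rcases hu with h1 | ⟨h1, h2, h3⟩
    · omega
    · exact Or.inr ⟨by omega, by omega, h3⟩
  · intro x hx h1 h2
    simp only at hx h1 h2 ⊢
    have := h.bounds_of_isBlackSquare hx
    rw [southEnds_down (by omega)]
    omega
  · intro y hy
    simp only at hy ⊢
    rw [southEnds_up (by omega)]
    rcases (show o.2 ≤ y by omega).lt_or_eq with hy | rfl
    · rw [southEnds_up (by omega)]
      refine (hC.up y (by simp only; omega)).imp ?_ fun h1 => ⟨?_, h1.2⟩
      · simp only; omega
      · have := h1.1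
        simp only at this
        omega
    · rw [southEnds_mid]
      have h4 := hW.down_lt o.2 le_rfl
      have h5 := hW.mid
      have h6 := hC.mid
      simp only at h6
      rw [h6]
      rcases hC.last with h1 | ⟨h1, h2, h3⟩
      · simp only at h1
        omega
      · simp only at h1 h2 h3
        refine Or.inr ⟨by omega, ?_, h3⟩
        rw [trimmedEnds_down le_rfl] at h1 ⊢
        omega
  · intro y hy x hx h1 h2
    simp only at hy hx h1 h2 ⊢
    rw [southEnds_up (by omega)]
    rcases (show o.2 ≤ y by omega).lt_or_eq with hy | rfl
    · rw [southEnds_up (by omega)] at h2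
      exact hC.up_max y (by simp only; omega) x hx (by simp only; omega) h2
    · rw [southEnds_mid] at h2
      have h4 := hW.down_max o.2 le_rfl x hx
      have h5 := hW.mid
      rw [trimmedEnds_up (by omega)]
      omega
  · intro y hy
    simp only at hy ⊢
    rw [southEnds_down (by omega), southEnds_down (by omega)]
    refine (hE.down y (by omega)).imp (by omega) fun h1 => ⟨by omega, h1.2⟩
  · intro y hy x hx h1 h2
    simp only at hy hx h1 h2 ⊢
    rw [southEnds_down (by omega)] at h2 ⊢
    exact hE.down_max y (by omega) x hx (by omega) h2

end PineconeEnds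

lemma specialWeight_of_ordinary {P : LatticeGraph} {x y : ℤ}
    (hx : P.Adj (x, y) (x + 1, y) → IsOrdinaryAt P x y) :
    specialWeight P (hEdge (x, y)) = 1 := by
  rw [specialWeight_hEdge, if_neg]
  rintro ⟨h1, h2⟩
  exact h2 (hx h1)

namespace PineconeEnds

variable {o : ℤ × ℤ} {k : ℕ} {P : LatticeGraph} {E W : ℤ → ℤ}

/-! ### Special edges among the forced edges -/

lemma not_isSpecialAt_of_lt (h : PineconeEnds o k P E) {x y : ℤ} (hx : E y < x + 1) :
    ¬ IsSpecialAt P (x, y) := by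
  rintro ⟨h1, -⟩
  have := (h.adj x y).1 h1
  omega

lemma specialWeight_of_lt (h : PineconeEnds o k P E) {x y : ℤ} (hx : E y < x + 1) :
    specialWeight P (hEdge (x, y)) = 1 := by
  rw [specialWeight_hEdge, if_neg (h.not_isSpecialAt_of_lt hx)]

/-- Forced edges beyond the ends of `P` are not edges of `P`, hence weigh 1. This settles `A` and
`A_E`. -/
lemma prod_forced_eq_one (h : PineconeEnds o k P E) {o' : ℤ × ℤ} {n : ℤ} {F : ℤ → ℤ}
    (hF : ∀ y, E y ≤ F y) : ∏ v ∈ forcedVerts o' n F, specialWeight P (hEdge v) = 1 := by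
  refine Finset.prod_eq_one fun v hv => ?_
  obtain ⟨x, y⟩ := v
  have h1 := (mem_forcedVerts.1 hv).2.2.1
  have h2 := hF y
  exact h.specialWeight_of_lt (by omega)

lemma le_trimmedEnds (F : ℤ → ℤ) (y : ℤ) : F y ≤ trimmedEnds o F y := by
  unfold trimmedEnds
  split_ifs <;> exact le_max_left _ _

/-- Above ordinate `o.2 + 1` the forced edges lie outside `P`; at that ordinate those belonging to
`P` are ordinary, the next black square being the last one of row `o.2`. The remaining forced edges
are those of the lower half of the central diamond. -/
lemma prod_forced_north (h : PineconeEnds o k P E) (hclosed : IsClosed P)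
    (ho : (o.1 + o.2) % 2 = 0) :
    ∏ v ∈ forcedVerts (o.1 + 1, o.2 + 1) (k - 1) (northEnds o E W), specialWeight P (hEdge v) =
      ∏ v ∈ (forcedVerts (o.1 + 2, o.2) (k - 1 - 1) (trimmedEnds o W)).filter (¬ o.2 < ·.2),
        specialWeight P (hEdge v) := by
  refine (Finset.prod_subset ?_ ?_).symm
  · rintro ⟨x, y⟩ hv
    simp only [Finset.mem_filter, mem_forcedVerts, mem_rootedDiamond] at hv ⊢
    rw [northEnds_down (by omega)]
    omega
  · rintro ⟨x, y⟩ hv hv'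
    simp only [Finset.mem_filter, mem_forcedVerts, mem_rootedDiamond] at hv hv'
    rcases lt_trichotomy y (o.2 + 1) with hy | rfl | hy
    · rw [northEnds_down (by omega)] at hv
      omega
    · rw [northEnds_mid] at hv
      refine specialWeight_of_ordinary fun hadj => ⟨hadj, Or.inl ⟨Int.even_iff.2 (by omega),
        E (o.2 + 1) - 1, ?_, ?_, ?_⟩⟩
      · have := (h.adj _ _).1 hadj
        omega
      · have hm1 := h.mid
        have hm2 := h.mid'
        have hpos := h.pos
        rcases ((h.isEnds hclosed ho).up_cases IsBlackSquare.emod_two ho (o.2 + 1)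
          (by omega)).2 with h1 | h1
        · omega
        · exact h1.2.2.2
      · intro z hz1 hz2 hz
        have := h.bounds_of_isBlackSquare hz
        rw [add_assoc o.2, one_add_one_eq_two] at this
        omega
    · rw [northEnds_up hy] at hv
      exact h.specialWeight_of_lt (by omega)

/-- Mirror image of the North case. Together they account for each forced edge of the central
diamond once. -/
lemma prod_forced_south (h : PineconeEnds o k P E) (hclosed : IsClosed P)
    (ho : (o.1 + o.2) % 2 = 0) :
    ∏ v ∈ forcedVerts (o.1 + 1, o.2 - 1) (k - 1) (southEnds o E W), specialWeight P (hEdge v) =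
      ∏ v ∈ (forcedVerts (o.1 + 2, o.2) (k - 1 - 1) (trimmedEnds o W)).filter (o.2 < ·.2),
        specialWeight P (hEdge v) := by
  refine (Finset.prod_subset ?_ ?_).symm
  · rintro ⟨x, y⟩ hv
    simp only [Finset.mem_filter, mem_forcedVerts, mem_rootedDiamond] at hv ⊢
    rw [southEnds_up (by omega)]
    omega
  · rintro ⟨x, y⟩ hv hv'
    simp only [Finset.mem_filter, mem_forcedVerts, mem_rootedDiamond] at hv hv'
    rcases lt_trichotomy y o.2 with hy | rfl | hy
    · rw [southEnds_down hy] at hv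
      exact h.specialWeight_of_lt (by omega)
    · rw [southEnds_mid] at hv
      refine specialWeight_of_ordinary fun hadj => ⟨hadj, Or.inr ⟨Int.odd_iff.2 (by omega),
        E o.2 - 1, ?_, ?_, ?_⟩⟩
      · have := (h.adj _ _).1 hadj
        omega
      · have hm1 := h.mid
        have hpos := h.pos
        rcases ((h.isEnds hclosed ho).down_cases IsBlackSquare.emod_two ho o.2
          le_rfl).2 with h1 | h1
        · omega
        · exact h1.2.2.2
      · intro z hz1 hz2 hz
        have := h.bounds_of_isBlackSquare hz
        omega
    · rw [southEnds_up hy] at hv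
      omega

/-- Compared with the central diamond, the West one has extra forced edges only on the left
boundary, in rows where the second end is absent. Below ordinate `o.2 + i` these are ordinary, above
it they lie outside `P`, and at that ordinate the edge is the special edge `a`. If `i = k`, then `a`
is instead the top edge of `A`. -/
lemma prod_forced_west_up (h : PineconeEnds o k P E) (hclosed : IsClosed P)
    (ho : (o.1 + o.2) % 2 = 0) (hW : SecondEnds (IsBlackSquare P) o E W) {i : ℕ} (hi : 1 ≤ i)
    (hup : ∀ y, o.2 < y → (o.1 + (y - o.2) - 1 < E y ↔ y ≤ o.2 + i)) :
    specialWeight P (hEdge (o.1 + k - 1, o.2 + k)) *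
        ∏ v ∈ (forcedVerts o (k - 1) W).filter (o.2 < ·.2), specialWeight P (hEdge v) =
      X (hEdge (o.1 + i - 1, o.2 + i)) *
        ∏ v ∈ (forcedVerts (o.1 + 2, o.2) (k - 1 - 1) (trimmedEnds o W)).filter (o.2 < ·.2),
          specialWeight P (hEdge v) := by
  classical
  have hE := h.isEnds hclosed ho
  have hB := IsBlackSquare.emod_two (P := P)
  have hreal := (hup (o.2 + i) (by omega)).2 le_rfl
  have hnext : E (o.2 + i + 1) ≤ o.1 + i - 1 := by
    have h1 := hup (o.2 + i + 1) (by omega)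
    have h2 := h.up (o.2 + i) (by omega)
    omega
  have hik : i ≤ k := by
    rcases (hE.up_cases hB ho (o.2 + i) (by omega)).2 with h1 | h1 <;> omega
  have hWi : W (o.2 + i) = o.1 + i - 2 := by
    have h1 := hW.up_lt (o.2 + i) (by omega)
    rcases hW.up (o.2 + i) (by omega) with h2 | h2 <;> omega
  -- By parity, `a` could be ordinary only through a black square in the row above it, which is
  -- beyond the top of `P`.
  have hspec : specialWeight P (hEdge (o.1 + i - 1, o.2 + i)) =
      X (hEdge (o.1 + i - 1, o.2 + i)) := by
    rw [specialWeight_hEdge, if_pos]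
    refine ⟨(h.adj _ _).2 (by omega), ?_⟩
    rintro ⟨-, ⟨h1, -⟩ | ⟨-, z, hz1, hz2, -⟩⟩
    · have := Int.even_iff.1 h1
      simp only at this
      omega
    · have := h.bounds_of_isBlackSquare hz2
      simp only at this hz1
      omega
  rw [← hspec, ← Finset.prod_insert (f := fun v => specialWeight P (hEdge v)),
    ← Finset.prod_insert (f := fun v => specialWeight P (hEdge v))]
  · refine (Finset.prod_subset ?_ ?_).symm
    · intro v hv
      obtain ⟨x, y⟩ := v
      simp only [Finset.mem_insert, Finset.mem_filter, mem_forcedVerts, mem_rootedDiamond,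
        Prod.mk.injEq] at hv ⊢
      rcases hv with ⟨rfl, rfl⟩ | hv
      · rcases hik.lt_or_eq with hik | rfl
        · right
          rw [hWi]
          omega
        · exact Or.inl ⟨rfl, rfl⟩
      · rw [trimmedEnds_up hv.2] at hv
        right
        omega
    · intro v hv hv'
      obtain ⟨x, y⟩ := v
      simp only [Finset.mem_insert, Finset.mem_filter, mem_forcedVerts, mem_rootedDiamond,
        Prod.mk.injEq, not_or] at hv hv'
      rcases lt_or_ge (o.2 + i) y with hy | hy
      · have h1 := hup y (by omega)
        refine h.specialWeight_of_lt ?_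
        omega
      · have hlt : i < k ∨ i = k := by omega
        have hv1 : o.2 < y ∧ x = o.1 + (y - o.2) - 1 ∧ W y < x ∧ y < o.2 + i := by
          rcases hv with hv | hv
          · omega
          · rw [trimmedEnds_up hv.2] at hv'
            have h3 := hW.up y hv.2
            omega
        obtain ⟨hy0, rfl, hWy, hyi⟩ := hv1
        have hr := (hup (y + 1) (by omega)).2 (by omega)
        have hr' := hE.up y hy0
        -- The next segment up ends at a black square of row `y`; with no second black square in row
        -- `y - 1`, that row's first candidate comes only at `E y`, which is further right.
        refine specialWeight_of_ordinary fun hadj => ⟨hadj, Or.inr ⟨Int.odd_iff.2 (by omega),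
          E (y + 1) - 1, by omega, ?_, ?_⟩⟩
        · rcases hr' with hr' | hr'
          · omega
          · exact hr'.2.2
        · intro z hz1 hz2 hz
          have := hW.up_max y hy0 z hz (by omega)
          omega
  · simp only [Finset.mem_filter, mem_forcedVerts, mem_rootedDiamond]
    omega
  · simp only [Finset.mem_filter, mem_forcedVerts, mem_rootedDiamond]
    omega

lemma prod_forced_west_down (h : PineconeEnds o k P E) (hclosed : IsClosed P)
    (ho : (o.1 + o.2) % 2 = 0) (hW : SecondEnds (IsBlackSquare P) o E W) {j : ℕ}
    (hdown : ∀ y, y ≤ o.2 → (o.1 + (o.2 - y) < E y ↔ o.2 - j ≤ y)) :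
    specialWeight P (hEdge (o.1 + k - 1, o.2 - k + 1)) *
        ∏ v ∈ (forcedVerts o (k - 1) W).filter (¬ o.2 < ·.2), specialWeight P (hEdge v) =
      X (hEdge (o.1 + j, o.2 - j)) *
        ∏ v ∈ (forcedVerts (o.1 + 2, o.2) (k - 1 - 1) (trimmedEnds o W)).filter (¬ o.2 < ·.2),
          specialWeight P (hEdge v) := by
  classical
  have hE := h.isEnds hclosed ho
  have hB := IsBlackSquare.emod_two (P := P)
  have hreal := (hdown (o.2 - j) (by omega)).2 le_rfl
  have hnext : E (o.2 - j - 1) ≤ o.1 + j + 1 := by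
    have := hdown (o.2 - j - 1) (by omega)
    omega
  have hjk : j + 1 ≤ k := by
    rcases (hE.down_cases hB ho (o.2 - j) (by omega)).2 with h1 | h1 <;> omega
  have hpj := (hE.down_cases hB ho (o.2 - j - 1) (by omega)).1
  have hWj : W (o.2 - j) = o.1 + j - 1 := by
    have h1 := hW.down_lt (o.2 - j) (by omega)
    rcases hW.down (o.2 - j) (by omega) with h2 | ⟨h2, -, h3⟩
    · omega
    · have := hB _ _ h3
      omega
  have hspec : specialWeight P (hEdge (o.1 + j, o.2 - j)) = X (hEdge (o.1 + j, o.2 - j)) := by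
    rw [specialWeight_hEdge, if_pos]
    refine ⟨(h.adj _ _).2 (by omega), ?_⟩
    rintro ⟨-, ⟨-, z, hz1, hz2, -⟩ | ⟨h1, -⟩⟩
    · have := h.bounds_of_isBlackSquare hz2
      simp only at this hz1
      omega
    · have := Int.odd_iff.1 h1
      simp only at this
      omega
  rw [← hspec, ← Finset.prod_insert (f := fun v => specialWeight P (hEdge v)),
    ← Finset.prod_insert (f := fun v => specialWeight P (hEdge v))]
  · refine (Finset.prod_subset ?_ ?_).symm
    · intro v hv
      obtain ⟨x, y⟩ := v
      simp only [Finset.mem_insert, Finset.mem_filter, mem_forcedVerts, mem_rootedDiamond,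
        Prod.mk.injEq] at hv ⊢
      rcases hv with ⟨rfl, rfl⟩ | hv
      · rcases hjk.lt_or_eq with hjk | hjk
        · right
          rw [hWj]
          omega
        · left
          omega
      · rw [trimmedEnds_down (by omega)] at hv
        right
        omega
    · intro v hv hv'
      obtain ⟨x, y⟩ := v
      simp only [Finset.mem_insert, Finset.mem_filter, mem_forcedVerts, mem_rootedDiamond,
        Prod.mk.injEq, not_or] at hv hv'
      rcases lt_or_ge y (o.2 - j) with hy | hy
      · have h1 := hdown y (by omega)
        have h2 := (hE.down_cases hB ho y (by omega)).1
        refine h.specialWeight_of_lt ?_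
        omega
      · have hlt : j + 1 < k ∨ j + 1 = k := by omega
        have hv1 : y ≤ o.2 ∧ x = o.1 + (o.2 - y) ∧ W y < x ∧ o.2 - j < y := by
          rcases hv with hv | hv
          · omega
          · rw [trimmedEnds_down (by omega)] at hv'
            have h3 := hW.down y (by omega)
            omega
        obtain ⟨hy0, rfl, hWy, hyi⟩ := hv1
        have hr := (hdown (y - 1) (by omega)).2 (by omega)
        have hr' := hE.down y hy0
        refine specialWeight_of_ordinary fun hadj => ⟨hadj, Or.inl ⟨Int.even_iff.2 (by omega),
          E (y - 1) - 1, by omega, ?_, ?_⟩⟩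
        · rcases hr' with hr' | hr'
          · omega
          · exact hr'.2.2
        · intro z hz1 hz2 hz
          have := hW.down_max y hy0 z hz (by omega)
          omega
  · simp only [Finset.mem_filter, mem_forcedVerts, mem_rootedDiamond]
    omega
  · simp only [Finset.mem_filter, mem_forcedVerts, mem_rootedDiamond]
    omega

/-! ### Distinguished edges -/

lemma isLeftEdge_iff (h : PineconeEnds o k P E) {x y : ℤ} :
    IsLeftEdge P (x, y) ↔ (-1 ≤ x - y - o.1 + o.2 ∧ 0 ≤ x + y - o.1 - o.2 ∧ x + 1 ≤ E y) ∧
      ¬ (-1 ≤ x - 1 - y - o.1 + o.2 ∧ 0 ≤ x - 1 + y - o.1 - o.2) := by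
  have h2 := h.adj (x - 1) y
  rw [sub_add_cancel] at h2
  rw [IsLeftEdge, h.adj, h2]
  omega

lemma isHighestLeftEdge (h : PineconeEnds o k P E) {i : ℕ} (hi : 1 ≤ i)
    (hup : ∀ y, o.2 < y → (o.1 + (y - o.2) - 1 < E y ↔ y ≤ o.2 + i)) :
    IsHighestLeftEdge P (o.1 + i - 1, o.2 + i) := by
  have hreal := (hup (o.2 + i) (by omega)).2 le_rfl
  refine ⟨h.isLeftEdge_iff.2 (by omega), ?_⟩
  rintro ⟨x, y⟩ hu hne
  rw [h.isLeftEdge_iff] at hu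
  rw [Ne, Prod.mk.injEq] at hne
  simp only
  have := hup y
  omega

lemma isLowestLeftEdge (h : PineconeEnds o k P E) {j : ℕ}
    (hdown : ∀ y, y ≤ o.2 → (o.1 + (o.2 - y) < E y ↔ o.2 - j ≤ y)) :
    IsLowestLeftEdge P (o.1 + j, o.2 - j) := by
  have hreal := (hdown (o.2 - j) (by omega)).2 le_rfl
  refine ⟨h.isLeftEdge_iff.2 (by omega), ?_⟩
  rintro ⟨x, y⟩ hu hne
  rw [h.isLeftEdge_iff] at hu
  rw [Ne, Prod.mk.injEq] at hne
  simp only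
  have := hdown y
  omega

lemma isEastmostEdge (h : PineconeEnds o k P E) (hclosed : IsClosed P)
    (ho : (o.1 + o.2) % 2 = 0) : IsEastmostEdge P (o.1 + 2 * k - 1, o.2) := by
  have hE := h.isEnds hclosed ho
  have hB := IsBlackSquare.emod_two (P := P)
  have hm := h.mid
  have hpos := h.pos
  refine ⟨?_, ?_⟩
  · have := h.adj_right_end_down hclosed le_rfl (by omega)
    rwa [hm] at this
  · rintro ⟨x, y⟩ hu hne
    have h1 := (h.verts _ _).1 hu.fst_mem
    have h2 := (h.verts _ _).1 hu.snd_mem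
    rw [Ne, Prod.mk.injEq] at hne
    simp only at h1 h2 ⊢
    rcases lt_trichotomy y o.2 with hy | rfl | hy
    · rcases (hE.down_cases hB ho y hy.le).2 with h3 | h3 <;> omega
    · omega
    · rcases (hE.up_cases hB ho (y + 1) (by omega)).2 with h3 | h3 <;> omega

lemma isWestmostEdge (h : PineconeEnds o k P E) (ho : (o.1 + o.2) % 2 = 0) :
    IsWestmostEdge P o := by
  have hm := h.mid
  have hm' := h.mid'
  have hpos := h.pos
  refine ⟨h.even _ _ ho ((h.verts _ _).2 (by omega)) ((h.verts _ _).2 (by omega)), ?_⟩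
  rintro ⟨x, y⟩ hu hne
  have h1 := (h.verts _ _).1 hu.fst_mem
  have h2 := (h.verts _ _).1 hu.snd_mem
  rw [Ne, Prod.ext_iff] at hne
  simp only at h1 h2 hne ⊢
  omega

end PineconeEnds

/-! ### Assembling the identity. -/

lemma specialWeight_vEdge_of_adj {P : LatticeGraph} {v : ℤ × ℤ} (h : P.Adj v (v.1, v.2 + 1)) :
    specialWeight P (vEdge v) = X (vEdge v) := by
  rw [specialWeight_vEdge, if_pos (Or.inl h)]

lemma prod_specialWeight_hEdge_ne_zero (P : LatticeGraph) (s : Finset (ℤ × ℤ)) :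
    ∏ v ∈ s, specialWeight P (hEdge v) ≠ 0 := by
  refine Finset.prod_ne_zero_iff.2 fun v _ => ?_
  rw [specialWeight_hEdge]
  split_ifs
  · exact X_ne_zero _
  · exact one_ne_zero

/-- The matching sum of a sub-diamond of the completion of `P`, in terms of its core. -/
lemma matchSum_eq_prod_mul_core {P : LatticeGraph} {o o' c : ℤ × ℤ} {k : ℕ} {n : ℤ}
    {E F : ℤ → ℤ} (h : PineconeEnds o k P E) (ho : (o.1 + o.2) % 2 = 0)
    (hF : IsEnds (IsBlackSquare P) o' n F) (ho' : (o'.1 + o'.2) % 2 = 0)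
    (hc : c = (o'.1 + n - 1, o'.2)) (hsub : diamondVerts c n ⊆ diamondVerts (centre o k) k)
    (hrow : ∀ x y, (x, y) ∈ rootedDiamond o' n → x + 1 ≤ F y → x + 1 ≤ E y) :
    matchSum (diamondVerts c n) (specialWeight P) =
      (∏ v ∈ forcedVerts o' n F, specialWeight P (hEdge v)) *
        partialMatchingPoly (core o' (completion o k P ⊓ diamond c n)) := by
  have hodd := h.isBlackSquare_of_odd ho
  subst hc
  rw [completion_inf_diamond _ _ _ _ _ hsub]
  rw [← rootedDiamond, core_completedOn hF ho' hodd]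
  refine matchSum_specialWeight hF ho' hodd fun x y h1 h2 => (h.adj x y).2 ?_
  have h3 := mem_coreVerts.1 h1
  have h4 := mem_coreVerts.1 h2
  have h5 := hrow x y h3.1 h4.2
  have h6 : (x, y) ∈ diamondVerts (centre o k) k := hsub h3.1
  rw [mem_diamondVerts] at h6
  simp only [centre] at h6
  omega

end LatticeGraph

open LatticeGraph in
theorem mainTheorem7 (o : ℤ × ℤ) (k : ℕ) (P : LatticeGraph)
    (hP : LatticeGraph.IsPinecone o k P)
    (hclosed : LatticeGraph.IsClosed P)
    (hinter : LatticeGraph.IsInterleaved P) :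
    ∃ a a' e w : ℤ × ℤ,
      LatticeGraph.IsHighestLeftEdge P a ∧ LatticeGraph.IsLowestLeftEdge P a' ∧
      LatticeGraph.IsEastmostEdge P e ∧ LatticeGraph.IsWestmostEdge P w ∧
      LatticeGraph.partialMatchingPoly P *
          LatticeGraph.partialMatchingPoly (LatticeGraph.subC o k P) =
        MvPolynomial.X (hEdge a) * MvPolynomial.X (hEdge a') *
            LatticeGraph.partialMatchingPoly (LatticeGraph.subW o k P) *
            LatticeGraph.partialMatchingPoly (LatticeGraph.subE o k P) +
          MvPolynomial.X (vEdge e) * MvPolynomial.X (vEdge w) *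
            LatticeGraph.partialMatchingPoly (LatticeGraph.subN o k P) *
            LatticeGraph.partialMatchingPoly (LatticeGraph.subS o k P) := by
  classical
  obtain ⟨ho, i, j, E, hE, hi, hup, hdown⟩ := hP.exists_ends
  obtain ⟨W, hW⟩ := hE.exists_secondEnds hclosed ho hinter
  have hB := IsBlackSquare.emod_two (P := P)
  have endsA := hE.isEnds hclosed ho
  have endsW := hW.isEnds hB ho hE.mid
  have endsE := endsA.trim hB ho
  have endsC := endsW.trim hB ho
  have endsN := hE.isEnds_north hclosed ho hW
  have endsS := hE.isEnds_south hclosed ho hW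
  have east := hE.isEastmostEdge hclosed ho
  have west := hE.isWestmostEdge ho
  refine ⟨(o.1 + i - 1, o.2 + i), (o.1 + j, o.2 - j), (o.1 + 2 * k - 1, o.2), o,
    hE.isHighestLeftEdge hi hup, hE.isLowestLeftEdge hdown, east, west, ?_⟩
  have hWE : ∀ x y, (x, y) ∈ diamondVerts (centre o k) k → x + 1 ≤ W y → x + 1 ≤ E y := by
    intro x y hx hxW
    rw [mem_diamondVerts] at hx
    simp only [centre] at hx
    rcases lt_or_ge o.2 y with hy | hy
    · rcases hW.up y hy with h1 | h1 <;> omega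
    · rcases hW.down y hy with h1 | h1 <;> omega
  have hsubdiamond : ∀ (c : ℤ × ℤ) (n : ℤ), |c.1 - (centre o k).1| + |c.2 - (centre o k).2| ≤ k - n →
      diamondVerts c n ⊆ diamondVerts (centre o k) k := by
    intro c n hcn v hv
    have := abs_add_abs_lt_iff.1 (Int.lt_add_one_of_le hcn)
    rw [mem_diamondVerts] at hv ⊢
    omega
  -- For `A` itself the core is all of `P`, and every forced edge weighs 1.
  have zA : matchSum (diamondVerts (centre o k) k) (specialWeight P) = partialMatchingPoly P := by
    have h1 := matchSum_specialWeight endsA ho (hE.isBlackSquare_of_odd ho) (fun x y h1 h2 => by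
      have h3 := (mem_coreVerts.1 h2).2
      have h4 := mem_rootedDiamond.1 (mem_coreVerts.1 h1).1
      exact (hE.adj x y).2 (by omega))
    rw [hE.prod_forced_eq_one fun y => le_rfl, one_mul, ← hE.eq_completedOn hclosed ho] at h1
    exact h1
  have zW := matchSum_eq_prod_mul_core (c := centre o k + (-1, 0)) hE ho endsW ho
    (by simp [centre, Prod.ext_iff]; ring) (hsubdiamond _ _ (by simp))
    (fun x y hx hxW => by
      rw [mem_rootedDiamond] at hx
      exact hWE x y (mem_diamondVerts.2 (by simp only [centre]; omega)) hxW)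
  have zE := matchSum_eq_prod_mul_core (c := centre o k + (1, 0)) hE ho endsE
    (by simp only; omega)
    (by simp [centre, Prod.ext_iff]; ring) (hsubdiamond _ _ (by simp))
    (fun x y hx hxW => by
      rw [mem_rootedDiamond] at hx
      unfold trimmedEnds at hxW
      simp only at hx
      split_ifs at hxW <;> omega)
  have zC := matchSum_eq_prod_mul_core (c := centre o k) hE ho endsC
    (by simp only; omega)
    (by simp only [centre, Prod.mk.injEq, and_true]; ring) (hsubdiamond _ _ (by simp only [sub_self, abs_zero]; omega))
    (fun x y hx hxW => by
      rw [mem_rootedDiamond] at hx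
      simp only at hx
      refine hWE x y (mem_diamondVerts.2 (by simp only [centre]; omega)) ?_
      unfold trimmedEnds at hxW
      split_ifs at hxW <;> omega)
  have zN := matchSum_eq_prod_mul_core (c := centre o k + (0, 1)) hE ho endsN
    (by simp only; omega)
    (by simp [centre]) (hsubdiamond _ _ (by simp))
    (fun x y hx hxW => by
      rw [mem_rootedDiamond] at hx
      simp only at hx
      rcases lt_trichotomy y (o.2 + 1) with hy | rfl | hy
      · rw [northEnds_down (by omega), trimmedEnds_down (by omega)] at hxW
        exact hWE x y (mem_diamondVerts.2 (by simp only [centre]; omega)) (by omega)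
      · rw [northEnds_mid] at hxW
        have := hE.up (o.2 + 1) (by omega)
        rw [add_assoc, one_add_one_eq_two] at this
        omega
      · rwa [northEnds_up hy] at hxW)
  have zS := matchSum_eq_prod_mul_core (c := centre o k + (0, -1)) hE ho endsS
    (by simp only; omega)
    (by simp [centre, Prod.ext_iff]; ring) (hsubdiamond _ _ (by simp))
    (fun x y hx hxW => by
      rw [mem_rootedDiamond] at hx
      simp only at hx
      rcases lt_trichotomy y o.2 with hy | rfl | hy
      · rwa [southEnds_down hy] at hxW
      · rw [southEnds_mid] at hxW
        have := hE.down o.2 le_rfl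
        omega
      · rw [southEnds_up (by omega), trimmedEnds_up (by omega)] at hxW
        exact hWE x y (mem_diamondVerts.2 (by simp only [centre]; omega)) (by omega))
  have fE := hE.prod_forced_eq_one (o' := (o.1 + 2, o.2)) (n := k - 1)
    (PineconeEnds.le_trimmedEnds (o := o) E)
  have fN := hE.prod_forced_north (W := W) hclosed ho
  have fS := hE.prod_forced_south (W := W) hclosed ho
  have fW1 := hE.prod_forced_west_up hclosed ho hW hi hup
  have fW2 := hE.prod_forced_west_down hclosed ho hW hdown
  have fW := Finset.prod_filter_mul_prod_filter_not (forcedVerts o (k - 1) W)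
    (o.2 < ·.2) (fun v => specialWeight P (hEdge v))
  have fC := Finset.prod_filter_mul_prod_filter_not
    (forcedVerts (o.1 + 2, o.2) (k - 1 - 1) (trimmedEnds o W))
    (o.2 < ·.2) (fun v => specialWeight P (hEdge v))
  have hC0 := prod_specialWeight_hEdge_ne_zero P
    (forcedVerts (o.1 + 2, o.2) (k - 1 - 1) (trimmedEnds o W))
  have cond := condensation (specialWeight P) (centre o k) (n := k) (by have := hE.pos; omega)
  have eK : ((k : ℤ) - 1 - 1) = k - 2 := by ring
  have eT : ((centre o k).1, (centre o k).2 + (k : ℤ)) = (o.1 + k - 1, o.2 + k) := rfl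
  have eB : ((centre o k).1, (centre o k).2 - (k : ℤ) + 1) = (o.1 + k - 1, o.2 - k + 1) := rfl
  have eR : ((centre o k).1 + (k : ℤ), (centre o k).2) = (o.1 + 2 * k - 1, o.2) := by
    simp only [centre, Prod.mk.injEq, and_true]; ring
  have eL : ((centre o k).1 - (k : ℤ) + 1, (centre o k).2) = o := by
    simp only [centre, Prod.ext_iff, and_true]; ring
  have eW : centre o k - (1, 0) = centre o k + (-1, 0) := by simp [Prod.ext_iff]; ring
  have eS : centre o k - (0, 1) = centre o k + (0, -1) := by simp [Prod.ext_iff]; ring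
  rw [Condensation, eT, eB, eR, eL, eW, eS, specialWeight_vEdge_of_adj east.1,
    specialWeight_vEdge_of_adj west.1, zA, zW, zE, zN, zS, fE, fN, fS, ← eK, zC, ← fW, ← fC] at cond
  rw [← fC] at hC0
  -- The forced weight of the central diamond is common to all three terms, once the West weights
  -- are rewritten.
  refine mul_left_cancel₀ hC0 ?_
  have oN : o + (1, 1) = (o.1 + 1, o.2 + 1) := rfl
  have oS : o + (1, -1) = (o.1 + 1, o.2 - 1) := rfl
  have oE : o + (2, 0) = (o.1 + 2, o.2) := by simp [Prod.ext_iff]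
  rw [subC, subW, subE, subN, subS, oN, oS, oE, ← eK]
  -- The two West identities are multiplied together: the first is scaled by the left side of the
  -- second, the second by the right side of the first.
  linear_combination cond + (partialMatchingPoly
      (core o (completion o k P ⊓ diamond (centre o k + (-1, 0)) (k - 1))) *
    partialMatchingPoly
      (core (o.1 + 2, o.2) (completion o k P ⊓ diamond (centre o k + (1, 0)) (k - 1)))) *
    ((specialWeight P (hEdge (o.1 + k - 1, o.2 - k + 1)) *
        ∏ v ∈ (forcedVerts o (k - 1) W).filter (¬ o.2 < ·.2), specialWeight P (hEdge v)) * fW1 +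
      (X (hEdge (o.1 + i - 1, o.2 + i)) *
        ∏ v ∈ (forcedVerts (o.1 + 2, o.2) (k - 1 - 1) (trimmedEnds o W)).filter (o.2 < ·.2),
          specialWeight P (hEdge v)) * fW2)
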